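/- Let $\ell,r\ge 1$, $\omega=(\omega_1,\dots,\omega_\ell)\in\mathbb C^\ell$ and $\underline c=(c_1,\dots,c_\ell)\in\{0,1\}^\ell$. Let $\mathscr H_{\ell,r}$ be the degenerate cyclotomic Hecke algebra, i.e. the unital associative $\mathbb C$-algebra generated by $s_1,\dots,s_{r-1},x_1,\dots,x_r$ with relations $s_i^2=1$; $s_is_j=s_js_i$ for $|i-j|>1$; $s_is_{i+1}s_i=s_{i+1}s_is_{i+1}$; $x_ix_j=x_jx_i$; $s_ix_j=x_js_i$ for $j\ne i,i+1$; $x_is_i-s_ix_{i+1}=-1=s_ix_i-x_{i+1}s_i$; and $(x_1-\omega_1)\cdots(x_1-\omega_\ell)=0$. Let $*$ be the anti-automorphism of $\mathscr H_{\ell,r}$ fixing $x_1$ and all $s_i$ (hence all $x_i$). The symmetric group $\mathfrak S_r$ acts on $\{1,\dots,r\}$ from the right, and $w\in\mathfrak S_r$ also denotes its image in $\mathscr H_{\ell,r}$ under $(i,i+1)\mapsto s_i$. Let $\Lambda_{\ell,r}$ be the set of $\ell$-partitions $\lambda=(\lambda^{(1)},\dots,\lambda^{(\ell)})$ of $r$,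 ordered by dominance: $\lambda\unrhd\mu$ iff $\sum_{t<s}|\lambda^{(t)}|+\sum_{j\le k}\lambda^{(s)}_j\ge\sum_{t<s}|\mu^{(t)}|+\sum_{j\le k}\mu^{(s)}_j$ for all $1\le s\le\ell$, $k\ge 0$. Let $\lambda'$ be the $\ell$-partition whose $(\ell+1-i)$th component is the conjugate of $\lambda^{(i)}$. Let $\mathrm{Std}(\lambda)$ be the set of standard $\lambda$-tableaux, $\mathfrak t^\lambda$ the one in which $1,\dots,r$ are entered successively along the rows of $\lambda^{(1)}$, then of $\lambda^{(2)}$, and so on, and for $\mathfrak t\in\mathrm{Std}(\lambda)$ let $d(\mathfrak t)\in\mathfrak S_r$ satisfy $\mathfrak t^\lambda d(\mathfrak t)=\mathfrak t$. Put $a_i=\sum_{j\le i}|\lambda^{(j)}|$ and $$\pi_{[\lambda]}=\prod_{i=1}^{\ell-1}\prod_{k=1}^{a_i}(x_k-\omega_{i+1}),\qquad \tilde\pi_{[\lambda]}=\prod_{i=1}^{\ell-1}\prod_{k=1}^{a_i}(x_k-\omega_{\ell-i}).$$ Let $\mathfrak S_{\lambda^{(i)}}$ be the row stabilizer of the $i$th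 component of $\mathfrak t^\lambda$, and let $x^0_{\lambda^{(i)}}=y^1_{\lambda^{(i)}}=\sum_{w\in\mathfrak S_{\lambda^{(i)}}}w$ and $x^1_{\lambda^{(i)}}=y^0_{\lambda^{(i)}}=\sum_{w\in\mathfrak S_{\lambda^{(i)}}}(-1)^{l(w)}w$, where $l(w)$ is the length of $w$. Put $x^{\underline c}_\lambda=\prod_{i=1}^\ell x^{c_i}_{\lambda^{(i)}}$ and $y^{\underline c}_\lambda=\prod_{i=1}^\ell y^{c_{\ell+1-i}}_{\lambda^{(i)}}$ (so that in $y^{\underline c}_{\lambda'}$ the conjugate of $\lambda^{(i)}$ goes with $c_i$). For $\mathfrak s,\mathfrak t\in\mathrm{Std}(\lambda)$ let $$m^{\underline c}_{\mathfrak s,\mathfrak t}=d(\mathfrak s)^{-1}\pi_{[\lambda]}x^{\underline c}_\lambda d(\mathfrak t),\qquad n^{\underline c}_{\mathfrak s,\mathfrak t}=d(\mathfrak s)^{-1}\tilde\pi_{[\lambda]}y^{\underline c}_\lambda d(\mathfrak t).$$ Then $\{m^{\underline c}_{\mathfrak s,\mathfrak t}\}$ and $\{n^{\underline c}_{\mathfrak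 s,\mathfrak t}\}$ ($\mathfrak s,\mathfrak t\in\mathrm{Std}(\lambda)$, $\lambda\in\Lambda_{\ell,r}$) are cellular bases of $\mathscr H_{\ell,r}$ in the sense of Graham and Lehrer, with respect to $*$ and the dominance order. Let $S^{\underline c}(\lambda)$ and $\tilde S^{\underline c}(\lambda)$ be the corresponding right cell modules; thus $S^{\underline c}(\lambda)$ has a basis $\{m^{\underline c}_{\mathfrak s}\mid\mathfrak s\in\mathrm{Std}(\lambda)\}$ with $m^{\underline c}_{\mathfrak s}a=\sum_{\mathfrak u}r_{\mathfrak s,\mathfrak u}(a^*)m^{\underline c}_{\mathfrak u}$, where $a\,m^{\underline c}_{\mathfrak s,\mathfrak t}\equiv\sum_{\mathfrak u}r_{\mathfrak s,\mathfrak u}(a)m^{\underline c}_{\mathfrak u,\mathfrak t}$ modulo the span of the $m^{\underline c}_{\mathfrak u,\mathfrak v}$ of shapes $\mu\rhd\lambda$; similarly for $\tilde S^{\underline c}(\lambda)$ with $n^{\underline c}$. For a right $\mathscr H_{\ell,r}$-module $M$ let $M^\circledast=\mathrm{Hom}_{\mathbb C}(M,\mathbb C)$ be its contragredient dual, with the right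 action $(fh)(m)=f(mh^*)$. Then, for every $\lambda\in\Lambda_{\ell,r}$, there is an isomorphism of right $\mathscr H_{\ell,r}$-modules $$S^{\underline c}(\lambda)^\circledast\;\cong\;\tilde S^{\underline c}(\lambda').$$ -/

import Mathlib

open MulOpposite

noncomputable section

/-! ### Cellular bases, cell modules and contragredient duals

Right `A`-modules are modules over `Aᵐᵒᵖ`, so `m a` is written `op a • m`.  An anti-automorphism `*`
of `A` is an algebra homomorphism `A →ₐ[ℂ] Aᵐᵒᵖ`. -/

namespace Cellular

section

variable {A : Type*} [Ring A] [Algebra ℂ A] {L : Type*} [PartialOrder L]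
  {M : L → Type*} [∀ l, Fintype (M l)]

/-- The span of the basis elements `C_{u,v}` whose shape is strictly greater than `l`. -/
def upper (C : (l : L) → M l → M l → A) (l : L) : Submodule ℂ A :=
  Submodule.span ℂ {a | ∃ m, l < m ∧ ∃ u v : M m, a = C m u v}

/-- Cellular bases in the sense of Graham and Lehrer, for the poset `L`, the finite sets `M l`
and the anti-involution `star`.  Here the cell ideals are indexed by the larger elements of the
poset, as is usual for the dominance order. -/
structure IsCellularBasis (star : A →ₐ[ℂ] Aᵐᵒᵖ) (C : (l : L) → M l → M l → A) : Prop where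
  linearIndependent : LinearIndependent ℂ (fun p : Σ l, M l × M l => C p.1 p.2.1 p.2.2)
  span_eq_top : Submodule.span ℂ (Set.range fun p : Σ l, M l × M l => C p.1 p.2.1 p.2.2) = ⊤
  star_star : ∀ a, unop (star (unop (star a))) = a
  star_basis : ∀ l (s t : M l), unop (star (C l s t)) = C l t s
  mul_basis : ∀ l (a : A), ∃ R : M l → M l → ℂ, ∀ s t : M l,
    a * C l s t - ∑ u, R s u • C l u t ∈ upper C l

variable {star : A →ₐ[ℂ] Aᵐᵒᵖ} {C : (l : L) → M l → M l → A}

/-- The scalars `r_{s,u}(a)`, determined by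
`a C_{s,t} ≡ ∑_u r_{s,u}(a) C_{u,t}` modulo larger shapes, for all `t`. -/
def IsCellularBasis.coeff (h : IsCellularBasis star C) (l : L) (a : A) : M l → M l → ℂ :=
  Classical.choose (h.mul_basis l a)

theorem IsCellularBasis.coeff_spec (h : IsCellularBasis star C) (l : L) (a : A) (s t : M l) :
    a * C l s t - ∑ u, h.coeff l a s u • C l u t ∈ upper C l :=
  Classical.choose_spec (h.mul_basis l a) s t

theorem IsCellularBasis.eq_zero_of_mem (h : IsCellularBasis star C) (l : L) (t : M l)
    (f : M l → ℂ) (hf : ∑ u, f u • C l u t ∈ upper C l) : f = 0 := by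
  classical
  let F : (Σ l, M l × M l) → A := fun p => C p.1 p.2.1 p.2.2
  let S : Set (Σ l, M l × M l) := {p | p.1 = l}
  let S' : Set (Σ l, M l × M l) := {p | l < p.1}
  have hd : Disjoint S S' := by
    rw [Set.disjoint_left]
    rintro p hp hp'
    have h1 : p.1 = l := hp
    have h2 : l < p.1 := hp'
    exact absurd h2 (by rw [h1]; exact lt_irrefl l)
  have hds := h.linearIndependent.disjoint_span_image hd
  have h1 : ∑ u, f u • C l u t ∈ Submodule.span ℂ (F '' S) := by
    refine Submodule.sum_mem _ fun u _ => Submodule.smul_mem _ _ (Submodule.subset_span ?_)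
    exact ⟨⟨l, u, t⟩, rfl, rfl⟩
  have h2 : ∑ u, f u • C l u t ∈ Submodule.span ℂ (F '' S') := by
    refine Submodule.span_mono ?_ hf
    rintro a ⟨m, hm, u, v, rfl⟩
    exact ⟨⟨m, u, v⟩, hm, rfl⟩
  have h0 : ∑ u, f u • C l u t = 0 := Submodule.disjoint_def.1 hds _ h1 h2
  have hli : LinearIndependent ℂ (fun u : M l => C l u t) := by
    refine h.linearIndependent.comp (fun u : M l => (⟨l, u, t⟩ : Σ l, M l × M l)) ?_
    intro u v huv
    simpa using huv
  funext u
  exact Fintype.linearIndependent_iff.1 hli f h0 u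

theorem IsCellularBasis.coeff_unique (h : IsCellularBasis star C) (l : L) (a : A)
    (R : M l → M l → ℂ)
    (hR : ∀ s t : M l, a * C l s t - ∑ u, R s u • C l u t ∈ upper C l) : h.coeff l a = R := by
  funext s
  have := h.eq_zero_of_mem l s (fun u => h.coeff l a s u - R s u) (by
    have := Submodule.sub_mem _ (hR s s) (h.coeff_spec l a s s)
    simpa [sub_smul, Finset.sum_sub_distrib] using this)
  funext u
  exact sub_eq_zero.1 (congrFun this u)

theorem IsCellularBasis.mul_mem_upper (h : IsCellularBasis star C) (l : L) (a z : A)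
    (hz : z ∈ upper C l) : a * z ∈ upper C l := by
  unfold upper at hz
  induction hz using Submodule.span_induction with
  | mem x hx =>
    obtain ⟨m, hm, u, v, rfl⟩ := hx
    have h1 := h.coeff_spec m a u v
    have h2 : upper C m ≤ upper C l := by
      refine Submodule.span_mono ?_
      rintro x ⟨n, hn, u, v, rfl⟩
      exact ⟨n, hm.trans hn, u, v, rfl⟩
    have h3 : ∑ w, h.coeff m a u w • C m w v ∈ upper C l :=
      Submodule.sum_mem _ fun w _ => Submodule.smul_mem _ _
        (Submodule.subset_span ⟨m, hm, w, v, rfl⟩)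
    simpa using Submodule.add_mem _ (h2 h1) h3
  | zero => simp
  | add x y _ _ hx hy => rw [mul_add]; exact Submodule.add_mem _ hx hy
  | smul c x _ hx => rw [mul_smul_comm]; exact Submodule.smul_mem _ _ hx

theorem IsCellularBasis.coeff_add (h : IsCellularBasis star C) (l : L) (a b : A) :
    h.coeff l (a + b) = h.coeff l a + h.coeff l b := by
  refine h.coeff_unique l _ _ fun s t => ?_
  have := Submodule.add_mem _ (h.coeff_spec l a s t) (h.coeff_spec l b s t)
  convert this using 1
  simp only [Pi.add_apply, add_smul, Finset.sum_add_distrib, add_mul]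
  abel

theorem IsCellularBasis.coeff_smul (h : IsCellularBasis star C) (l : L) (c : ℂ) (a : A) :
    h.coeff l (c • a) = c • h.coeff l a := by
  refine h.coeff_unique l _ _ fun s t => ?_
  have := Submodule.smul_mem _ c (h.coeff_spec l a s t)
  convert this using 1
  simp only [Pi.smul_apply, smul_sub, Finset.smul_sum, smul_mul_assoc, smul_assoc]

theorem IsCellularBasis.coeff_one [∀ l, DecidableEq (M l)] (h : IsCellularBasis star C) (l : L) :
    h.coeff l 1 = fun s u => if s = u then 1 else 0 := by
  refine h.coeff_unique l _ _ fun s t => ?_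
  simp [ite_smul]

theorem IsCellularBasis.coeff_mul (h : IsCellularBasis star C) (l : L) (a b : A) :
    h.coeff l (a * b) = fun s u => ∑ v, h.coeff l b s v * h.coeff l a v u := by
  refine h.coeff_unique l _ _ fun s t => ?_
  have h1 := h.mul_mem_upper l a _ (h.coeff_spec l b s t)
  have h2 : ∑ v, h.coeff l b s v • (a * C l v t - ∑ u, h.coeff l a v u • C l u t) ∈ upper C l :=
    Submodule.sum_mem _ fun v _ => Submodule.smul_mem _ _ (h.coeff_spec l a v t)
  have h3 := Submodule.add_mem _ h1 h2
  convert h3 using 1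
  simp only [mul_sub, Finset.mul_sum, mul_smul_comm, smul_sub, Finset.sum_sub_distrib,
    Finset.smul_sum, smul_smul, Finset.sum_smul, mul_assoc]
  rw [Finset.sum_comm]
  abel

/-- The right cell module of shape `l`: the vector space with basis `(C_s)`, `s ∈ M l`, where the
function `f` stands for `∑_s f s • C_s`. -/
def CellModule (_h : IsCellularBasis star C) (l : L) : Type _ := M l → ℂ

instance (h : IsCellularBasis star C) (l : L) : AddCommGroup (CellModule h l) :=
  inferInstanceAs (AddCommGroup (M l → ℂ))

instance (h : IsCellularBasis star C) (l : L) : Module ℂ (CellModule h l) :=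
  inferInstanceAs (Module ℂ (M l → ℂ))

/-- The right action `C_s a = ∑_u r_{s,u}(a^*) C_u`. -/
instance (h : IsCellularBasis star C) (l : L) : Module Aᵐᵒᵖ (CellModule h l) where
  smul a f := fun u => ∑ s, f s * h.coeff l (unop (star (unop a))) s u
  one_smul f := by
    classical
    funext u
    change ∑ s, f s * h.coeff l (unop (star (unop 1))) s u = f u
    simp only [unop_one, map_one, h.coeff_one, mul_ite, mul_one, mul_zero]
    exact (Finset.sum_ite_eq' Finset.univ u f).trans (if_pos (Finset.mem_univ u))
  mul_smul a b f := by
    funext u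
    change ∑ s, f s * h.coeff l (unop (star (unop (a * b)))) s u =
      ∑ v, (∑ s, f s * h.coeff l (unop (star (unop b))) s v) *
        h.coeff l (unop (star (unop a))) v u
    simp only [unop_mul, map_mul, h.coeff_mul, Finset.mul_sum, Finset.sum_mul]
    rw [Finset.sum_comm]
    simp only [mul_assoc]
  smul_zero a := by
    funext u
    change ∑ s, (0 : ℂ) * h.coeff l (unop (star (unop a))) s u = 0
    simp
  smul_add a f g := by
    funext u
    change ∑ s, (f s + g s) * h.coeff l (unop (star (unop a))) s u =
      ∑ s, f s * h.coeff l (unop (star (unop a))) s u +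
      ∑ s, g s * h.coeff l (unop (star (unop a))) s u
    simp only [add_mul, Finset.sum_add_distrib]
  add_smul a b f := by
    funext u
    change ∑ s, f s * h.coeff l (unop (star (unop (a + b)))) s u =
      ∑ s, f s * h.coeff l (unop (star (unop a))) s u +
      ∑ s, f s * h.coeff l (unop (star (unop b))) s u
    simp only [unop_add, map_add, h.coeff_add, Pi.add_apply, mul_add, Finset.sum_add_distrib]
  zero_smul f := by
    funext u
    have h0 : h.coeff l 0 = 0 := by
      have := h.coeff_smul l 0 0
      simpa using this
    change ∑ s, f s * h.coeff l (unop (star (unop 0))) s u = 0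
    simp [h0]

instance (h : IsCellularBasis star C) (l : L) : IsScalarTower ℂ Aᵐᵒᵖ (CellModule h l) where
  smul_assoc c a f := by
    funext u
    change ∑ s, f s * h.coeff l (unop (star (unop (c • a)))) s u =
      c * ∑ s, f s * h.coeff l (unop (star (unop a))) s u
    simp only [unop_smul, map_smul, h.coeff_smul, Pi.smul_apply, smul_eq_mul, Finset.mul_sum]
    exact Finset.sum_congr rfl fun s _ => by ring

end

section

variable {A : Type*} [Ring A] [Algebra ℂ A]

/-- The contragredient dual of a right `A`-module `V`: the space `Hom_ℂ(V, ℂ)`, on which `A` acts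
from the right by `(f a)(v) = f(v a^*)`. -/
def ContraDual (_star : A →ₐ[ℂ] Aᵐᵒᵖ) (V : Type*) [AddCommGroup V] [Module ℂ V] : Type _ :=
  V →ₗ[ℂ] ℂ

variable (star : A →ₐ[ℂ] Aᵐᵒᵖ) (V : Type*) [AddCommGroup V] [Module ℂ V]

instance : AddCommGroup (ContraDual star V) := inferInstanceAs (AddCommGroup (V →ₗ[ℂ] ℂ))

instance : Module ℂ (ContraDual star V) := inferInstanceAs (Module ℂ (V →ₗ[ℂ] ℂ))

instance [Module Aᵐᵒᵖ V] [IsScalarTower ℂ Aᵐᵒᵖ V] : Module Aᵐᵒᵖ (ContraDual star V) where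
  smul a f := LinearMap.comp (M₂ := V) f (Module.toModuleEnd ℂ (S := Aᵐᵒᵖ) V (star (unop a)))
  one_smul f := LinearMap.ext fun v => by
    change f.toFun (star (unop 1) • v) = f.toFun v
    simp
  mul_smul a b f := LinearMap.ext fun v => by
    change f.toFun (star (unop (a * b)) • v) = f.toFun (star (unop b) • star (unop a) • v)
    simp [mul_smul]
  smul_zero a := LinearMap.ext fun v => rfl
  smul_add a f g := LinearMap.ext fun v => rfl
  add_smul a b f := LinearMap.ext fun v => by
    change f.toFun (star (unop (a + b)) • v) =
      f.toFun (star (unop a) • v) + f.toFun (star (unop b) • v)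
    simp [add_smul]
  zero_smul f := LinearMap.ext fun v => by
    change f.toFun (star (unop 0) • v) = 0
    simp

end

end Cellular

/-! ### Multipartitions, standard tableaux and permutations -/

namespace DegHecke

/-- `ℓ`-partitions of `r`.  A box of a Young diagram is a pair (row, column). -/
@[ext]
structure MultiPartition (ℓ r : ℕ) where
  comp : Fin ℓ → YoungDiagram
  card_eq : ∑ i, (comp i).card = r

namespace MultiPartition

variable {ℓ r : ℕ}

/-- `a_i = |λ^{(1)}| + ⋯ + |λ^{(i)}|`. -/
def partialSize (l : MultiPartition ℓ r) (i : ℕ) : ℕ :=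
  ∑ t : Fin ℓ with t.val < i, (l.comp t).card

/-- The dominance order: `m ≤ l` means that `l` dominates `m`. -/
instance : PartialOrder (MultiPartition ℓ r) where
  le m l := ∀ (s : Fin ℓ) (k : ℕ),
    m.partialSize s + ∑ j ∈ Finset.range k, (m.comp s).rowLen j ≤
      l.partialSize s + ∑ j ∈ Finset.range k, (l.comp s).rowLen j
  le_refl _ _ _ := le_rfl
  le_trans _ _ _ h₁ h₂ s k := (h₁ s k).trans (h₂ s k)
  le_antisymm m l h₁ h₂ := by
    have h s k := le_antisymm (h₁ s k) (h₂ s k)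
    ext s ⟨i, j⟩
    have h0 := h s 0
    have h1 := h s i
    have h2 := h s (i + 1)
    simp only [Finset.range_zero, Finset.sum_empty, add_zero] at h0
    rw [Finset.sum_range_succ, Finset.sum_range_succ] at h2
    have h3 : (m.comp s).rowLen i = (l.comp s).rowLen i := by omega
    rw [YoungDiagram.mem_cells, YoungDiagram.mem_cells, YoungDiagram.mem_iff_lt_rowLen,
      YoungDiagram.mem_iff_lt_rowLen, h3]

/-- The dual `λ'`: conjugate all components and reverse their order. -/
def dual (l : MultiPartition ℓ r) : MultiPartition ℓ r where
  comp i := (l.comp i.rev).transpose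
  card_eq := by
    have h (μ : YoungDiagram) : μ.transpose.card = μ.card := Finset.card_map _
    simp only [h]
    exact (Equiv.sum_comp Fin.revPerm fun i => (l.comp i).card).trans l.card_eq

/-- The boxes of `λ`, as triples (component, row, column), ordered lexicographically. -/
abbrev Box (l : MultiPartition ℓ r) : Type :=
  {b : Fin ℓ ×ₗ (ℕ ×ₗ ℕ) // ofLex (ofLex b).2 ∈ l.comp (ofLex b).1}

namespace Box

variable {l : MultiPartition ℓ r}

def comp (b : l.Box) : Fin ℓ := (ofLex b.1).1

def row (b : l.Box) : ℕ := (ofLex (ofLex b.1).2).1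

def col (b : l.Box) : ℕ := (ofLex (ofLex b.1).2).2

end Box

def boxEquiv (l : MultiPartition ℓ r) : l.Box ≃ Σ i : Fin ℓ, (l.comp i).cells where
  toFun b := ⟨(ofLex b.1).1, ofLex (ofLex b.1).2, b.2⟩
  invFun c := ⟨toLex (c.1, toLex c.2.1), c.2.2⟩
  left_inv _ := rfl
  right_inv _ := rfl

instance (l : MultiPartition ℓ r) : Fintype l.Box := Fintype.ofEquiv _ l.boxEquiv.symm

theorem card_box (l : MultiPartition ℓ r) : Fintype.card l.Box = r := by
  rw [Fintype.card_congr l.boxEquiv, Fintype.card_sigma]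
  simpa using l.card_eq

/-- The tableau `t^λ`, in which the numbers increase along the rows of the first component, then
along the rows of the second one, and so on. -/
def initial (l : MultiPartition ℓ r) : l.Box ≃ Fin r :=
  (monoEquivOfFin l.Box l.card_box).symm.toEquiv

/-- A tableau is standard if, in each component, its entries increase along rows and down
columns. -/
def IsStandard {l : MultiPartition ℓ r} (t : l.Box ≃ Fin r) : Prop :=
  ∀ b b' : l.Box, b.comp = b'.comp →
    (b.row = b'.row → b.col < b'.col → t b < t b') ∧
    (b.col = b'.col → b.row < b'.row → t b < t b')

/-- The set of standard `λ`-tableaux. -/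
def Std (l : MultiPartition ℓ r) : Type := {t : l.Box ≃ Fin r // IsStandard t}

instance (l : MultiPartition ℓ r) : Fintype l.Std :=
  haveI : Finite l.Std := inferInstanceAs (Finite {t : l.Box ≃ Fin r // IsStandard t})
  Fintype.ofFinite _

end MultiPartition

/-- The symmetric group acting on `{1, …, r}` from the right: in a product `u * v`, first apply
`u` and then `v`. -/
abbrev Sym (r : ℕ) : Type := (Equiv.Perm (Fin r))ᵐᵒᵖ

/-- The indices `i` and `i + 1` belonging to the generator `s_i`. -/
def lo {r : ℕ} (i : Fin (r - 1)) : Fin r := ⟨i.val, by omega⟩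

def hi {r : ℕ} (i : Fin (r - 1)) : Fin r := ⟨i.val + 1, by omega⟩

/-- The simple transposition `(i, i + 1)`. -/
def simple {r : ℕ} (i : Fin (r - 1)) : Sym r := op (Equiv.swap (lo i) (hi i))

theorem exists_word {r : ℕ} (w : Sym r) : ∃ u : List (Fin (r - 1)), (u.map simple).prod = w := by
  obtain _ | n := r
  · exact ⟨[], MulOpposite.unop_injective (Subsingleton.elim _ _)⟩
  · have hw : w.unop ∈ Submonoid.closure
        (Set.range fun i : Fin n => Equiv.swap i.castSucc i.succ) := by
      rw [Equiv.Perm.mclosure_swap_castSucc_succ]; trivial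
    have key : ∀ p : Equiv.Perm (Fin (n + 1)), p ∈ Submonoid.closure
        (Set.range fun i : Fin n => Equiv.swap i.castSucc i.succ) →
        ∃ u : List (Fin (n + 1 - 1)), (u.map simple).prod = op p := by
      intro p hp
      induction hp using Submonoid.closure_induction with
      | mem x hx =>
        obtain ⟨i, rfl⟩ := hx
        exact ⟨[i], by simp only [List.map_cons, List.map_nil, List.prod_singleton]; rfl⟩
      | one => exact ⟨[], rfl⟩
      | mul x y _ _ hx hy =>
        obtain ⟨u, hu⟩ := hx
        obtain ⟨v, hv⟩ := hy
        exact ⟨v ++ u, by rw [List.map_append, List.prod_append, hu, hv, op_mul]⟩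
    exact key _ hw

/-- A word in the simple transpositions that represents `w`. -/
def word {r : ℕ} (w : Sym r) : List (Fin (r - 1)) := Classical.choose (exists_word w)

/-- The permutation `d(t)`, determined by `t^λ d(t) = t`. -/
def tableauPerm {ℓ r : ℕ} {l : MultiPartition ℓ r} (t : l.Std) : Sym r :=
  op (l.initial.symm.trans t.1)

open Classical in
/-- The row stabilizer of the `i`th component of `t^λ`: the permutations that preserve the rows of
`t^λ` and fix all numbers outside its `i`th component. -/
def rowStabilizer {ℓ r : ℕ} (l : MultiPartition ℓ r) (i : Fin ℓ) : Finset (Equiv.Perm (Fin r)) :=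
  Finset.univ.filter fun w => ∀ b : l.Box,
    (b.comp ≠ i → w (l.initial b) = l.initial b) ∧
    (l.initial.symm (w (l.initial b))).comp = b.comp ∧
    (l.initial.symm (w (l.initial b))).row = b.row

/-! ### The degenerate cyclotomic Hecke algebra -/

/-- The generators `s_1, …, s_{r-1}` and `x_1, …, x_r`. -/
inductive Gen (r : ℕ) : Type
  | s (i : Fin (r - 1)) : Gen r
  | x (i : Fin r) : Gen r

/-- The polynomial `f = (X - ω_1) ⋯ (X - ω_ℓ)`. -/
def cycPoly {ℓ : ℕ} (ω : Fin ℓ → ℂ) : Polynomial ℂ :=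
  ∏ k, (Polynomial.X - Polynomial.C (ω k))

namespace Free

def s {r : ℕ} (i : Fin (r - 1)) : FreeAlgebra ℂ (Gen r) := FreeAlgebra.ι ℂ (Gen.s i)

def x {r : ℕ} (i : Fin r) : FreeAlgebra ℂ (Gen r) := FreeAlgebra.ι ℂ (Gen.x i)

end Free

open Free in
/-- The relations of the degenerate affine Hecke algebra, together with `f(x_1) = 0`. -/
inductive Rel {ℓ : ℕ} (ω : Fin ℓ → ℂ) (r : ℕ) :
    FreeAlgebra ℂ (Gen r) → FreeAlgebra ℂ (Gen r) → Prop
  | s_sq (i : Fin (r - 1)) : Rel ω r (s i * s i) 1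
  | x_comm (i j : Fin r) : Rel ω r (x i * x j) (x j * x i)
  | s_comm (i j : Fin (r - 1)) (h : i.val + 1 < j.val) : Rel ω r (s i * s j) (s j * s i)
  | s_x_comm (i : Fin (r - 1)) (j : Fin r) (h₁ : j ≠ lo i) (h₂ : j ≠ hi i) :
      Rel ω r (s i * x j) (x j * s i)
  | x_s (i : Fin (r - 1)) : Rel ω r (x (lo i) * s i - s i * x (hi i)) (-1)
  | s_x (i : Fin (r - 1)) : Rel ω r (s i * x (lo i) - x (hi i) * s i) (-1)
  | braid (i j : Fin (r - 1)) (h : i.val + 1 = j.val) :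
      Rel ω r (s i * s j * s i) (s j * s i * s j)
  | cyclotomic (i : Fin r) (h : i.val = 0) : Rel ω r (Polynomial.aeval (x i) (cycPoly ω)) 0

/-- The degenerate cyclotomic Hecke algebra `H_{ℓ,r}` with parameters `ω`. -/
def Hecke {ℓ : ℕ} (ω : Fin ℓ → ℂ) (r : ℕ) : Type := RingQuot (Rel ω r)

instance {ℓ : ℕ} (ω : Fin ℓ → ℂ) (r : ℕ) : Ring (Hecke ω r) :=
  inferInstanceAs (Ring (RingQuot (Rel ω r)))

instance {ℓ : ℕ} (ω : Fin ℓ → ℂ) (r : ℕ) : Algebra ℂ (Hecke ω r) :=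
  inferInstanceAs (Algebra ℂ (RingQuot (Rel ω r)))

section

variable {ℓ : ℕ} (ω : Fin ℓ → ℂ) {r : ℕ}

/-- The quotient map from the free algebra. -/
def mk : FreeAlgebra ℂ (Gen r) →ₐ[ℂ] Hecke ω r := RingQuot.mkAlgHom ℂ (Rel ω r)

theorem mk_rel {a b : FreeAlgebra ℂ (Gen r)} (h : Rel ω r a b) : mk ω a = mk ω b :=
  RingQuot.mkAlgHom_rel ℂ h

def s (i : Fin (r - 1)) : Hecke ω r := mk ω (Free.s i)

def x (i : Fin r) : Hecke ω r := mk ω (Free.x i)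

/-- The images of the generators under `*`. -/
def starFree : FreeAlgebra ℂ (Gen r) →ₐ[ℂ] (Hecke ω r)ᵐᵒᵖ :=
  FreeAlgebra.lift ℂ fun g => op (mk ω (FreeAlgebra.ι ℂ g))

theorem starFree_s (i : Fin (r - 1)) : starFree ω (Free.s i) = op (mk ω (Free.s i)) :=
  FreeAlgebra.lift_ι_apply _ _

theorem starFree_x (i : Fin r) : starFree ω (Free.x i) = op (mk ω (Free.x i)) :=
  FreeAlgebra.lift_ι_apply _ _

theorem aeval_op {B : Type*} [Ring B] [Algebra ℂ B] (b : B) (p : Polynomial ℂ) :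
    Polynomial.aeval (op b) p = op (Polynomial.aeval b p) := by
  induction p using Polynomial.induction_on' with
  | add p q hp hq => simp [hp, hq]
  | monomial n c =>
    simp only [Polynomial.aeval_monomial, op_mul, op_pow, MulOpposite.algebraMap_apply]
    exact Algebra.commutes (A := Bᵐᵒᵖ) c (op b ^ n)

theorem starFree_rel {a b : FreeAlgebra ℂ (Gen r)} (h : Rel ω r a b) :
    starFree ω a = starFree ω b := by
  have key {a b : FreeAlgebra ℂ (Gen r)} (h : Rel ω r a b) := mk_rel ω h
  cases h with
  | s_sq i =>
    simp only [map_mul, map_one, starFree_s, ← op_mul]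
    rw [← map_mul, key (Rel.s_sq i), map_one, op_one]
  | x_comm i j =>
    simp only [map_mul, starFree_x, ← op_mul]
    rw [← map_mul, key (Rel.x_comm j i), map_mul]
  | s_comm i j h =>
    simp only [map_mul, starFree_s, ← op_mul]
    rw [← map_mul, ← key (Rel.s_comm i j h), map_mul]
  | s_x_comm i j h₁ h₂ =>
    simp only [map_mul, starFree_s, starFree_x, ← op_mul]
    rw [← map_mul, ← key (Rel.s_x_comm i j h₁ h₂), map_mul]
  | x_s i =>
    simp only [map_sub, map_mul, map_neg, map_one, starFree_s, starFree_x, ← op_mul, ← op_sub]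
    rw [← map_mul, ← map_mul, ← map_sub, key (Rel.s_x i), map_neg, map_one, op_neg, op_one]
  | s_x i =>
    simp only [map_sub, map_mul, map_neg, map_one, starFree_s, starFree_x, ← op_mul, ← op_sub]
    rw [← map_mul, ← map_mul, ← map_sub, key (Rel.x_s i), map_neg, map_one, op_neg, op_one]
  | braid i j h =>
    simp only [map_mul, starFree_s, ← op_mul, ← mul_assoc]
    rw [← map_mul, ← map_mul, key (Rel.braid i j h), map_mul, map_mul]
  | cyclotomic i h =>
    rw [← Polynomial.aeval_algHom_apply, starFree_x, aeval_op, Polynomial.aeval_algHom_apply,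
      key (Rel.cyclotomic i h), map_zero, map_zero, op_zero]

/-- The anti-automorphism `*`, which fixes all the generators. -/
def heckeStar : Hecke ω r →ₐ[ℂ] (Hecke ω r)ᵐᵒᵖ :=
  RingQuot.liftAlgHom ℂ ⟨starFree ω, fun _ _ h => starFree_rel ω h⟩

/-- The image in `H_{ℓ,r}` of a permutation; by the braid relations and `s_i ^ 2 = 1` it does not
depend on the word that is used. -/
def perm (w : Sym r) : Hecke ω r := ((word w).map (s ω)).prod

/-- `(x_1 - q)(x_2 - q) ⋯ (x_a - q)`, for `a ≤ r`. -/
def piFactor (a : ℕ) (q : ℂ) : Hecke ω r :=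
  (((List.finRange r).take a).map fun j => x ω j - algebraMap ℂ _ q).prod

/-- `π_{[λ]}`, the product over `i = 1, …, ℓ - 1` of the factors with `a = a_i` and
`q = ω_{i+1}`. -/
def piElt (l : MultiPartition ℓ r) : Hecke ω r :=
  (List.ofFn fun k : Fin (ℓ - 1) =>
    piFactor ω (l.partialSize (k.val + 1)) (ω ⟨k.val + 1, by omega⟩)).prod

/-- `π̃_{[λ]}`, the product over `i = 1, …, ℓ - 1` of the factors with `a = a_i` and
`q = ω_{ℓ-i}`. -/
def piTildeElt (l : MultiPartition ℓ r) : Hecke ω r :=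
  (List.ofFn fun k : Fin (ℓ - 1) =>
    piFactor ω (l.partialSize (k.val + 1)) (ω ⟨ℓ - 2 - k.val, by omega⟩)).prod

/-- `x_{λ^{(i)}}`, the sum of the row stabilizer. -/
def rowSum (l : MultiPartition ℓ r) (i : Fin ℓ) : Hecke ω r :=
  ∑ w ∈ rowStabilizer l i, perm ω (op w)

/-- `y_{λ^{(i)}}`, the signed sum of the row stabilizer. -/
def signedRowSum (l : MultiPartition ℓ r) (i : Fin ℓ) : Hecke ω r :=
  ∑ w ∈ rowStabilizer l i, ((Equiv.Perm.sign w : ℤˣ) : ℤ) • perm ω (op w)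

/-- `x_λ^c`: the `i`th factor is `x_{λ^{(i)}}` if `c_i = 0` and `y_{λ^{(i)}}` if `c_i = 1`. -/
def xElt (c : Fin ℓ → Fin 2) (l : MultiPartition ℓ r) : Hecke ω r :=
  (List.ofFn fun i : Fin ℓ => if c i = 0 then rowSum ω l i else signedRowSum ω l i).prod

/-- `y_λ^c`: the `i`th factor is `y_{λ^{(i)}}` if `c_{ℓ+1-i} = 0` and `x_{λ^{(i)}}` if
`c_{ℓ+1-i} = 1`.  Thus in `y_{λ'}^c` the conjugate of `λ^{(i)}`, which is the component
`ℓ + 1 - i` of `λ'`, goes with `c_i`. -/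
def yElt (c : Fin ℓ → Fin 2) (l : MultiPartition ℓ r) : Hecke ω r :=
  (List.ofFn fun i : Fin ℓ => if c i.rev = 0 then signedRowSum ω l i else rowSum ω l i).prod

/-- `m^c_{s,t} = d(s)⁻¹ π_{[λ]} x_λ^c d(t)`. -/
def mBasis (c : Fin ℓ → Fin 2) (l : MultiPartition ℓ r) (u t : l.Std) : Hecke ω r :=
  perm ω (tableauPerm u)⁻¹ * (piElt ω l * xElt ω c l) * perm ω (tableauPerm t)

/-- `n^c_{s,t} = d(s)⁻¹ π̃_{[λ]} y_λ^c d(t)`. -/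
def nBasis (c : Fin ℓ → Fin 2) (l : MultiPartition ℓ r) (u t : l.Std) : Hecke ω r :=
  perm ω (tableauPerm u)⁻¹ * (piTildeElt ω l * yElt ω c l) * perm ω (tableauPerm t)

end

end DegHecke

end

/-! Write m_λ = π_[λ] x_λ and let n_λ be its analogue for the reversed parameters and the signs
`coSign c`. The n-basis is thus an m-basis for other data with the same cyclotomic polynomial f, so
everything is proved for parameters q with `cycPoly q = cycPoly ω` (`cellGen`, `cellElt`). Put z_λ =
m_λ w_λ n_λ', where w_λ takes t^λ to the transpose of t^λ'.

Three facts carry the proof. (A) m_μ H n_λ' = 0 unless μ ⊴ λ (`cellGen_mul_mul_eq_zero`). (B) m_λ H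
n_λ' is contained in ℂ z_λ (`cellGen_mul_mul_cellGen`). (C) The elements d(s)⁻¹ z_λ, for s standard
of shape λ, are linearly independent (`linearIndependent_spechtElt`).

By (B) there are scalars g(t, p) with m_λ d(t) d(p)⁻¹ n_λ' = g(t, p) z_λ, for t of shape λ and p of
shape λ'. Indexing the p by transposes of λ-tableaux makes the matrix g unitriangular for the
lexicographic order on row sequences. Hence right multiplication by d(p)⁻¹ n_λ' extracts the shape-λ
coefficients of a combination of the m_{s,t} in which no smaller shapes occur. This gives linear
independence and the cell property (`isCellularBasis_of_pairing`). Absorbing a into the left or the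
right factor of m_{s,s} a d(p)⁻¹ n_λ' shows that g is an invariant pairing of the two cell modules
(`pairing_invariant`); being nondegenerate, it is the required isomorphism.

For (A) and (B), m_μ is treated as a row vector: it has a product of linear factors on the right,
and transpositions within a row act by signs. Multiplication by x_k yields combinations of m_μ w and
of row vectors in which some positions have moved to smaller rows (`IsRowVec.mul_x`). A product v w
n_λ' of a row vector with n_λ' vanishes if linear factors combine to f(x_1) = 0, or if a
transposition acts with opposite signs on the two sides. What survives satisfies, by a count column
by column, the dominance inequalities (`Survives.card_fiber_le`). If v = m_λ, then w is w_λ times a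
row and a column permutation, which only contribute scalars.

For (C), H acts on combinations of permutations whose coefficients are polynomials of degree less
than ℓ in each variable. Only the coefficient of the top monomial, with all exponents ℓ - 1, is
needed; it turns d(s)⁻¹ z_λ into a unitriangular matrix.

Finally, the elements x^α w with exponents less than ℓ span H, so dim H ≤ ℓ^r r!. The commutation
relation between adding and removing boxes shows that the pairs of standard tableaux number at least
ℓ^r r!. Hence the independent elements m_{s,t} form a basis. -/

open MulOpposite

noncomputable section

namespace DegHecke

/-! ### Words in the simple transpositions -/

section Words

variable {M : Type*} [Monoid M]

/-- The product `S (k + m - 1) ⋯ S (k + 1) S k`. -/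
def descProd (S : ℕ → M) (k : ℕ) : ℕ → M
  | 0 => 1
  | m + 1 => S (k + m) * descProd S k m

theorem descProd_succ' (S : ℕ → M) (k m : ℕ) :
    descProd S (k + 1) m * S k = descProd S k (m + 1) := by
  induction m with
  | zero => simp [descProd]
  | succ m ih =>
    rw [descProd, mul_assoc, ih, descProd, descProd]
    congr 2; omega

/-- The Coxeter relations of type `A` for the elements `S i`, `i < N`. -/
structure IsCoxeter (S : ℕ → M) (N : ℕ) : Prop where
  sq : ∀ i < N, S i * S i = 1
  comm : ∀ i j, i + 1 < j → j < N → S i * S j = S j * S i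
  braid : ∀ i, i + 1 < N → S i * S (i + 1) * S i = S (i + 1) * S i * S (i + 1)

variable {S : ℕ → M} {N : ℕ}

theorem IsCoxeter.descProd_comm (h : IsCoxeter S N) {i k m : ℕ} (hi : i + 1 < k) (hN : k + m ≤ N) :
    descProd S k m * S i = S i * descProd S k m := by
  induction m with
  | zero => simp [descProd]
  | succ m ih =>
    rw [descProd, mul_assoc, ih (by omega), ← mul_assoc, ← mul_assoc,
      h.comm i (k + m) (by omega) (by omega)]

/-- `S (i + 1)` slides left past the factors of index below i. The braid relation turns `S (i + 1) *
S i * S (i + 1)` into `S i * S (i + 1) * S i`, and the leading `S i` slides past the factors of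
index above i + 1. -/
theorem IsCoxeter.descProd_shift (h : IsCoxeter S N) {i k m : ℕ} (hi : k ≤ i) (hm : i + 1 < k + m)
    (hN : k + m ≤ N) : descProd S k m * S (i + 1) = S i * descProd S k m := by
  induction m with
  | zero => omega
  | succ m ih =>
    rcases Nat.lt_or_ge (i + 1) (k + m) with h1 | h1
    · rw [descProd, mul_assoc, ih h1 (by omega), ← mul_assoc, ← mul_assoc,
        h.comm i (k + m) (by omega) (by omega)]
    · obtain ⟨m, rfl⟩ : ∃ m', m = m' + 1 := ⟨m - 1, by omega⟩
      have e : i = k + m := by omega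
      subst e
      have h2 : descProd S k m * S (k + m + 1) = S (k + m + 1) * descProd S k m := by
        clear ih hm hi h1
        have : ∀ n ≤ m, descProd S k n * S (k + m + 1) = S (k + m + 1) * descProd S k n := by
          intro n hn
          induction n with
          | zero => simp [descProd]
          | succ n ih =>
            rw [descProd, mul_assoc, ih (by omega), ← mul_assoc, ← mul_assoc,
              h.comm (k + n) (k + m + 1) (by omega) (by omega)]
        exact this m le_rfl
      rw [descProd, descProd, mul_assoc, mul_assoc, h2, ← mul_assoc, ← mul_assoc, ← mul_assoc,
        ← add_assoc, ← h.braid (k + m) (by omega), mul_assoc, mul_assoc]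

/-- Elements that are products of the `S i` with `i < n`. -/
def wordSubmonoid (S : ℕ → M) (n : ℕ) : Submonoid M := Submonoid.closure (S '' {i | i < n})

theorem mem_wordSubmonoid {i n : ℕ} (hi : i < n) : S i ∈ wordSubmonoid S n :=
  Submonoid.subset_closure ⟨i, hi, rfl⟩

/-- The descending runs are coset representatives for one symmetric group in the next. Multiplying v
· S n ⋯ S k by `S i` on the right lengthens the run if i + 1 = k, shortens it if i = k, and
otherwise moves a generator of index less than n into v. -/
theorem IsCoxeter.exists_normal_form (h : IsCoxeter S N) {n : ℕ} (hn : n + 1 ≤ N) {a : M}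
    (ha : a ∈ wordSubmonoid S (n + 1)) :
    ∃ v ∈ wordSubmonoid S n, ∃ k m, k + m = n + 1 ∧ a = v * descProd S k m := by
  unfold wordSubmonoid at ha
  induction ha using Submonoid.closure_induction_right with
  | one => exact ⟨1, one_mem _, n + 1, 0, rfl, by simp [descProd]⟩
  | mul_right a _ y hy ih =>
    obtain ⟨i, hi, rfl⟩ := hy
    obtain ⟨v, hv, k, m, hkm, rfl⟩ := ih
    simp only [Set.mem_ofPred_eq] at hi
    rcases Nat.lt_trichotomy (i + 1) k with h1 | h1 | h1
    · refine ⟨v * S i, mul_mem hv (mem_wordSubmonoid (by omega)), k, m, hkm, ?_⟩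
      rw [mul_assoc, h.descProd_comm h1 (by omega), mul_assoc]
    · subst h1
      exact ⟨v, hv, i, m + 1, by omega, by rw [mul_assoc, descProd_succ']⟩
    · rcases Nat.eq_or_lt_of_le (Nat.lt_succ_iff.1 h1) with h2 | h2
      · subst h2
        obtain ⟨m, rfl⟩ : ∃ m', m = m' + 1 := ⟨m - 1, by omega⟩
        refine ⟨v, hv, k + 1, m, by omega, ?_⟩
        rw [← descProd_succ', mul_assoc, mul_assoc, h.sq k (by omega), mul_one]
      · obtain ⟨i, rfl⟩ : ∃ i', i = i' + 1 := ⟨i - 1, by omega⟩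
        refine ⟨v * S i, mul_mem hv (mem_wordSubmonoid (by omega)), k, m, hkm, ?_⟩
        rw [mul_assoc, h.descProd_shift (by omega) (by omega) (by omega), mul_assoc]

end Words

theorem simple_mul_self {r : ℕ} (i : Fin (r - 1)) : simple i * simple i = 1 := by
  simp [simple, ← op_mul]

theorem lo_ne_hi {r : ℕ} (i : Fin (r - 1)) : lo i ≠ hi i := by
  simp [lo, hi, Fin.ext_iff]

/-! ### The Coxeter presentation of the symmetric group. -/

section Presentation

variable {M : Type*} [Monoid M] {r : ℕ}

/-- The Coxeter relations, for elements indexed like the simple transpositions. -/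
structure IsCoxeterFin (s : Fin (r - 1) → M) : Prop where
  sq : ∀ i, s i * s i = 1
  comm : ∀ i j, i.val + 1 < j.val → s i * s j = s j * s i
  braid : ∀ i j, i.val + 1 = j.val → s i * s j * s i = s j * s i * s j

theorem isCoxeterFin_simple : IsCoxeterFin (simple (r := r)) where
  sq := simple_mul_self
  comm i j h := by
    simp only [simple, ← op_mul]
    congr 1
    apply Equiv.Perm.Disjoint.commute
    rw [Equiv.Perm.disjoint_iff_disjoint_support, Equiv.Perm.support_swap (lo_ne_hi _),
      Equiv.Perm.support_swap (lo_ne_hi _)]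
    simp [lo, hi, Fin.ext_iff]
    omega
  braid i j h := by
    simp only [simple, ← op_mul]
    congr 1
    have : hi i = lo j := by simp [lo, hi, h]
    have h1 : lo i ≠ hi i := lo_ne_hi i
    have h2 : lo j ≠ hi j := lo_ne_hi j
    have h3 : lo i ≠ hi j := by simp [lo, hi, Fin.ext_iff]; omega
    rw [this] at *
    ext k
    simp only [Equiv.Perm.mul_apply, Equiv.swap_apply_def]
    grind

/-- The generators extended to all natural numbers, paired with the simple transpositions. -/
def pairGen (s : Fin (r - 1) → M) (i : ℕ) : M × Sym r :=
  if h : i < r - 1 then (s ⟨i, h⟩, simple ⟨i, h⟩) else 1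

theorem IsCoxeterFin.pairGen {s : Fin (r - 1) → M} (hs : IsCoxeterFin s) :
    IsCoxeter (pairGen s) (r - 1) where
  sq i h := by
    simp [DegHecke.pairGen, h, hs.sq, simple_mul_self]
  comm i j h hj := by
    have hi : i < r - 1 := by omega
    simp only [DegHecke.pairGen, hj, hi, dif_pos, Prod.mk_mul_mk]
    rw [hs.comm ⟨i, hi⟩ ⟨j, hj⟩ h, isCoxeterFin_simple.comm ⟨i, hi⟩ ⟨j, hj⟩ h]
  braid i h := by
    have hi : i < r - 1 := by omega
    simp only [DegHecke.pairGen, h, hi, dif_pos, Prod.mk_mul_mk]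
    rw [hs.braid ⟨i, hi⟩ ⟨i + 1, h⟩ rfl, isCoxeterFin_simple.braid ⟨i, hi⟩ ⟨i + 1, h⟩ rfl]

theorem fix_of_mem_wordSubmonoid (s : Fin (r - 1) → M) {n : ℕ} {a : M × Sym r}
    (ha : a ∈ wordSubmonoid (pairGen s) n) (p : Fin r) (hp : n < p.val) : a.2.unop p = p := by
  unfold wordSubmonoid at ha
  induction ha using Submonoid.closure_induction with
  | mem x hx =>
    obtain ⟨i, hi, rfl⟩ := hx
    simp only [Set.mem_ofPred_eq] at hi
    unfold pairGen
    split_ifs with h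
    · simp only [simple, unop_op]
      apply Equiv.swap_apply_of_ne_of_ne <;> simp [lo, DegHecke.hi, Fin.ext_iff] <;> omega
    · simp
  | one => simp
  | mul x y _ _ hx hy => simp [hx, hy]

theorem descProd_apply (s : Fin (r - 1) → M) (k m : ℕ) (h : k + m < r) :
    (descProd (pairGen s) k m).2.unop ⟨k + m, h⟩ = ⟨k, by omega⟩ := by
  induction m with
  | zero => simp [descProd]
  | succ m ih =>
    have h1 : k + m < r - 1 := by omega
    have : (pairGen s (k + m)).2.unop ⟨k + (m + 1), h⟩ = ⟨k + m, by omega⟩ := by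
      simp only [pairGen, h1, dif_pos, simple, unop_op]
      exact Equiv.swap_apply_right _ _
    simp [descProd, this, ih (by omega)]

/-- Working in the product with `Sym r` lets the permutation control the normal form. A nonempty run
S n ⋯ S k sends position n + 1 to k, whereas v fixes n + 1; if the permutation is trivial, the run
is therefore empty and induction on n applies to v. -/
theorem IsCoxeterFin.eq_one {s : Fin (r - 1) → M} (hs : IsCoxeterFin s) {n : ℕ} (hn : n ≤ r - 1)
    {a : M × Sym r} (ha : a ∈ wordSubmonoid (DegHecke.pairGen s) n) (h1 : a.2 = 1) : a.1 = 1 := by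
  induction n generalizing a with
  | zero =>
    have : a = 1 := by simpa [wordSubmonoid] using ha
    simp [this]
  | succ n ih =>
    obtain ⟨v, hv, k, m, hkm, rfl⟩ := hs.pairGen.exists_normal_form hn ha
    obtain _ | m := m
    · simp only [descProd, mul_one] at h1 ⊢
      exact ih (by omega) hv h1
    · exfalso
      have hr : k + (m + 1) < r := by omega
      have h2 := congrArg (fun w : Sym r => w.unop ⟨k + (m + 1), hr⟩) h1
      simp only [Prod.snd_mul, unop_mul, Equiv.Perm.mul_apply, unop_one, Equiv.Perm.one_apply] at h2
      rw [fix_of_mem_wordSubmonoid s hv _ (by simp; omega), descProd_apply] at h2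
      simp [Fin.ext_iff] at h2

theorem pairGen_prod (s : Fin (r - 1) → M) (u : List (Fin (r - 1))) :
    ((u.map s).prod, (u.map simple).prod) ∈ wordSubmonoid (pairGen s) (r - 1) := by
  induction u with
  | nil => exact one_mem _
  | cons i u ih =>
    have : pairGen s i.val = (s i, simple i) := by simp [pairGen]
    have h2 := mul_mem (mem_wordSubmonoid (S := pairGen s) i.isLt) ih
    rw [this] at h2
    simpa using h2

theorem IsCoxeterFin.prod_reverse {s : Fin (r - 1) → M} (hs : IsCoxeterFin s)
    (u : List (Fin (r - 1))) : (u.map s).prod * (u.reverse.map s).prod = 1 := by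
  induction u with
  | nil => simp
  | cons i u ih =>
    simp only [List.map_cons, List.prod_cons, List.reverse_cons, List.map_append, List.prod_append,
      List.map_nil, List.prod_nil, mul_one]
    calc _ = s i * ((u.map s).prod * (u.reverse.map s).prod) * s i := by simp only [mul_assoc]
      _ = 1 := by rw [ih, mul_one, hs.sq]

/-- Two words that represent the same permutation have the same product whenever the Coxeter
relations hold. -/
theorem IsCoxeterFin.prod_eq {s : Fin (r - 1) → M} (hs : IsCoxeterFin s)
    {u v : List (Fin (r - 1))} (h : (u.map simple).prod = (v.map simple).prod) :
    (u.map s).prod = (v.map s).prod := by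
  -- Reversing a word in involutions inverts it, so u followed by the reversed v represents the
  -- identity.
  have h1 := hs.eq_one le_rfl (pairGen_prod s (u ++ v.reverse)) (by
    simp only [List.map_append, List.prod_append, h]
    exact isCoxeterFin_simple.prod_reverse v)
  simp only [List.map_append, List.prod_append] at h1
  have h2 := hs.prod_reverse v.reverse
  rw [List.reverse_reverse] at h2
  calc (u.map s).prod = (u.map s).prod * ((v.reverse.map s).prod * (v.map s).prod) := by
        rw [h2, mul_one]
    _ = _ := by rw [← mul_assoc, h1, one_mul]

theorem word_prod (w : Sym r) : ((word w).map simple).prod = w := Classical.choose_spec (exists_word w)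

/-- The homomorphism from the symmetric group given by elements satisfying the Coxeter relations. -/
def coxeterHom (s : Fin (r - 1) → M) (hs : IsCoxeterFin s) : Sym r →* M where
  toFun w := ((word w).map s).prod
  map_one' := hs.prod_eq (v := []) (by rw [word_prod]; rfl)
  map_mul' a b := by
    rw [← List.prod_append, ← List.map_append]
    exact hs.prod_eq (by rw [word_prod, List.map_append, List.prod_append, word_prod, word_prod])

theorem coxeterHom_simple (s : Fin (r - 1) → M) (hs : IsCoxeterFin s) (i : Fin (r - 1)) :
    coxeterHom s hs (simple i) = s i := by
  have := hs.prod_eq (u := word (simple i)) (v := [i]) (by rw [word_prod]; simp)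
  exact this.trans (by simp)

end Presentation

/-! ### Induction over Young subgroups -/

/-- A permutation without descents is strictly monotone, hence the unique order automorphism of `Fin
r`. -/
theorem exists_descent {r : ℕ} (σ : Equiv.Perm (Fin r)) (h : σ ≠ 1) :
    ∃ i : Fin (r - 1), σ (hi i) < σ (lo i) := by
  by_contra! hc
  apply h
  obtain _ | n := r
  · exact Subsingleton.elim _ _
  have hm : StrictMono σ := by
    rw [Fin.strictMono_iff_lt_succ]
    intro i
    exact lt_of_le_of_ne (hc i) fun e => lo_ne_hi (r := n + 1) i (σ.injective e)
  have := Subsingleton.elim (hm.orderIsoOfSurjective σ σ.surjective) (OrderIso.refl _)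
  ext k
  exact congrArg (fun f : Fin (n + 1) ≃o Fin (n + 1) => (f k).val) this

/-- The weighted sum ∑ k · σ(k) replaces the length function: it is bounded by r³ and grows whenever
a descent is removed, which makes the induction in `young_induction` terminate. -/
theorem swap_lo_hi_sum {r : ℕ} (σ : Equiv.Perm (Fin r)) (i : Fin (r - 1))
    (h : σ (hi i) < σ (lo i)) :
    ∑ k : Fin r, k.val * (σ k).val < ∑ k : Fin r, k.val * ((σ * Equiv.swap (lo i) (hi i)) k).val := by
  rw [← Finset.add_sum_erase _ _ (Finset.mem_univ (lo i)),
    ← Finset.add_sum_erase _ (fun k : Fin r => k.val * ((σ * Equiv.swap (lo i) (hi i)) k).val)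
      (Finset.mem_univ (lo i))]
  have hm : hi i ∈ Finset.univ.erase (lo i) := by simp [(lo_ne_hi i).symm]
  rw [← Finset.add_sum_erase _ _ hm, ← Finset.add_sum_erase _ (fun k : Fin r => k.val *
    ((σ * Equiv.swap (lo i) (hi i)) k).val) hm]
  have : ∑ x ∈ (Finset.univ.erase (lo i)).erase (hi i), x.val *
      ((σ * Equiv.swap (lo i) (hi i)) x).val =
      ∑ x ∈ (Finset.univ.erase (lo i)).erase (hi i), x.val * (σ x).val := by
    refine Finset.sum_congr rfl fun x hx => ?_
    simp only [Finset.mem_erase, Finset.mem_univ, and_true] at hx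
    rw [Equiv.Perm.mul_apply, Equiv.swap_apply_of_ne_of_ne hx.2 hx.1]
  rw [this]
  simp only [Equiv.Perm.mul_apply, Equiv.swap_apply_left, Equiv.swap_apply_right]
  have e1 : (hi i).val = (lo i).val + 1 := rfl
  rw [e1]
  have := Fin.lt_def.1 h
  nlinarith

/-- The permutations that preserve the fibres of a monotone map are generated by the simple
transpositions within the fibres. -/
theorem young_induction {r : ℕ} {α : Type*} [LinearOrder α] {β : Fin r → α} (hβ : Monotone β)
    {P : Equiv.Perm (Fin r) → Prop} (h1 : P 1)
    (hs : ∀ σ (i : Fin (r - 1)), β (lo i) = β (hi i) → P σ → P (σ * Equiv.swap (lo i) (hi i)))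
    (σ : Equiv.Perm (Fin r)) (hσ : ∀ k, β (σ k) = β k) : P σ := by
  have hb : ∀ τ : Equiv.Perm (Fin r), ∑ k : Fin r, k.val * (τ k).val ≤ r * (r * r) := by
    intro τ
    calc _ ≤ ∑ k : Fin r, r * r := Finset.sum_le_sum fun k _ =>
          Nat.mul_le_mul k.isLt.le (τ k).isLt.le
      _ = _ := by simp
  induction hd : r * (r * r) - ∑ k : Fin r, k.val * (σ k).val using Nat.strong_induction_on
    generalizing σ with
  | _ d ih =>
    by_cases h : σ = 1
    · rw [h]; exact h1
    obtain ⟨i, hi'⟩ := exists_descent σ h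
    -- A descent lies inside a fibre, because β (hi i) = β (σ (hi i)) ≤ β (σ (lo i)) = β (lo i) ≤ β
    -- (hi i).
    have e : β (lo i) = β (hi i) := by
      refine le_antisymm (hβ (by simp [lo, hi, Fin.le_def])) ?_
      rw [← hσ (hi i), ← hσ (lo i)]
      exact hβ hi'.le
    have hlt := swap_lo_hi_sum σ i hi'
    have := ih _ (by have := hb (σ * Equiv.swap (lo i) (hi i)); omega)
      (σ * Equiv.swap (lo i) (hi i)) (by
        intro k
        rw [Equiv.Perm.mul_apply, hσ]
        by_cases hk : k = lo i
        · subst hk; rw [Equiv.swap_apply_left, e]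
        by_cases hk' : k = hi i
        · subst hk'; rw [Equiv.swap_apply_right, e]
        rw [Equiv.swap_apply_of_ne_of_ne hk hk']) rfl
    have h3 := hs _ i e this
    rwa [mul_assoc, Equiv.swap_mul_self, mul_one] at h3

/-! ### Divided differences -/

section Demazure

open MvPolynomial

variable {r : ℕ}

/-- The transposition `s_i` of the variables. -/
def swapVar (i : Fin (r - 1)) : MvPolynomial (Fin r) ℂ →ₐ[ℂ] MvPolynomial (Fin r) ℂ :=
  rename (Equiv.swap (lo i) (hi i))

theorem swapVar_X (i : Fin (r - 1)) (k : Fin r) :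
    swapVar i (X k) = X (Equiv.swap (lo i) (hi i) k) := rename_X _ _

theorem swapVar_swapVar (i : Fin (r - 1)) (p : MvPolynomial (Fin r) ℂ) :
    swapVar i (swapVar i p) = p := by
  rw [swapVar, rename_rename]
  have : (Equiv.swap (lo i) (hi i) : Fin r → Fin r) ∘ Equiv.swap (lo i) (hi i) = id := by
    funext k; simp
  rw [this, rename_id_apply]

/-- `x_i - x_{i+1}`. -/
def diffVar (i : Fin (r - 1)) : MvPolynomial (Fin r) ℂ := X (lo i) - X (hi i)

theorem diffVar_ne_zero (i : Fin (r - 1)) : diffVar i ≠ 0 := by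
  intro h
  exact lo_ne_hi i (X_injective (sub_eq_zero.1 h))

/-- By pq - s(pq) = (p - sp) q + sp (q - sq), divisibility passes from the variables to all
polynomials. -/
theorem diffVar_dvd (i : Fin (r - 1)) (p : MvPolynomial (Fin r) ℂ) :
    diffVar i ∣ p - swapVar i p := by
  induction p using MvPolynomial.induction_on with
  | C a => simp [swapVar]
  | add p q hp hq =>
    rw [map_add, add_sub_add_comm]
    exact dvd_add hp hq
  | mul_X p k hp =>
    have e : p * X k - swapVar i (p * X k) =
        (p - swapVar i p) * X k + swapVar i p * (X k - swapVar i (X k)) := by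
      rw [map_mul]; ring
    rw [e]
    refine dvd_add (Dvd.dvd.mul_right hp _) (Dvd.dvd.mul_left ?_ _)
    rw [swapVar_X]
    by_cases h1 : k = lo i
    · subst h1; rw [Equiv.swap_apply_left]; exact dvd_rfl
    by_cases h2 : k = hi i
    · subst h2; rw [Equiv.swap_apply_right]
      exact ⟨-1, by rw [diffVar]; ring⟩
    · rw [Equiv.swap_apply_of_ne_of_ne h1 h2, sub_self]; exact dvd_zero _

/-- The divided difference `(p - s_i p) / (x_i - x_{i+1})`. -/
def demazure (i : Fin (r - 1)) : MvPolynomial (Fin r) ℂ →ₗ[ℂ] MvPolynomial (Fin r) ℂ where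
  toFun p := Classical.choose (diffVar_dvd i p)
  map_add' p q := by
    apply mul_left_cancel₀ (diffVar_ne_zero i)
    rw [mul_add, ← Classical.choose_spec (diffVar_dvd i p), ← Classical.choose_spec
      (diffVar_dvd i q), ← Classical.choose_spec (diffVar_dvd i (p + q)), map_add]
    ring
  map_smul' c p := by
    apply mul_left_cancel₀ (diffVar_ne_zero i)
    rw [RingHom.id_apply, mul_smul_comm, ← Classical.choose_spec (diffVar_dvd i p),
      ← Classical.choose_spec (diffVar_dvd i (c • p)), map_smul, smul_sub]

theorem diffVar_mul_demazure (i : Fin (r - 1)) (p : MvPolynomial (Fin r) ℂ) :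
    diffVar i * demazure i p = p - swapVar i p :=
  (Classical.choose_spec (diffVar_dvd i p)).symm

theorem demazure_eq {i : Fin (r - 1)} {p d : MvPolynomial (Fin r) ℂ}
    (h : diffVar i * d = p - swapVar i p) : demazure i p = d :=
  mul_left_cancel₀ (diffVar_ne_zero i) ((diffVar_mul_demazure i p).trans h.symm)

theorem demazure_eq_zero {i : Fin (r - 1)} {p : MvPolynomial (Fin r) ℂ}
    (h : swapVar i p = p) : demazure i p = 0 := demazure_eq (by rw [h]; ring)

theorem demazure_mul (i : Fin (r - 1)) (p q : MvPolynomial (Fin r) ℂ) :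
    demazure i (p * q) = demazure i p * q + swapVar i p * demazure i q := by
  apply demazure_eq
  have h1 := diffVar_mul_demazure i p
  have h2 := diffVar_mul_demazure i q
  rw [map_mul]
  linear_combination q * h1 + swapVar i p * h2

theorem demazure_X_lo (i : Fin (r - 1)) : demazure i (X (lo i)) = 1 :=
  demazure_eq (by rw [swapVar_X, Equiv.swap_apply_left, diffVar, mul_one])

theorem demazure_X_hi (i : Fin (r - 1)) : demazure i (X (hi i)) = -1 :=
  demazure_eq (by rw [swapVar_X, Equiv.swap_apply_right, diffVar]; ring)

theorem demazure_X_of_ne (i : Fin (r - 1)) {k : Fin r} (h1 : k ≠ lo i) (h2 : k ≠ hi i) :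
    demazure i (X k) = 0 :=
  demazure_eq_zero (by rw [swapVar_X, Equiv.swap_apply_of_ne_of_ne h1 h2])

/-- Polynomials of total degree less than `d`. -/
def degLT (r d : ℕ) : Submodule ℂ (MvPolynomial (Fin r) ℂ) :=
  restrictSupport ℂ {m | m.degree < d}

theorem mem_degLT {d : ℕ} {p : MvPolynomial (Fin r) ℂ} :
    p ∈ degLT r d ↔ ∀ m, p.coeff m ≠ 0 → m.degree < d := by
  rw [degLT, mem_restrictSupport_iff]
  simp [Set.subset_def, mem_support_iff]

/-- The zero polynomial is listed separately: its `totalDegree` is 0, yet it has to lie in `degLT r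
0`. -/
theorem mem_degLT_iff {d : ℕ} {p : MvPolynomial (Fin r) ℂ} :
    p ∈ degLT r d ↔ p = 0 ∨ p.totalDegree < d := by
  rw [mem_degLT]
  constructor
  · intro h
    by_cases hp : p = 0
    · exact Or.inl hp
    · right
      obtain ⟨m, hm⟩ := support_nonempty.2 hp
      have hd : 0 < d := (Nat.zero_le _).trans_lt (h m (mem_support_iff.1 hm))
      rw [totalDegree, Finset.sup_lt_iff hd]
      exact fun m hm => h m (mem_support_iff.1 hm)
  · rintro (rfl | h) m hm
    · simp at hm
    · exact lt_of_le_of_lt (le_totalDegree (mem_support_iff.2 hm)) h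

theorem degLT_mono {d e : ℕ} (h : d ≤ e) : degLT r d ≤ degLT r e :=
  restrictSupport_mono _ fun _ hm => lt_of_lt_of_le hm h

theorem mul_mem_degLT {d e : ℕ} {p q : MvPolynomial (Fin r) ℂ} (hp : p ∈ degLT r d)
    (hq : q.totalDegree ≤ e) : p * q ∈ degLT r (d + e) := by
  rw [mem_degLT_iff] at hp ⊢
  rcases hp with rfl | hp
  · simp
  · right
    exact (totalDegree_mul p q).trans_lt (by omega)

theorem X_mul_mem_degLT {d : ℕ} {p : MvPolynomial (Fin r) ℂ} (hp : p ∈ degLT r d) (k : Fin r) :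
    X k * p ∈ degLT r (d + 1) := by
  rw [mul_comm]
  exact mul_mem_degLT hp (by simp)

theorem rename_mem_degLT {d : ℕ} {p : MvPolynomial (Fin r) ℂ} (hp : p ∈ degLT r d)
    (f : Fin r → Fin r) : rename f p ∈ degLT r d := by
  rw [mem_degLT_iff] at hp ⊢
  rcases hp with rfl | hp
  · simp
  · exact Or.inr ((totalDegree_rename_le f p).trans_lt hp)

theorem swapVar_mem_degLT {d : ℕ} {p : MvPolynomial (Fin r) ℂ} (hp : p ∈ degLT r d)
    (i : Fin (r - 1)) : swapVar i p ∈ degLT r d := rename_mem_degLT hp _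

theorem totalDegree_diffVar (i : Fin (r - 1)) : (diffVar i).totalDegree = 1 := by
  have h : (diffVar i).totalDegree ≤ 1 := by
    refine (totalDegree_sub _ _).trans ?_
    simp
  refine le_antisymm h ?_
  by_contra hc
  have h0 : (diffVar i).totalDegree = 0 := by omega
  rw [totalDegree_eq_zero_iff_eq_C] at h0
  have h1 := congrArg (coeff (Finsupp.single (lo i) 1)) h0
  simp [diffVar, coeff_X] at h1
  rw [if_neg (by
    intro e
    have := Finsupp.single_left_injective one_ne_zero e
    exact lo_ne_hi i this.symm)] at h1
  simp at h1

/-- Multiplication by x_i - x_{i+1} raises the total degree of a nonzero polynomial by exactly one,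
and the product p - s_i p has degree at most that of p. -/
theorem demazure_mem_degLT {d : ℕ} {p : MvPolynomial (Fin r) ℂ} (hp : p ∈ degLT r (d + 1))
    (i : Fin (r - 1)) : demazure i p ∈ degLT r d := by
  have h1 : diffVar i * demazure i p ∈ degLT r (d + 1) := by
    rw [diffVar_mul_demazure]
    exact Submodule.sub_mem _ hp (swapVar_mem_degLT hp i)
  rw [mem_degLT_iff] at h1 ⊢
  by_cases h : demazure i p = 0
  · exact Or.inl h
  · rcases h1 with h1 | h1
    · exact Or.inl ((mul_eq_zero.1 h1).resolve_left (diffVar_ne_zero i))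
    · rw [totalDegree_mul_of_isDomain (diffVar_ne_zero i) h, totalDegree_diffVar] at h1
      exact Or.inr (by omega)

theorem swapVar_mem_restrictDegree {m : ℕ} {p : MvPolynomial (Fin r) ℂ}
    (hp : p ∈ restrictDegree (Fin r) ℂ m) (i : Fin (r - 1)) :
    swapVar i p ∈ restrictDegree (Fin r) ℂ m := by
  rw [mem_restrictDegree] at hp ⊢
  intro a ha k
  rw [swapVar, support_rename_of_injective (Equiv.injective _)] at ha
  obtain ⟨b, hb, rfl⟩ := Finset.mem_image.1 ha
  rw [← Equiv.swap_apply_self (lo i) (hi i) k, Finsupp.mapDomain_apply (Equiv.injective _)]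
  exact hp b hb _

theorem mem_restrictDegree_iff_degreeOf {m : ℕ} {p : MvPolynomial (Fin r) ℂ} :
    p ∈ restrictDegree (Fin r) ℂ m ↔ ∀ k, degreeOf k p ≤ m := by
  simp only [mem_restrictDegree, degreeOf_le_iff]
  exact ⟨fun h k s hs => h s hs k, fun h s hs k => h k s hs⟩

/-- Degrees in a single variable add up in products over a domain, so a factor of p - s_i p cannot
exceed the bound. Thus divided differences keep all exponents below ℓ. -/
theorem demazure_mem_restrictDegree {m : ℕ} {p : MvPolynomial (Fin r) ℂ}
    (hp : p ∈ restrictDegree (Fin r) ℂ m) (i : Fin (r - 1)) :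
    demazure i p ∈ restrictDegree (Fin r) ℂ m := by
  have h1 : diffVar i * demazure i p ∈ restrictDegree (Fin r) ℂ m := by
    rw [diffVar_mul_demazure]
    exact Submodule.sub_mem _ hp (swapVar_mem_restrictDegree hp i)
  by_cases h : demazure i p = 0
  · rw [h]; exact Submodule.zero_mem _
  rw [mem_restrictDegree_iff_degreeOf] at h1 ⊢
  intro k
  have := h1 k
  rw [degreeOf_mul_eq (diffVar_ne_zero i) h] at this
  omega

end Demazure

/-! ### Generators and relations -/

section Hecke

variable {ℓ : ℕ} (ω : Fin ℓ → ℂ) {r : ℕ}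

theorem s_mul_self (i : Fin (r - 1)) : s ω i * s ω i = 1 := by
  have := mk_rel ω (Rel.s_sq i)
  simpa [s] using this

theorem x_mul_comm (i j : Fin r) : x ω i * x ω j = x ω j * x ω i := by
  have := mk_rel ω (Rel.x_comm i j)
  simpa [x] using this

theorem isCoxeterFin_s : IsCoxeterFin (s ω (r := r)) where
  sq := s_mul_self ω
  comm i j h := by
    have := mk_rel ω (Rel.s_comm i j h)
    simpa [s] using this
  braid i j h := by
    have := mk_rel ω (Rel.braid i j h)
    simpa [s] using this

theorem s_mul_x_of_ne (i : Fin (r - 1)) (j : Fin r) (h₁ : j ≠ lo i) (h₂ : j ≠ hi i) :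
    s ω i * x ω j = x ω j * s ω i := by
  have := mk_rel ω (Rel.s_x_comm i j h₁ h₂)
  simpa [s, x] using this

theorem s_mul_x_lo (i : Fin (r - 1)) : s ω i * x ω (lo i) = x ω (hi i) * s ω i - 1 := by
  have := mk_rel ω (Rel.s_x i)
  simp only [map_sub, map_mul, map_neg, map_one] at this
  rw [sub_eq_iff_eq_add] at this
  exact this.trans (by rw [add_comm, sub_eq_add_neg]; rfl)

theorem s_mul_x_hi (i : Fin (r - 1)) : s ω i * x ω (hi i) = x ω (lo i) * s ω i + 1 := by
  have := mk_rel ω (Rel.x_s i)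
  simp only [map_sub, map_mul, map_neg, map_one] at this
  rw [sub_eq_iff_eq_add] at this
  change s ω i * x ω (hi i) = mk ω (Free.x (lo i)) * mk ω (Free.s i) + 1
  rw [this]
  change s ω i * x ω (hi i) = -1 + s ω i * x ω (hi i) + 1
  abel

theorem x_hi_eq (i : Fin (r - 1)) : x ω (hi i) = s ω i * x ω (lo i) * s ω i + s ω i := by
  rw [s_mul_x_lo, sub_mul, one_mul, mul_assoc, s_mul_self, mul_one, sub_add_cancel]

theorem aeval_x_zero (i : Fin r) (h : i.val = 0) : Polynomial.aeval (x ω i) (cycPoly ω) = 0 := by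
  have := mk_rel ω (Rel.cyclotomic i h)
  rwa [← Polynomial.aeval_algHom_apply, map_zero] at this

theorem hecke_induction {P : Hecke ω r → Prop} (hC : ∀ c : ℂ, P (algebraMap ℂ _ c))
    (hs : ∀ i, P (s ω i)) (hx : ∀ i, P (x ω i)) (hadd : ∀ a b, P a → P b → P (a + b))
    (hmul : ∀ a b, P a → P b → P (a * b)) (a : Hecke ω r) : P a := by
  obtain ⟨b, rfl⟩ : ∃ b, mk ω b = a := RingQuot.mkAlgHom_surjective ℂ (Rel ω r) a
  induction b using FreeAlgebra.induction with
  | grade0 c => rw [AlgHom.commutes]; exact hC c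
  | grade1 g =>
    cases g with
    | s i => exact hs i
    | x i => exact hx i
  | add a b ha hb => rw [map_add]; exact hadd _ _ ha hb
  | mul a b ha hb => rw [map_mul]; exact hmul _ _ ha hb

/-- The image of the permutation `σ`; here `pm σ * pm τ` belongs to `τ * σ`. -/
def pm (σ : Equiv.Perm (Fin r)) : Hecke ω r := perm ω (op σ)

theorem perm_eq_coxeterHom (w : Sym r) : perm ω w = coxeterHom (s ω) (isCoxeterFin_s ω) w := rfl

theorem pm_one : pm ω (1 : Equiv.Perm (Fin r)) = 1 := by
  rw [pm, perm_eq_coxeterHom]; exact map_one _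

theorem pm_mul (σ τ : Equiv.Perm (Fin r)) : pm ω σ * pm ω τ = pm ω (τ * σ) := by
  rw [pm, pm, pm, perm_eq_coxeterHom, perm_eq_coxeterHom, perm_eq_coxeterHom, ← map_mul, op_mul]

theorem pm_swap (i : Fin (r - 1)) : pm ω (Equiv.swap (lo i) (hi i)) = s ω i := by
  rw [pm, perm_eq_coxeterHom]; exact coxeterHom_simple _ _ i

theorem pm_mul_inv (σ : Equiv.Perm (Fin r)) : pm ω σ * pm ω σ⁻¹ = 1 := by
  rw [pm_mul, inv_mul_cancel, pm_one]

theorem s_mul_pm (i : Fin (r - 1)) (σ : Equiv.Perm (Fin r)) :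
    s ω i * pm ω σ = pm ω (σ * Equiv.swap (lo i) (hi i)) := by rw [← pm_swap, pm_mul]

theorem perm_induction {P : Equiv.Perm (Fin r) → Prop} (h1 : P 1)
    (hs : ∀ σ (i : Fin (r - 1)), P σ → P (σ * Equiv.swap (lo i) (hi i)))
    (σ : Equiv.Perm (Fin r)) : P σ :=
  young_induction (β := fun _ => 0) (fun _ _ _ => le_rfl) h1 (fun σ i _ => hs σ i) σ fun _ => rfl

/-! ### The polynomial subalgebra -/

open scoped IsMulCommutative in
/-- Evaluation of polynomials at `x_1, …, x_r`. -/
def evX : MvPolynomial (Fin r) ℂ →ₐ[ℂ] Hecke ω r :=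
  haveI := Algebra.isMulCommutative_adjoin ℂ (s := Set.range (x ω (r := r))) (by
    rintro _ ⟨i, rfl⟩ _ ⟨j, rfl⟩; exact x_mul_comm ω i j)
  (Algebra.adjoin ℂ (Set.range (x ω (r := r)))).val.comp
    (MvPolynomial.aeval fun i => ⟨x ω i, Algebra.subset_adjoin ⟨i, rfl⟩⟩)

theorem evX_X (i : Fin r) : evX ω (MvPolynomial.X i) = x ω i := by
  simp [evX]

theorem evX_C (c : ℂ) : evX ω (MvPolynomial.C c : MvPolynomial (Fin r) ℂ) = algebraMap ℂ _ c :=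
  AlgHom.commutes _ _

theorem evX_comm (p q : MvPolynomial (Fin r) ℂ) : evX ω p * evX ω q = evX ω q * evX ω p := by
  rw [← map_mul, mul_comm, map_mul]

/-- Both sides follow the twisted Leibniz rule, so it suffices to compare them on variables, where
∂_i x_i = 1 and ∂_i x_{i+1} = -1 reproduce the defining relations. -/
theorem s_mul_evX (i : Fin (r - 1)) (p : MvPolynomial (Fin r) ℂ) :
    s ω i * evX ω p = evX ω (swapVar i p) * s ω i - evX ω (demazure i p) := by
  induction p using MvPolynomial.induction_on with
  | C a =>
    have h : swapVar i (MvPolynomial.C a) = MvPolynomial.C a := by simp [swapVar]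
    rw [h, demazure_eq_zero h, map_zero, sub_zero, evX_C, Algebra.commutes]
  | add p q hp hq =>
    simp only [map_add, mul_add, add_mul, hp, hq]; abel
  | mul_X p k hp =>
    rw [map_mul, ← mul_assoc, hp, sub_mul, mul_assoc, evX_X, demazure_mul, map_mul, swapVar_X]
    by_cases h1 : k = lo i
    · subst h1
      rw [s_mul_x_lo, Equiv.swap_apply_left, demazure_X_lo]
      simp only [map_mul, map_add, evX_X, map_one, mul_sub, mul_assoc]
      abel
    by_cases h2 : k = hi i
    · subst h2
      rw [s_mul_x_hi, Equiv.swap_apply_right, demazure_X_hi]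
      simp only [map_mul, map_add, evX_X, map_one, map_neg, mul_add, mul_neg, mul_assoc]
      abel
    · rw [s_mul_x_of_ne ω i k h1 h2, Equiv.swap_apply_of_ne_of_ne h1 h2, demazure_X_of_ne i h1 h2]
      simp only [map_mul, evX_X, mul_zero, add_zero, mul_assoc]

theorem s_comm_evX (i : Fin (r - 1)) {p : MvPolynomial (Fin r) ℂ} (h : swapVar i p = p) :
    s ω i * evX ω p = evX ω p * s ω i := by
  rw [s_mul_evX, h, demazure_eq_zero h, map_zero, sub_zero]

theorem pm_comm_evX {α : Type*} [LinearOrder α] {β : Fin r → α} (hβ : Monotone β)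
    {p : MvPolynomial (Fin r) ℂ} (hp : ∀ i : Fin (r - 1), β (lo i) = β (hi i) → swapVar i p = p)
    (σ : Equiv.Perm (Fin r)) (hσ : ∀ k, β (σ k) = β k) : pm ω σ * evX ω p = evX ω p * pm ω σ := by
  refine young_induction hβ (P := fun σ => pm ω σ * evX ω p = evX ω p * pm ω σ) ?_ ?_ σ hσ
  · rw [pm_one, one_mul, mul_one]
  · intro σ i hi h
    rw [← s_mul_pm, mul_assoc, h, ← mul_assoc, s_comm_evX ω i (hp i hi), mul_assoc]

/-- The span of the elements `p w`, for polynomials `p` of degree less than `d`. -/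
def heckeLT (d : ℕ) : Submodule ℂ (Hecke ω r) :=
  Submodule.span ℂ {a | ∃ p ∈ degLT r d, ∃ σ, a = evX ω p * pm ω σ}

theorem mem_heckeLT {d : ℕ} {p : MvPolynomial (Fin r) ℂ} (hp : p ∈ degLT r d)
    (σ : Equiv.Perm (Fin r)) : evX ω p * pm ω σ ∈ heckeLT ω d :=
  Submodule.subset_span ⟨p, hp, σ, rfl⟩

theorem s_mul_mem_heckeLT {d : ℕ} (i : Fin (r - 1)) {a : Hecke ω r} (ha : a ∈ heckeLT ω d) :
    s ω i * a ∈ heckeLT ω d := by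
  unfold heckeLT at ha
  induction ha using Submodule.span_induction with
  | mem a h =>
    obtain ⟨p, hp, σ, rfl⟩ := h
    rw [← mul_assoc, s_mul_evX, sub_mul, mul_assoc, s_mul_pm]
    exact Submodule.sub_mem _ (mem_heckeLT ω (swapVar_mem_degLT hp i) _)
      (mem_heckeLT ω (demazure_mem_degLT (degLT_mono (Nat.le_succ d) hp) i) _)
  | zero => simp
  | add a b _ _ ha hb => rw [mul_add]; exact Submodule.add_mem _ ha hb
  | smul c a _ ha => rw [mul_smul_comm]; exact Submodule.smul_mem _ _ ha

theorem evX_mul_mem_heckeLT {d e : ℕ} {q : MvPolynomial (Fin r) ℂ} (hq : q.totalDegree ≤ e)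
    {a : Hecke ω r} (ha : a ∈ heckeLT ω d) : evX ω q * a ∈ heckeLT ω (d + e) := by
  unfold heckeLT at ha
  induction ha using Submodule.span_induction with
  | mem a h =>
    obtain ⟨p, hp, τ, rfl⟩ := h
    rw [← mul_assoc, ← map_mul, mul_comm q]
    exact mem_heckeLT ω (mul_mem_degLT hp hq) _
  | zero => simp
  | add a b _ _ ha hb => rw [mul_add]; exact Submodule.add_mem _ ha hb
  | smul c a _ ha => rw [mul_smul_comm]; exact Submodule.smul_mem _ _ ha

/-- Permutations permute the variables, up to terms of lower degree. -/
theorem pm_mul_evX {d : ℕ} (σ : Equiv.Perm (Fin r)) {p : MvPolynomial (Fin r) ℂ}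
    (hp : p ∈ degLT r (d + 1)) :
    pm ω σ * evX ω p - evX ω (MvPolynomial.rename σ.symm p) * pm ω σ ∈ heckeLT ω d := by
  induction σ using perm_induction with
  | h1 =>
    have : (⇑(Equiv.symm (1 : Equiv.Perm (Fin r)))) = id := rfl
    rw [pm_one, this, MvPolynomial.rename_id_apply, one_mul, mul_one, sub_self]
    exact Submodule.zero_mem _
  | hs σ i h =>
    have h1 := s_mul_mem_heckeLT ω i h
    have h2 := mem_heckeLT ω (demazure_mem_degLT (rename_mem_degLT hp σ.symm) i) σ
    have e : MvPolynomial.rename (Equiv.symm (σ * Equiv.swap (lo i) (hi i))) p =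
        swapVar i (MvPolynomial.rename σ.symm p) := by
      rw [swapVar, MvPolynomial.rename_rename]; rfl
    have h3 := Submodule.sub_mem _ h1 h2
    convert h3 using 1
    rw [e, ← s_mul_pm, mul_sub, ← mul_assoc, ← mul_assoc, ← mul_assoc, s_mul_evX]
    simp only [sub_mul, mul_assoc]
    abel

/-! ### The anti-automorphism -/

/-- The anti-automorphism `*` as a map of the algebra to itself. -/
def st (a : Hecke ω r) : Hecke ω r := unop (heckeStar ω a)

theorem st_mul (a b : Hecke ω r) : st ω (a * b) = st ω b * st ω a := by simp [st]

theorem st_add (a b : Hecke ω r) : st ω (a + b) = st ω a + st ω b := by simp [st]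

theorem st_one : st ω (1 : Hecke ω r) = 1 := by simp [st]

theorem st_smul (c : ℂ) (a : Hecke ω r) : st ω (c • a) = c • st ω a := by simp [st]

theorem st_zero : st ω (0 : Hecke ω r) = 0 := by simp [st]

theorem st_sum {ι : Type*} (F : Finset ι) (f : ι → Hecke ω r) :
    st ω (∑ i ∈ F, f i) = ∑ i ∈ F, st ω (f i) := by
  simp only [st, map_sum]; exact map_sum (MulOpposite.opAddEquiv (α := Hecke ω r)).symm _ _

theorem st_algebraMap (c : ℂ) : st ω (algebraMap ℂ (Hecke ω r) c) = algebraMap ℂ _ c := by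
  rw [Algebra.algebraMap_eq_smul_one, st_smul, st_one]

theorem st_s (i : Fin (r - 1)) : st ω (s ω i) = s ω i := by
  have : heckeStar ω (s ω i) = starFree ω (Free.s i) := RingQuot.liftAlgHom_mkAlgHom_apply _ _ _ _
  rw [st, this, starFree_s]; rfl

theorem st_x (i : Fin r) : st ω (x ω i) = x ω i := by
  have : heckeStar ω (x ω i) = starFree ω (Free.x i) := RingQuot.liftAlgHom_mkAlgHom_apply _ _ _ _
  rw [st, this, starFree_x]; rfl

theorem st_st (a : Hecke ω r) : st ω (st ω a) = a := by
  induction a using hecke_induction with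
  | hC c => rw [st_algebraMap, st_algebraMap]
  | hs i => rw [st_s, st_s]
  | hx i => rw [st_x, st_x]
  | hadd a b ha hb => rw [st_add, st_add, ha, hb]
  | hmul a b ha hb => rw [st_mul, st_mul, ha, hb]

theorem st_pm (σ : Equiv.Perm (Fin r)) : st ω (pm ω σ) = pm ω σ⁻¹ := by
  induction σ using perm_induction with
  | h1 => rw [inv_one, pm_one, st_one]
  | hs σ i h =>
    rw [← s_mul_pm, st_mul, h, st_s, ← pm_swap, pm_mul, mul_inv_rev, Equiv.swap_inv]

theorem st_evX (p : MvPolynomial (Fin r) ℂ) : st ω (evX ω p) = evX ω p := by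
  induction p using MvPolynomial.induction_on with
  | C a => rw [evX_C, st_algebraMap]
  | add p q hp hq => rw [map_add, st_add, hp, hq]
  | mul_X p k hp => rw [map_mul, st_mul, hp, evX_X, st_x, ← evX_X, evX_comm]

end Hecke

/-! ### Commutation and braid relations for divided differences. -/

section Braid

open MvPolynomial

variable {r : ℕ}

theorem swapVar_diffVar_self (i : Fin (r - 1)) : swapVar i (diffVar i) = -diffVar i := by
  rw [diffVar, map_sub, swapVar_X, swapVar_X, Equiv.swap_apply_left, Equiv.swap_apply_right]; ring

theorem swapVar_demazure_self (i : Fin (r - 1)) (p : MvPolynomial (Fin r) ℂ) :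
    swapVar i (demazure i p) = demazure i p := by
  symm
  apply demazure_eq
  have h := congrArg (swapVar i) (diffVar_mul_demazure i p)
  rw [map_mul, swapVar_diffVar_self, map_sub, swapVar_swapVar] at h
  linear_combination -h

theorem demazure_swapVar_self (i : Fin (r - 1)) (p : MvPolynomial (Fin r) ℂ) :
    demazure i (swapVar i p) = -demazure i p := by
  apply demazure_eq
  have h := diffVar_mul_demazure i p
  rw [swapVar_swapVar]
  linear_combination -h

theorem demazure_demazure_self (i : Fin (r - 1)) (p : MvPolynomial (Fin r) ℂ) :
    demazure i (demazure i p) = 0 := demazure_eq_zero (swapVar_demazure_self i p)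

section Far

variable {i j : Fin (r - 1)}

theorem swap_comm_far (h : i.val + 1 < j.val) : Equiv.swap (lo i) (hi i) * Equiv.swap (lo j) (hi j) =
    Equiv.swap (lo j) (hi j) * Equiv.swap (lo i) (hi i) :=
  (congrArg unop (isCoxeterFin_simple.comm i j h)).symm

theorem swapVar_comm_far (h : i.val + 1 < j.val) (p : MvPolynomial (Fin r) ℂ) :
    swapVar i (swapVar j p) = swapVar j (swapVar i p) := by
  simp only [swapVar, rename_rename, ← Equiv.Perm.coe_mul, swap_comm_far h]

theorem swapVar_diffVar_far (h : i.val + 1 < j.val) : swapVar i (diffVar j) = diffVar j := by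
  rw [diffVar, map_sub, swapVar_X, swapVar_X, Equiv.swap_apply_of_ne_of_ne,
    Equiv.swap_apply_of_ne_of_ne] <;> simp [lo, hi, Fin.ext_iff] <;> omega

theorem swapVar_diffVar_far' (h : i.val + 1 < j.val) : swapVar j (diffVar i) = diffVar i := by
  rw [diffVar, map_sub, swapVar_X, swapVar_X, Equiv.swap_apply_of_ne_of_ne,
    Equiv.swap_apply_of_ne_of_ne] <;> simp [lo, hi, Fin.ext_iff] <;> omega

theorem swapVar_demazure_far (h : i.val + 1 < j.val) (p : MvPolynomial (Fin r) ℂ) :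
    swapVar i (demazure j p) = demazure j (swapVar i p) := by
  symm
  apply demazure_eq
  have h1 := congrArg (swapVar i) (diffVar_mul_demazure j p)
  rw [map_mul, swapVar_diffVar_far h, map_sub, swapVar_comm_far h] at h1
  exact h1

theorem swapVar_demazure_far' (h : i.val + 1 < j.val) (p : MvPolynomial (Fin r) ℂ) :
    swapVar j (demazure i p) = demazure i (swapVar j p) := by
  symm
  apply demazure_eq
  have h1 := congrArg (swapVar j) (diffVar_mul_demazure i p)
  rw [map_mul, swapVar_diffVar_far' h, map_sub, ← swapVar_comm_far h] at h1
  exact h1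

theorem demazure_comm_far (h : i.val + 1 < j.val) (p : MvPolynomial (Fin r) ℂ) :
    demazure i (demazure j p) = demazure j (demazure i p) := by
  apply demazure_eq
  rw [swapVar_demazure_far h, ← map_sub, ← diffVar_mul_demazure, demazure_mul,
    demazure_eq_zero (swapVar_diffVar_far' h), swapVar_diffVar_far' h]
  ring

end Far

section Near

variable {i j : Fin (r - 1)}

theorem swap_braid (h : i.val + 1 = j.val) : Equiv.swap (lo i) (hi i) * Equiv.swap (lo j) (hi j) * Equiv.swap (lo i) (hi i) =
    Equiv.swap (lo j) (hi j) * Equiv.swap (lo i) (hi i) * Equiv.swap (lo j) (hi j) := by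
  have := congrArg unop (isCoxeterFin_simple.braid i j h)
  simpa [simple, mul_assoc] using this

theorem swapVar_braid (h : i.val + 1 = j.val) (p : MvPolynomial (Fin r) ℂ) :
    swapVar i (swapVar j (swapVar i p)) = swapVar j (swapVar i (swapVar j p)) := by
  simp only [swapVar, rename_rename, ← Equiv.Perm.coe_mul]
  rw [← mul_assoc, ← mul_assoc, swap_braid h]

theorem hi_eq_lo (h : i.val + 1 = j.val) : hi i = lo j := by simp [lo, hi, h]

theorem swapVar_diffVar_near (h : i.val + 1 = j.val) : swapVar i (diffVar j) = diffVar i + diffVar j := by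
  have h3 : hi j ≠ lo i := by simp [lo, hi, Fin.ext_iff]; omega
  have h4 : hi j ≠ hi i := by simp [hi, Fin.ext_iff]; omega
  rw [diffVar, diffVar, map_sub, swapVar_X, swapVar_X, ← hi_eq_lo h, Equiv.swap_apply_right,
    Equiv.swap_apply_of_ne_of_ne h3 h4]
  ring

theorem swapVar_diffVar_near' (h : i.val + 1 = j.val) : swapVar j (diffVar i) = diffVar i + diffVar j := by
  have h3 : lo i ≠ lo j := by simp [lo, Fin.ext_iff]; omega
  have h4 : lo i ≠ hi j := by simp [lo, hi, Fin.ext_iff]; omega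
  rw [diffVar, diffVar, map_sub, swapVar_X, swapVar_X, hi_eq_lo h, Equiv.swap_apply_left,
    Equiv.swap_apply_of_ne_of_ne h3 h4]
  ring

theorem sum_mul_swapVar_demazure (h : i.val + 1 = j.val) (p : MvPolynomial (Fin r) ℂ) :
    (diffVar i + diffVar j) * swapVar i (demazure j p) = swapVar i p - swapVar i (swapVar j p) := by
  rw [← swapVar_diffVar_near h, ← map_mul, diffVar_mul_demazure, map_sub]

theorem sum_mul_swapVar_demazure' (h : i.val + 1 = j.val) (p : MvPolynomial (Fin r) ℂ) :
    (diffVar i + diffVar j) * swapVar j (demazure i p) = swapVar j p - swapVar j (swapVar i p) := by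
  rw [← swapVar_diffVar_near' h, ← map_mul, diffVar_mul_demazure, map_sub]

theorem diffVar_add_ne_zero (h : i.val + 1 = j.val) : diffVar i + diffVar j ≠ 0 := by
  rw [← swapVar_diffVar_near h]
  intro e
  have := congrArg (swapVar i) e
  rw [swapVar_swapVar, map_zero] at this
  exact diffVar_ne_zero j this

/-- Denominators are cleared by the Vandermonde product of the three variables. With δ = `diffVar`,
the third factor δ_i + δ_j = s_i δ_j is the denominator that δ_j becomes under s_i. -/
theorem prod_mul_demazure_demazure (h : i.val + 1 = j.val) (p : MvPolynomial (Fin r) ℂ) :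
    diffVar i * diffVar j * (diffVar i + diffVar j) * demazure i (demazure j p) =
      (diffVar i + diffVar j) * (p - swapVar j p) -
        diffVar j * (swapVar i p - swapVar i (swapVar j p)) := by
  have h1 := diffVar_mul_demazure i (demazure j p)
  have h2 := diffVar_mul_demazure j p
  have h3 := sum_mul_swapVar_demazure h p
  linear_combination diffVar j * (diffVar i + diffVar j) * h1 + (diffVar i + diffVar j) * h2 -
    diffVar j * h3

theorem prod_mul_demazure_demazure' (h : i.val + 1 = j.val) (p : MvPolynomial (Fin r) ℂ) :
    diffVar i * diffVar j * (diffVar i + diffVar j) * demazure j (demazure i p) =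
      (diffVar i + diffVar j) * (p - swapVar i p) -
        diffVar i * (swapVar j p - swapVar j (swapVar i p)) := by
  have h1 := diffVar_mul_demazure j (demazure i p)
  have h2 := diffVar_mul_demazure i p
  have h3 := sum_mul_swapVar_demazure' h p
  linear_combination diffVar i * (diffVar i + diffVar j) * h1 + (diffVar i + diffVar j) * h2 -
    diffVar i * h3

theorem vandermonde_ne_zero (h : i.val + 1 = j.val) : diffVar i * diffVar j * (diffVar i + diffVar j) ≠ 0 :=
  mul_ne_zero (mul_ne_zero (diffVar_ne_zero i) (diffVar_ne_zero j)) (diffVar_add_ne_zero h)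

/-- The product s_i s_j carries the root δ_i = x_i - x_{i+1} to δ_j, hence it conjugates ∂_i to ∂_j.
-/
theorem swapVar_swapVar_demazure (h : i.val + 1 = j.val) (p : MvPolynomial (Fin r) ℂ) :
    swapVar i (swapVar j (demazure i p)) = demazure j (swapVar i (swapVar j p)) := by
  symm
  apply demazure_eq
  have h1 := congrArg (fun q => swapVar i (swapVar j q)) (diffVar_mul_demazure i p)
  simp only [map_mul, map_sub, map_add, swapVar_diffVar_near' h, swapVar_diffVar_near h,
    swapVar_diffVar_self, swapVar_braid h] at h1
  linear_combination h1

theorem swapVar_swapVar_demazure' (h : i.val + 1 = j.val) (p : MvPolynomial (Fin r) ℂ) :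
    swapVar j (swapVar i (demazure j p)) = demazure i (swapVar j (swapVar i p)) := by
  symm
  apply demazure_eq
  have h1 := congrArg (fun q => swapVar j (swapVar i q)) (diffVar_mul_demazure j p)
  simp only [map_mul, map_sub, map_add, swapVar_diffVar_near' h, swapVar_diffVar_near h,
    swapVar_diffVar_self] at h1
  rw [swapVar_braid h]
  linear_combination h1

/-- This is the part of the braid relation for the operators s_i - ∂_i that has two divided
differences and one transposition. After multiplication by the Vandermonde product, both sides
become combinations of the s_w p. -/
theorem demazure_mixed (h : i.val + 1 = j.val) (p : MvPolynomial (Fin r) ℂ) :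
    swapVar i (demazure j (demazure i p)) + demazure i (demazure j (swapVar i p)) =
      demazure j (swapVar i (demazure j p)) := by
  apply mul_left_cancel₀ (vandermonde_ne_zero h)
  have h1 := congrArg (swapVar i) (prod_mul_demazure_demazure' h p)
  simp only [map_mul, map_sub, map_add, swapVar_diffVar_near h, swapVar_diffVar_self,
    swapVar_swapVar] at h1
  have h2 := prod_mul_demazure_demazure h (swapVar i p)
  rw [swapVar_swapVar] at h2
  have h3 := diffVar_mul_demazure j (swapVar i (demazure j p))
  have h4 := sum_mul_swapVar_demazure h p
  have h5 := congrArg (swapVar j) h4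
  simp only [map_mul, map_sub, map_add, swapVar_diffVar_near' h, swapVar_diffVar_self] at h5
  have h6 := swapVar_braid h p
  linear_combination -h1 + h2 - diffVar i * (diffVar i + diffVar j) * h3 - diffVar i * h4 +
    (diffVar i + diffVar j) * h5 + (diffVar i + diffVar j) * h6

theorem demazure_mixed' (h : i.val + 1 = j.val) (p : MvPolynomial (Fin r) ℂ) :
    swapVar j (demazure i (demazure j p)) + demazure j (demazure i (swapVar j p)) =
      demazure i (swapVar j (demazure i p)) := by
  apply mul_left_cancel₀ (vandermonde_ne_zero h)
  have h1 := congrArg (swapVar j) (prod_mul_demazure_demazure h p)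
  simp only [map_mul, map_sub, map_add, swapVar_diffVar_near' h, swapVar_diffVar_self,
    swapVar_swapVar] at h1
  have h2 := prod_mul_demazure_demazure' h (swapVar j p)
  rw [swapVar_swapVar] at h2
  have h3 := diffVar_mul_demazure i (swapVar j (demazure i p))
  have h4 := sum_mul_swapVar_demazure' h p
  have h5 := congrArg (swapVar i) h4
  simp only [map_mul, map_sub, map_add, swapVar_diffVar_near h, swapVar_diffVar_self] at h5
  have h6 := swapVar_braid h p
  linear_combination -h1 + h2 - diffVar j * (diffVar i + diffVar j) * h3 - diffVar j * h4 +
    (diffVar i + diffVar j) * h5 - (diffVar i + diffVar j) * h6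

theorem swapVar_demazure_swapVar (h : i.val + 1 = j.val) (p : MvPolynomial (Fin r) ℂ) :
    swapVar i (demazure j (swapVar i p)) = swapVar j (demazure i (swapVar j p)) := by
  apply mul_left_cancel₀ (diffVar_add_ne_zero h)
  rw [sum_mul_swapVar_demazure h, sum_mul_swapVar_demazure' h, swapVar_swapVar, swapVar_swapVar,
    swapVar_braid h]

theorem demazure_braid (h : i.val + 1 = j.val) (p : MvPolynomial (Fin r) ℂ) :
    demazure i (demazure j (demazure i p)) = demazure j (demazure i (demazure j p)) := by
  apply mul_left_cancel₀ (vandermonde_ne_zero h)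
  -- The outermost divided differences bring one more denominator, δ_i on the left and δ_j on the
  -- right.
  apply mul_left_cancel₀ (mul_ne_zero (diffVar_ne_zero i) (diffVar_ne_zero j))
  have h1 := prod_mul_demazure_demazure' h p
  have h1' := congrArg (swapVar i) h1
  simp only [map_mul, map_sub, map_add, swapVar_diffVar_near h, swapVar_diffVar_self,
    swapVar_swapVar] at h1'
  have h2 := prod_mul_demazure_demazure h p
  have h2' := congrArg (swapVar j) h2
  simp only [map_mul, map_sub, map_add, swapVar_diffVar_near' h, swapVar_diffVar_self,
    swapVar_swapVar] at h2'
  have h3 := diffVar_mul_demazure i (demazure j (demazure i p))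
  have h4 := diffVar_mul_demazure j (demazure i (demazure j p))
  have h6 := swapVar_braid h p
  linear_combination diffVar i * diffVar j * (diffVar i + diffVar j) * (diffVar j * h3 -
    diffVar i * h4) + diffVar j * (h1 + h1') - diffVar i * (h2 + h2') - diffVar i * diffVar j * h6

end Near

end Braid

/-! ### Reduction modulo the cyclotomic polynomial -/

section Reduction

open MvPolynomial

variable {ℓ : ℕ} (ω : Fin ℓ → ℂ) {n : ℕ}

theorem cycPoly_monic : (cycPoly ω).Monic := Polynomial.monic_prod_X_sub_C _ _

theorem cycPoly_natDegree : (cycPoly ω).natDegree = ℓ := by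
  rw [cycPoly, Polynomial.natDegree_prod_of_monic _ _ fun i _ => Polynomial.monic_X_sub_C _]
  simp

/-- The cyclotomic polynomial in the variable `x_k`. -/
def cycVar (k : Fin (n + 1)) : MvPolynomial (Fin (n + 1)) ℂ := Polynomial.aeval (X k) (cycPoly ω)

theorem finSuccEquiv_cycVar_zero :
    finSuccEquiv ℂ n (cycVar ω 0) = (cycPoly ω).map C := by
  have h := Polynomial.aeval_algHom_apply (finSuccEquiv ℂ n).toAlgHom (X 0) (cycPoly ω)
  refine h.symm.trans ?_
  change Polynomial.aeval (finSuccEquiv ℂ n (X 0)) _ = _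
  rw [finSuccEquiv_X_zero]
  exact Polynomial.aeval_X_left_eq_map _

theorem finSuccEquiv_rename_succ (q : MvPolynomial (Fin n) ℂ) :
    finSuccEquiv ℂ n (rename Fin.succ q) = Polynomial.C q := by
  induction q using MvPolynomial.induction_on with
  | C a => rw [rename_C]; simp [finSuccEquiv_apply]
  | add p q hp hq => rw [map_add, map_add, hp, hq, map_add]
  | mul_X p k hp => rw [map_mul, map_mul, hp, rename_X, finSuccEquiv_X_succ, map_mul]

/-- The coefficient of `x_0 ^ (ℓ - 1)`. -/
def topCoeff (ℓ : ℕ) : MvPolynomial (Fin (n + 1)) ℂ →ₗ[ℂ] MvPolynomial (Fin (n + 1)) ℂ where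
  toFun p := rename Fin.succ ((finSuccEquiv ℂ n p).coeff (ℓ - 1))
  map_add' p q := by simp
  map_smul' c p := by simp

theorem topCoeff_apply (p : MvPolynomial (Fin (n + 1)) ℂ) :
    topCoeff ℓ p = rename Fin.succ ((finSuccEquiv ℂ n p).coeff (ℓ - 1)) := rfl

/-- Multiplication by `x_0` modulo the cyclotomic polynomial in `x_0`. -/
def red : MvPolynomial (Fin (n + 1)) ℂ →ₗ[ℂ] MvPolynomial (Fin (n + 1)) ℂ :=
  LinearMap.mulLeft ℂ (X 0) - (LinearMap.mulLeft ℂ (cycVar ω 0)).comp (topCoeff ℓ)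

theorem red_apply (p : MvPolynomial (Fin (n + 1)) ℂ) :
    red ω p = X 0 * p - cycVar ω 0 * topCoeff ℓ p := rfl

theorem degreeOf_zero_le_iff {p : MvPolynomial (Fin (n + 1)) ℂ} {m : ℕ} :
    degreeOf 0 p ≤ m ↔ ∀ N, m < N → (finSuccEquiv ℂ n p).coeff N = 0 := by
  rw [← natDegree_finSuccEquiv, Polynomial.natDegree_le_iff_coeff_eq_zero]

theorem degreeOf_succ_topCoeff_le (k : Fin n) (p : MvPolynomial (Fin (n + 1)) ℂ) :
    degreeOf k.succ (topCoeff ℓ p) ≤ degreeOf k.succ p := by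
  rw [topCoeff_apply, degreeOf_rename_of_injective (Fin.succ_injective n)]
  exact degreeOf_coeff_finSuccEquiv p k _

theorem degreeOf_cycVar_of_ne {j k : Fin (n + 1)} (h : j ≠ k) : degreeOf j (cycVar ω k) = 0 := by
  have e : cycVar ω k = ∏ i, (X k - C (ω i)) := by simp [cycVar, cycPoly, algebraMap_eq]
  rw [e]
  refine Nat.le_zero.1 ((degreeOf_prod_le _ _ _).trans (le_of_eq (Finset.sum_eq_zero fun i _ => ?_)))
  refine Nat.le_zero.1 ((degreeOf_sub_le _ _ _).trans ?_)
  simp [degreeOf_X_of_ne h, degreeOf_C]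

theorem coeff_map_cycPoly (N : ℕ) (h : ℓ ≤ N) :
    ((cycPoly ω).map (C : ℂ →+* MvPolynomial (Fin n) ℂ)).coeff N = if N = ℓ then 1 else 0 := by
  rw [Polynomial.coeff_map]
  split_ifs with e
  · have := (cycPoly_monic ω).coeff_natDegree
    rw [cycPoly_natDegree] at this
    rw [e, this, map_one]
  · rw [Polynomial.coeff_eq_zero_of_natDegree_lt (by rw [cycPoly_natDegree]; omega), map_zero]

/-- Multiplication by x_0 creates at most the power x_0^ℓ, with coefficient `topCoeff ℓ p`;
subtracting that multiple of the monic polynomial f(x_0) of degree ℓ removes it. In the other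
variables `topCoeff` does not raise the degree, and f(x_0) does not involve them. -/
theorem red_mem_restrictDegree (hℓ : 0 < ℓ) {p : MvPolynomial (Fin (n + 1)) ℂ}
    (hp : p ∈ restrictDegree (Fin (n + 1)) ℂ (ℓ - 1)) :
    red ω p ∈ restrictDegree (Fin (n + 1)) ℂ (ℓ - 1) := by
  rw [mem_restrictDegree_iff_degreeOf] at hp ⊢
  intro k
  refine Fin.cases ?_ (fun k => ?_) k
  · rw [degreeOf_zero_le_iff]
    intro N hN
    obtain ⟨N, rfl⟩ : ∃ N', N = N' + 1 := ⟨N - 1, by omega⟩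
    rw [red_apply, map_sub, map_mul, map_mul, finSuccEquiv_X_zero, finSuccEquiv_cycVar_zero,
      topCoeff_apply, finSuccEquiv_rename_succ, Polynomial.coeff_sub, Polynomial.coeff_X_mul,
      Polynomial.coeff_mul_C, coeff_map_cycPoly ω _ (by omega)]
    split_ifs with e
    · have : N = ℓ - 1 := by omega
      rw [this]; ring
    · rw [degreeOf_zero_le_iff.1 (hp 0) N (by omega)]; ring
  · rw [red_apply]
    refine (degreeOf_sub_le _ _ _).trans (max_le ?_ ?_)
    · refine (degreeOf_mul_le _ _ _).trans ?_
      rw [degreeOf_X_of_ne (Fin.succ_ne_zero k), zero_add]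
      exact hp _
    · refine (degreeOf_mul_le _ _ _).trans ?_
      rw [degreeOf_cycVar_of_ne ω (Fin.succ_ne_zero k), zero_add]
      exact (degreeOf_succ_topCoeff_le k p).trans (hp _)

theorem degreeOf_cycVar_zero : degreeOf 0 (cycVar ω (0 : Fin (n + 1))) = ℓ := by
  rw [← natDegree_finSuccEquiv, finSuccEquiv_cycVar_zero,
    (cycPoly_monic ω).natDegree_map, cycPoly_natDegree]

theorem cycVar_ne_zero : cycVar ω (0 : Fin (n + 1)) ≠ 0 := by
  intro h
  have := finSuccEquiv_cycVar_zero ω (n := n)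
  rw [h, map_zero] at this
  exact ((cycPoly_monic ω).map (C : ℂ →+* MvPolynomial (Fin n) ℂ)).ne_zero this.symm

/-- A nonzero multiple of f(x_0) has degree at least ℓ in x_0. This is how the relations of the
representation are checked: the difference of two reduced vectors that is a multiple of f(x_0) must
vanish. -/
theorem eq_zero_of_cycVar_mul (hℓ : 0 < ℓ) {g : MvPolynomial (Fin (n + 1)) ℂ}
    (h : cycVar ω 0 * g ∈ restrictDegree (Fin (n + 1)) ℂ (ℓ - 1)) : g = 0 := by
  by_contra hg
  have := mem_restrictDegree_iff_degreeOf.1 h 0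
  rw [degreeOf_mul_eq (cycVar_ne_zero ω) hg, degreeOf_cycVar_zero] at this
  omega

theorem totalDegree_cycVar_le (k : Fin (n + 1)) : (cycVar ω k).totalDegree ≤ ℓ := by
  have e : cycVar ω k = ∏ i, (X k - C (ω i)) := by simp [cycVar, cycPoly, algebraMap_eq]
  rw [e]
  refine (totalDegree_finsetProd _ _).trans ?_
  calc _ ≤ ∑ i : Fin ℓ, 1 := Finset.sum_le_sum fun i _ => by
        refine (totalDegree_sub _ _).trans ?_
        simp
    _ = ℓ := by simp

theorem topCoeff_eq_zero_of_degreeOf {p : MvPolynomial (Fin (n + 1)) ℂ} {m : ℕ}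
    (hp : degreeOf 0 p ≤ m) (hm : m < ℓ - 1) : topCoeff ℓ p = 0 := by
  rw [topCoeff_apply, degreeOf_zero_le_iff.1 hp _ hm, map_zero]

/-- A nonzero coefficient of x_0^(ℓ-1) has degree at most deg p - (ℓ - 1), and f(x_0) has degree at
most ℓ; hence reduction, like multiplication by x_0, raises the total degree by at most one. -/
theorem cycVar_mul_topCoeff_mem_degLT (hℓ : 0 < ℓ) {d : ℕ} {p : MvPolynomial (Fin (n + 1)) ℂ}
    (hp : p ∈ degLT (n + 1) d) : cycVar ω 0 * topCoeff ℓ p ∈ degLT (n + 1) (d + 1) := by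
  rw [mem_degLT_iff]
  by_cases h : (finSuccEquiv ℂ n p).coeff (ℓ - 1) = 0
  · left; rw [topCoeff_apply, h, map_zero, mul_zero]
  · right
    have h1 := totalDegree_coeff_finSuccEquiv_add_le p (ℓ - 1) h
    have hp0 : p ≠ 0 := by rintro rfl; simp at h
    have h2 := (mem_degLT_iff.1 hp).resolve_left hp0
    have h3 := totalDegree_rename_le Fin.succ ((finSuccEquiv ℂ n p).coeff (ℓ - 1))
    have h4 := totalDegree_mul (cycVar ω (0 : Fin (n + 1))) (topCoeff ℓ p)
    have h5 := totalDegree_cycVar_le ω (0 : Fin (n + 1))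
    rw [topCoeff_apply] at h4 ⊢
    omega

theorem red_mem_degLT (hℓ : 0 < ℓ) {d : ℕ} {p : MvPolynomial (Fin (n + 1)) ℂ}
    (hp : p ∈ degLT (n + 1) d) : red ω p ∈ degLT (n + 1) (d + 1) :=
  Submodule.sub_mem _ (X_mul_mem_degLT hp 0) (cycVar_mul_topCoeff_mem_degLT ω hℓ hp)

theorem topCoeff_X_succ_mul (k : Fin n) (p : MvPolynomial (Fin (n + 1)) ℂ) :
    topCoeff ℓ (X k.succ * p) = X k.succ * topCoeff ℓ p := by
  rw [topCoeff_apply, topCoeff_apply, map_mul, finSuccEquiv_X_succ, Polynomial.coeff_C_mul,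
    map_mul, rename_X]

theorem finSuccEquiv_cycVar_succ (k : Fin n) :
    finSuccEquiv ℂ n (cycVar ω k.succ) = Polynomial.C (Polynomial.aeval (X k) (cycPoly ω)) := by
  rw [← finSuccEquiv_rename_succ]
  congr 1
  rw [← Polynomial.aeval_algHom_apply, rename_X]; rfl

theorem topCoeff_cycVar_succ_mul (k : Fin n) (p : MvPolynomial (Fin (n + 1)) ℂ) :
    topCoeff ℓ (cycVar ω k.succ * p) = cycVar ω k.succ * topCoeff ℓ p := by
  rw [topCoeff_apply, topCoeff_apply, map_mul, finSuccEquiv_cycVar_succ, Polynomial.coeff_C_mul,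
    map_mul, ← Polynomial.aeval_algHom_apply, rename_X]; rfl

end Reduction

/-! ### The spanning set x^α w and the upper bound for the dimension. -/

section Spanning

open MvPolynomial

variable {ℓ : ℕ} (ω : Fin ℓ → ℂ) {n : ℕ}

theorem evX_cycVar_zero : evX ω (cycVar ω (0 : Fin (n + 1))) = 0 := by
  rw [cycVar, ← Polynomial.aeval_algHom_apply, evX_X]
  exact aeval_x_zero ω 0 rfl

theorem evX_red (p : MvPolynomial (Fin (n + 1)) ℂ) : evX ω (red ω p) = x ω 0 * evX ω p := by
  rw [red_apply, map_sub, map_mul, map_mul, evX_cycVar_zero, zero_mul, sub_zero, evX_X]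

/-- The span of the elements `p w`, where `p` has degree less than `ℓ` in each variable. -/
def stdSpan : Submodule ℂ (Hecke ω (n + 1)) :=
  Submodule.span ℂ {a | ∃ p ∈ restrictDegree (Fin (n + 1)) ℂ (ℓ - 1), ∃ σ, a = evX ω p * pm ω σ}

theorem s_mul_mem_stdSpan (i : Fin (n + 1 - 1)) {a : Hecke ω (n + 1)} (ha : a ∈ stdSpan ω) :
    s ω i * a ∈ stdSpan ω := by
  unfold stdSpan at ha
  induction ha using Submodule.span_induction with
  | mem a h =>
    obtain ⟨p, hp, σ, rfl⟩ := h
    rw [← mul_assoc, s_mul_evX, sub_mul, mul_assoc, s_mul_pm]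
    exact Submodule.sub_mem _ (Submodule.subset_span ⟨_, swapVar_mem_restrictDegree hp i, _, rfl⟩)
      (Submodule.subset_span ⟨_, demazure_mem_restrictDegree hp i, _, rfl⟩)
  | zero => simp
  | add a b _ _ ha hb => rw [mul_add]; exact Submodule.add_mem _ ha hb
  | smul c a _ ha => rw [mul_smul_comm]; exact Submodule.smul_mem _ _ ha

theorem x_zero_mul_mem_stdSpan (hℓ : 0 < ℓ) {a : Hecke ω (n + 1)} (ha : a ∈ stdSpan ω) :
    x ω 0 * a ∈ stdSpan ω := by
  unfold stdSpan at ha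
  induction ha using Submodule.span_induction with
  | mem a h =>
    obtain ⟨p, hp, σ, rfl⟩ := h
    rw [← mul_assoc, ← evX_red]
    exact Submodule.subset_span ⟨_, red_mem_restrictDegree ω hℓ hp, _, rfl⟩
  | zero => simp
  | add a b _ _ ha hb => rw [mul_add]; exact Submodule.add_mem _ ha hb
  | smul c a _ ha => rw [mul_smul_comm]; exact Submodule.smul_mem _ _ ha

theorem x_mul_mem_stdSpan (hℓ : 0 < ℓ) (k : Fin (n + 1)) {a : Hecke ω (n + 1)}
    (ha : a ∈ stdSpan ω) : x ω k * a ∈ stdSpan ω := by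
  induction k using Fin.induction generalizing a with
  | zero => exact x_zero_mul_mem_stdSpan ω hℓ ha
  | succ k ih =>
    have h := x_hi_eq ω (r := n + 1) k
    change x ω k.succ = _ at h
    rw [h, add_mul, mul_assoc, mul_assoc]
    exact Submodule.add_mem _ (s_mul_mem_stdSpan ω k (ih (s_mul_mem_stdSpan ω k ha)))
      (s_mul_mem_stdSpan ω k ha)

/-- The span is a left ideal that contains 1: the s_i preserve it, so does x_0 by reduction, and the
remaining x_k follow from x_{k+1} = s_k x_k s_k + s_k. -/
theorem stdSpan_eq_top (hℓ : 0 < ℓ) : stdSpan ω (n := n) = ⊤ := by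
  rw [eq_top_iff]
  intro a _
  have key : ∀ b ∈ stdSpan ω (n := n), a * b ∈ stdSpan ω := by
    induction a using hecke_induction with
    | hC c => intro b hb; rw [← Algebra.smul_def]; exact Submodule.smul_mem _ _ hb
    | hs i => exact fun b hb => s_mul_mem_stdSpan ω i hb
    | hx i => exact fun b hb => x_mul_mem_stdSpan ω hℓ i hb
    | hadd a b ha hb =>
      intro c hc; rw [add_mul]; exact Submodule.add_mem _ (ha trivial c hc) (hb trivial c hc)
    | hmul a b ha hb => intro c hc; rw [mul_assoc]; exact ha trivial _ (hb trivial c hc)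
  have h1 : (1 : Hecke ω (n + 1)) ∈ stdSpan ω := Submodule.subset_span ⟨1, by
    rw [mem_restrictDegree_iff_degreeOf]; intro k; rw [← C_1, degreeOf_C]; exact Nat.zero_le _,
    1, by rw [map_one, pm_one, one_mul]⟩
  simpa using key 1 h1

/-- The elements `x^α w` with exponents less than `ℓ`. -/
def stdMonomial (p : (Fin (n + 1) → Fin ℓ) × Equiv.Perm (Fin (n + 1))) : Hecke ω (n + 1) :=
  evX ω (monomial (Finsupp.equivFunOnFinite.symm fun k => (p.1 k).val) 1) * pm ω p.2

theorem span_stdMonomial (hℓ : 0 < ℓ) :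
    Submodule.span ℂ (Set.range (stdMonomial ω (n := n))) = ⊤ := by
  rw [eq_top_iff, ← stdSpan_eq_top ω hℓ, stdSpan, Submodule.span_le]
  rintro _ ⟨p, hp, σ, rfl⟩
  rw [restrictDegree, restrictSupport_eq_span] at hp
  induction hp using Submodule.span_induction with
  | mem p h =>
    obtain ⟨m, hm, rfl⟩ := h
    refine Submodule.subset_span ⟨(fun k => ⟨m k, ?_⟩, σ), ?_⟩
    · have := hm k; omega
    · have e : (Finsupp.equivFunOnFinite.symm fun k => m k) = m := by ext; rfl
      simp only [stdMonomial, e]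
  | zero => simp
  | add a b _ _ ha hb => rw [map_add, add_mul]; exact Submodule.add_mem _ ha hb
  | smul c a _ ha => rw [map_smul, smul_mul_assoc]; exact Submodule.smul_mem _ _ ha

theorem hecke_finite (hℓ : 0 < ℓ) : Module.Finite ℂ (Hecke ω (n + 1)) :=
  ⟨⟨(Set.finite_range (stdMonomial ω (n := n))).toFinset, by
    rw [Set.Finite.coe_toFinset]; exact span_stdMonomial ω hℓ⟩⟩

theorem finrank_hecke_le (hℓ : 0 < ℓ) :
    Module.finrank ℂ (Hecke ω (n + 1)) ≤ ℓ ^ (n + 1) * (n + 1).factorial := by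
  have h := finrank_range_le_card (R := ℂ) (stdMonomial ω (n := n))
  rw [Set.finrank, span_stdMonomial ω hℓ, finrank_top] at h
  simpa [Fintype.card_perm] using h

end Spanning

/-! ### Modules over the Hecke algebra -/

section Lift

variable {ℓ : ℕ} (ω : Fin ℓ → ℂ) {n : ℕ} {E : Type*} [Ring E]

/-- The elements determined by `x_0` and `x_{k+1} = s_k x_k s_k + s_k`. -/
def jm (S : Fin n → E) (x0 : E) (k : Fin (n + 1)) : E :=
  Fin.induction (motive := fun _ => E) x0 (fun k y => S k * y * S k + S k) k

theorem jm_succ (S : Fin n → E) (x0 : E) (k : Fin n) :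
    jm S x0 k.succ = S k * jm S x0 k.castSucc * S k + S k := by
  simp [jm]

variable {S : Fin n → E} {x0 : E}

theorem jm_commute_of_lt (hS : IsCoxeterFin (r := n + 1) S)
    (h0 : ∀ j : Fin n, 0 < j.val → Commute x0 (S j)) (k : Fin (n + 1)) (j : Fin n)
    (hj : k.val < j.val) : Commute (jm S x0 k) (S j) := by
  induction k using Fin.induction with
  | zero => exact h0 j hj
  | succ k ih =>
    rw [jm_succ]
    have h1 : Commute (S k) (S j) := hS.comm k j (by simpa using hj)
    have h2 := ih (by simp at hj ⊢; omega)
    exact ((h1.mul_left h2).mul_left h1).add_left h1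

/-- Only the case j + 1 = k needs an argument. With y the element of index j, the next but one is
S_k S_j y S_j S_k + S_k S_j S_k + S_k, where y commutes with S_k. The braid relation carries S_j
through the first term, and it exchanges the contributions of the other two. -/
theorem jm_commute_of_gt (hS : IsCoxeterFin (r := n + 1) S)
    (h0 : ∀ j : Fin n, 0 < j.val → Commute x0 (S j)) (k : Fin (n + 1)) (j : Fin n)
    (hj : j.val + 1 < k.val) : Commute (jm S x0 k) (S j) := by
  induction k using Fin.induction with
  | zero => simp at hj
  | succ k ih =>
    rcases Nat.lt_or_ge (j.val + 1) k.val with h | h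
    · rw [jm_succ]
      have h1 : Commute (S k) (S j) := (hS.comm j k h).symm
      have h2 := ih (by simpa using h)
      exact ((h1.mul_left h2).mul_left h1).add_left h1
    · have e : j.val + 1 = k.val := by simp at hj; omega
      have e' : k.castSucc = j.succ := by ext; simp [e]
      rw [jm_succ, e', jm_succ]
      have c := (jm_commute_of_lt hS h0 j.castSucc k (by simp; omega)).eq
      have b := hS.braid j k e
      have q := hS.sq j
      have q' := hS.sq k
      set y := jm S x0 j.castSucc
      have E1 : S k * (S j * y * S j) * S k * S j = S j * (S k * (S j * y * S j) * S k) := by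
        calc S k * (S j * y * S j) * S k * S j
            = S k * S j * y * (S j * S k * S j) := by simp only [mul_assoc]
          _ = S k * S j * (y * S k) * (S j * S k) := by rw [b]; simp only [mul_assoc]
          _ = (S k * S j * S k) * y * (S j * S k) := by rw [c]; simp only [mul_assoc]
          _ = _ := by rw [← b]; simp only [mul_assoc]
      have E2 : S k * S j * S k * S j = S j * S k := by rw [← b, mul_assoc, q, mul_one]
      have E3 : S j * (S k * S j * S k) = S k * S j := by
        rw [← b, ← mul_assoc, ← mul_assoc, q, one_mul]
      change (S k * (S j * y * S j + S j) * S k + S k) * S j =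
        S j * (S k * (S j * y * S j + S j) * S k + S k)
      simp only [mul_add, add_mul]
      rw [E1, E2, E3]
      abel

/-- The commutation of the first two elements is passed upwards. By induction, the element of index
k commutes with its successor; it commutes with S_{k+1}, hence with the element of index k + 2. The
latter also commutes with S_k, thus with S_k y S_k + S_k for y of index k. -/
theorem jm_commute_succ (hS : IsCoxeterFin (r := n + 1) S)
    (h0 : ∀ j : Fin n, 0 < j.val → Commute x0 (S j))
    (h1 : ∀ j : Fin n, j.val = 0 → Commute x0 (S j * x0 * S j + S j)) (k : Fin n) :
    Commute (jm S x0 k.castSucc) (jm S x0 k.succ) := by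
  obtain ⟨k, hk⟩ := k
  induction k with
  | zero =>
    rw [jm_succ]
    exact h1 ⟨0, hk⟩ rfl
  | succ k ih =>
    have ih := ih (by omega)
    set a : Fin n := ⟨k, by omega⟩ with ha
    set b : Fin n := ⟨k + 1, hk⟩ with hb
    have e : b.castSucc = a.succ := rfl
    have c1 : Commute (jm S x0 b.succ) (S a) := jm_commute_of_gt hS h0 _ _ (by simp [ha, hb])
    have c2 : Commute (jm S x0 a.castSucc) (S b) := jm_commute_of_lt hS h0 _ _ (by simp [ha, hb])
    have c3 : Commute (jm S x0 a.castSucc) (jm S x0 b.succ) := by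
      rw [jm_succ, e]
      exact ((c2.mul_right ih).mul_right c2).add_right c2
    rw [e, jm_succ S x0 a]
    exact ((c1.symm.mul_left c3).mul_left c1.symm).add_left c1.symm

theorem jm_commute (hS : IsCoxeterFin (r := n + 1) S)
    (h0 : ∀ j : Fin n, 0 < j.val → Commute x0 (S j))
    (h1 : ∀ j : Fin n, j.val = 0 → Commute x0 (S j * x0 * S j + S j)) (i j : Fin (n + 1)) :
    Commute (jm S x0 i) (jm S x0 j) := by
  have key : ∀ j i : Fin (n + 1), i < j → Commute (jm S x0 i) (jm S x0 j) := by
    intro j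
    induction j using Fin.induction with
    | zero => intro i hi; simp at hi
    | succ j ih =>
      intro i hi
      rcases (Fin.le_castSucc_iff.2 hi).eq_or_lt with e | h
      · rw [e]; exact jm_commute_succ hS h0 h1 j
      · have c := jm_commute_of_lt hS h0 i j h
        rw [jm_succ]
        exact ((c.mul_right (ih i h)).mul_right c).add_right c
  rcases lt_trichotomy i j with h | h | h
  · exact key _ _ h
  · rw [h]
  · exact (key _ _ h).symm

variable [Algebra ℂ E]

/-- The algebra homomorphism determined by elements satisfying the Coxeter relations and by a
compatible element `x0`. -/
def heckeLift (hS : IsCoxeterFin (r := n + 1) S)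
    (h0 : ∀ j : Fin n, 0 < j.val → Commute x0 (S j))
    (h1 : ∀ j : Fin n, j.val = 0 → Commute x0 (S j * x0 * S j + S j))
    (hf : Polynomial.aeval x0 (cycPoly ω) = 0) : Hecke ω (n + 1) →ₐ[ℂ] E :=
  RingQuot.liftAlgHom ℂ ⟨FreeAlgebra.lift ℂ fun g => match g with
    | Gen.s i => S i
    | Gen.x k => jm S x0 k, by
      have es : ∀ i : Fin n, FreeAlgebra.lift ℂ (fun g : Gen (n + 1) => match g with
        | Gen.s i => S i
        | Gen.x k => jm S x0 k) (Free.s (r := n + 1) i) = S i := fun i =>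
          FreeAlgebra.lift_ι_apply _ _
      have ex : ∀ k : Fin (n + 1), FreeAlgebra.lift ℂ (fun g : Gen (n + 1) => match g with
        | Gen.s i => S i
        | Gen.x k => jm S x0 k) (Free.x (r := n + 1) k) = jm S x0 k := fun i =>
          FreeAlgebra.lift_ι_apply _ _
      intro a b h
      cases h with
      | s_sq i => rw [map_mul, es, map_one]; exact hS.sq i
      | x_comm i j => rw [map_mul, map_mul, ex, ex]; exact jm_commute hS h0 h1 i j
      | s_comm i j h => rw [map_mul, map_mul, es, es]; exact hS.comm i j h
      | s_x_comm i j hj1 hj2 =>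
        rw [map_mul, map_mul, es, ex]
        have e1 : j.val ≠ i.val := fun e => hj1 (Fin.ext e)
        have e2 : j.val ≠ i.val + 1 := fun e => hj2 (Fin.ext e)
        rcases Nat.lt_or_ge j.val i.val with h | h
        · exact (jm_commute_of_lt hS h0 j i h).symm
        · exact (jm_commute_of_gt hS h0 j i (by omega)).symm
      | x_s i =>
        have : jm S x0 (hi (r := n + 1) i) =
          S i * jm S x0 (lo (r := n + 1) i) * S i + S i := jm_succ S x0 i
        have q := hS.sq i
        rw [map_sub, map_mul, map_mul, es, ex, ex, map_neg, map_one, this, mul_add, ← mul_assoc,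
          ← mul_assoc, q, one_mul]
        abel
      | s_x i =>
        have : jm S x0 (hi (r := n + 1) i) =
          S i * jm S x0 (lo (r := n + 1) i) * S i + S i := jm_succ S x0 i
        have q := hS.sq i
        rw [map_sub, map_mul, map_mul, es, ex, ex, map_neg, map_one, this, add_mul, mul_assoc _ (S i),
          q, mul_one]
        abel
      | braid i j h => simp only [map_mul]; rw [es, es]; exact hS.braid i j h
      | cyclotomic i h =>
        have : i = 0 := Fin.ext h
        rw [← Polynomial.aeval_algHom_apply, ex, this, map_zero]
        exact hf⟩

variable (hS : IsCoxeterFin (r := n + 1) S)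
    (h0 : ∀ j : Fin n, 0 < j.val → Commute x0 (S j))
    (h1 : ∀ j : Fin n, j.val = 0 → Commute x0 (S j * x0 * S j + S j))
    (hf : Polynomial.aeval x0 (cycPoly ω) = 0)

theorem heckeLift_s (i : Fin n) : heckeLift ω hS h0 h1 hf (s ω (r := n + 1) i) = S i := by
  have : heckeLift ω hS h0 h1 hf (s ω (r := n + 1) i) = _ := RingQuot.liftAlgHom_mkAlgHom_apply _ _ _ _
  exact this.trans (FreeAlgebra.lift_ι_apply _ _)

theorem heckeLift_x_zero : heckeLift ω hS h0 h1 hf (x ω (r := n + 1) 0) = x0 := by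
  have : heckeLift ω hS h0 h1 hf (x ω (r := n + 1) 0) = _ := RingQuot.liftAlgHom_mkAlgHom_apply _ _ _ _
  exact this.trans (FreeAlgebra.lift_ι_apply _ _)

end Lift

/-! ### The module with basis `x^α w` -/

section Module

open MvPolynomial

variable {ℓ : ℕ} (ω : Fin ℓ → ℂ) {n : ℕ}

/-- Combinations of permutations with polynomial coefficients. -/
abbrev PolyPerm (n : ℕ) : Type := Equiv.Perm (Fin (n + 1)) → MvPolynomial (Fin (n + 1)) ℂ

/-- Left multiplication by `s_i`, for the relation `s_i p = (s_i p) s_i - ∂_i p`. -/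
def sHat (i : Fin n) : PolyPerm n →ₗ[ℂ] PolyPerm n where
  toFun v σ := swapVar (r := n + 1) i (v (σ * Equiv.swap (lo (r := n + 1) i) (hi (r := n + 1) i))) -
    demazure (r := n + 1) i (v σ)
  map_add' u v := by funext σ; simp; abel
  map_smul' c v := by funext σ; simp [smul_sub]

theorem sHat_apply (i : Fin n) (v : PolyPerm n) (σ : Equiv.Perm (Fin (n + 1))) :
    sHat i v σ = swapVar (r := n + 1) i
      (v (σ * Equiv.swap (lo (r := n + 1) i) (hi (r := n + 1) i))) -
      demazure (r := n + 1) i (v σ) := rfl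

/-- Coefficientwise, the relations become identities between transpositions and divided differences.
For the braid relation the terms are grouped by the permutation at which v is evaluated, and each
group is covered by an identity for neighbouring divided differences. -/
theorem isCoxeterFin_sHat : IsCoxeterFin (r := n + 1) (M := Module.End ℂ (PolyPerm n)) sHat where
  sq i := by
    refine LinearMap.ext fun v => funext fun σ => ?_
    simp only [Module.End.mul_apply, Module.End.one_apply, sHat_apply, map_sub, mul_assoc,
      Equiv.swap_mul_self, mul_one, swapVar_swapVar, swapVar_demazure_self, demazure_swapVar_self,
      demazure_demazure_self]
    ring
  comm i j h := by
    refine LinearMap.ext fun v => funext fun σ => ?_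
    simp only [Module.End.mul_apply, sHat_apply, map_sub, mul_assoc, swap_comm_far h,
      swapVar_comm_far h, swapVar_demazure_far h, swapVar_demazure_far' h, demazure_comm_far h]
    ring
  braid i j h := by
    refine LinearMap.ext fun v => funext fun σ => ?_
    have b := swap_braid h
    rw [mul_assoc, mul_assoc] at b
    simp only [Module.End.mul_apply, sHat_apply, map_sub, mul_assoc, b, Equiv.swap_mul_self, mul_one,
      swapVar_braid h, swapVar_swapVar_demazure h, swapVar_swapVar_demazure' h]
    have e1 := demazure_mixed h (v (σ * Equiv.swap (lo (r := n + 1) i) (hi (r := n + 1) i)))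
    have e2 := demazure_mixed' h (v (σ * Equiv.swap (lo (r := n + 1) j) (hi (r := n + 1) j)))
    have e3 := swapVar_demazure_swapVar h (v σ)
    have e4 := demazure_braid h (v σ)
    rw [e3, e4, ← e1, ← e2]
    ring

/-- Multiplication by a polynomial. -/
def mulHat (p : MvPolynomial (Fin (n + 1)) ℂ) : PolyPerm n →ₗ[ℂ] PolyPerm n where
  toFun v σ := p * v σ
  map_add' u v := by funext σ; simp [mul_add]
  map_smul' c v := by funext σ; simp

theorem mulHat_apply (p : MvPolynomial (Fin (n + 1)) ℂ) (v : PolyPerm n)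
    (σ : Equiv.Perm (Fin (n + 1))) : mulHat p v σ = p * v σ := rfl

/-- Reduction in all coefficients. -/
def redHat : PolyPerm n →ₗ[ℂ] PolyPerm n where
  toFun v σ := red ω (v σ)
  map_add' u v := by funext σ; simp
  map_smul' c v := by funext σ; simp

theorem redHat_apply (v : PolyPerm n) (σ : Equiv.Perm (Fin (n + 1))) :
    redHat ω v σ = red ω (v σ) := rfl

/-- The coefficients of `x_0 ^ (ℓ - 1)`. -/
def topHat (ℓ : ℕ) : PolyPerm n →ₗ[ℂ] PolyPerm n where
  toFun v σ := topCoeff ℓ (v σ)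
  map_add' u v := by funext σ; simp
  map_smul' c v := by funext σ; simp

theorem topHat_apply (v : PolyPerm n) (σ : Equiv.Perm (Fin (n + 1))) :
    topHat ℓ v σ = topCoeff ℓ (v σ) := rfl

theorem mulHat_mulHat (p q : MvPolynomial (Fin (n + 1)) ℂ) (v : PolyPerm n) :
    mulHat p (mulHat q v) = mulHat (p * q) v := by
  funext σ; exact (mul_assoc _ _ _).symm

theorem redHat_eq (v : PolyPerm n) :
    redHat ω v = mulHat (X 0) v - mulHat (cycVar ω 0) (topHat ℓ v) := rfl

theorem sHat_mulHat (i : Fin n) (p : MvPolynomial (Fin (n + 1)) ℂ) (v : PolyPerm n) :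
    sHat i (mulHat p v) = mulHat (swapVar (r := n + 1) i p) (sHat i v) -
      mulHat (demazure (r := n + 1) i p) v := by
  funext σ
  change swapVar (r := n + 1) i (p * v _) - demazure (r := n + 1) i (p * v σ) =
    swapVar (r := n + 1) i p * (swapVar (r := n + 1) i (v _) - demazure (r := n + 1) i (v σ)) -
      demazure (r := n + 1) i p * v σ
  rw [map_mul, demazure_mul]
  ring

/-- The subspace where all exponents are less than `ℓ`. -/
def stdSub (ℓ n : ℕ) : Submodule ℂ (PolyPerm n) :=
  Submodule.pi Set.univ fun _ => restrictDegree (Fin (n + 1)) ℂ (ℓ - 1)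

theorem mem_stdSub {v : PolyPerm n} :
    v ∈ stdSub ℓ n ↔ ∀ σ, v σ ∈ restrictDegree (Fin (n + 1)) ℂ (ℓ - 1) := by
  simp [stdSub]

theorem sHat_mem_stdSub (i : Fin n) {v : PolyPerm n} (hv : v ∈ stdSub ℓ n) :
    sHat i v ∈ stdSub ℓ n := by
  rw [mem_stdSub] at hv ⊢
  exact fun σ => Submodule.sub_mem _ (swapVar_mem_restrictDegree (hv _) _)
    (demazure_mem_restrictDegree (hv _) _)

theorem redHat_mem_stdSub (hℓ : 0 < ℓ) {v : PolyPerm n} (hv : v ∈ stdSub ℓ n) :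
    redHat ω v ∈ stdSub ℓ n := by
  rw [mem_stdSub] at hv ⊢
  exact fun σ => red_mem_restrictDegree ω hℓ (hv _)

theorem eq_zero_of_mulHat_cycVar (hℓ : 0 < ℓ) {v : PolyPerm n}
    (h : mulHat (cycVar ω 0) v ∈ stdSub ℓ n) : v = 0 := by
  rw [mem_stdSub] at h
  funext σ
  exact eq_zero_of_cycVar_mul ω hℓ (h σ)

theorem swapVar_cycVar_lo (i : Fin n) :
    swapVar (r := n + 1) i (cycVar ω i.castSucc) = cycVar ω i.succ := by
  rw [cycVar, ← Polynomial.aeval_algHom_apply, swapVar_X]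
  rw [show i.castSucc = lo (r := n + 1) i from rfl, Equiv.swap_apply_left]
  rfl

theorem swapVar_cycVar_hi (i : Fin n) :
    swapVar (r := n + 1) i (cycVar ω i.succ) = cycVar ω i.castSucc := by
  rw [← swapVar_cycVar_lo, swapVar_swapVar]

theorem degreeOf_swapVar_zero {i : Fin n} (hi0 : i.val = 0) (p : MvPolynomial (Fin (n + 1)) ℂ) :
    degreeOf 0 (swapVar (r := n + 1) i p) = degreeOf i.succ p := by
  have : (0 : Fin (n + 1)) = Equiv.swap (lo (r := n + 1) i) (hi (r := n + 1) i) i.succ := by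
    rw [show i.succ = hi (r := n + 1) i from rfl, Equiv.swap_apply_right]
    exact Fin.ext hi0.symm
  rw [this, swapVar, degreeOf_rename_of_injective (Equiv.injective _)]

/-- Let q = `topCoeff ℓ p`, which is free of x_0, and D = ∂_i (f(x_0) q). In (x_0 - x_1) D = f(x_0)
q - f(x_1) s_i q the last term has degree less than ℓ in x_0. Comparing coefficients from the top
down shows that D has no powers x_0^N with N ≥ ℓ, and then that its coefficient of x_0^(ℓ-1) is q.
-/
theorem topCoeff_demazure_cycVar_mul (hℓ : 0 < ℓ) {i : Fin n} (hi0 : i.val = 0)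
    {p : MvPolynomial (Fin (n + 1)) ℂ} (hp : p ∈ restrictDegree (Fin (n + 1)) ℂ (ℓ - 1)) :
    topCoeff ℓ (demazure (r := n + 1) i (cycVar ω 0 * topCoeff ℓ p)) = topCoeff ℓ p := by
  have hc : i.castSucc = 0 := Fin.ext hi0
  set q' := (finSuccEquiv ℂ n p).coeff (ℓ - 1) with hq'
  have hq : topCoeff ℓ p = rename Fin.succ q' := rfl
  set D := demazure (r := n + 1) i (cycVar ω 0 * topCoeff ℓ p) with hD
  have hdeg : degreeOf i.succ (topCoeff ℓ p) ≤ ℓ - 1 :=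
    (degreeOf_succ_topCoeff_le i p).trans (mem_restrictDegree_iff_degreeOf.1 hp _)
  have key := diffVar_mul_demazure (r := n + 1) i (cycVar ω 0 * topCoeff ℓ p)
  rw [← hD, map_mul, ← hc, swapVar_cycVar_lo, hc] at key
  have hsw : degreeOf 0 (swapVar (r := n + 1) i (topCoeff ℓ p)) ≤ ℓ - 1 := by
    rw [degreeOf_swapVar_zero hi0]; exact hdeg
  have hdiff : finSuccEquiv ℂ n (diffVar (r := n + 1) i) = Polynomial.X - Polynomial.C (X i) := by
    have : diffVar (r := n + 1) i = X 0 - X i.succ := by rw [← hc]; rfl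
    rw [this, map_sub, finSuccEquiv_X_zero, finSuccEquiv_X_succ]
  have key2 := congrArg (finSuccEquiv ℂ n) key
  rw [map_mul, map_sub, map_mul, map_mul, hdiff, finSuccEquiv_cycVar_zero, hq,
    finSuccEquiv_rename_succ, finSuccEquiv_cycVar_succ, ← hq] at key2
  -- This is the coefficient of x_0^(N+1) in `key2`; the variable x_1 appears as `X i` after x_0 is
  -- split off.
  have hco : ∀ N, ℓ ≤ N + 1 → (finSuccEquiv ℂ n D).coeff N =
      X i * (finSuccEquiv ℂ n D).coeff (N + 1) + if N + 1 = ℓ then q' else 0 := by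
    intro N hN
    have := congrArg (fun P : Polynomial (MvPolynomial (Fin n) ℂ) => P.coeff (N + 1)) key2
    simp only [sub_mul, Polynomial.coeff_sub, Polynomial.coeff_X_mul, Polynomial.coeff_C_mul,
      Polynomial.coeff_mul_C] at this
    rw [coeff_map_cycPoly ω _ hN, degreeOf_zero_le_iff.1 hsw _ (by omega)] at this
    rw [sub_eq_iff_eq_add] at this
    rw [this]
    split_ifs <;> ring
  -- Descending induction on N: the number k measures how far N may lie below the vanishing range.
  have hz : ∀ k N, ℓ ≤ N → (finSuccEquiv ℂ n D).natDegree < N + k →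
      (finSuccEquiv ℂ n D).coeff N = 0 := by
    intro k
    induction k with
    | zero => exact fun N _ h => Polynomial.coeff_eq_zero_of_natDegree_lt h
    | succ k ih =>
      intro N hN h
      rw [hco N (by omega), ih (N + 1) (by omega) (by omega), if_neg (by omega)]
      ring
  rw [topCoeff_apply, hco (ℓ - 1) (by omega), if_pos (by omega),
    hz ((finSuccEquiv ℂ n D).natDegree + 1) _ (by omega) (by omega), mul_zero, zero_add, hq]

theorem mulHat_one (v : PolyPerm n) : mulHat 1 v = v := by
  funext σ; exact one_mul _

theorem mulHat_add (p q : MvPolynomial (Fin (n + 1)) ℂ) (v : PolyPerm n) :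
    mulHat (p + q) v = mulHat p v + mulHat q v := by
  funext σ; exact add_mul _ _ _

theorem mulHat_zero_left (v : PolyPerm n) : mulHat 0 v = 0 := by
  funext σ; exact zero_mul _

theorem sHat_sHat (i : Fin n) (v : PolyPerm n) : sHat i (sHat i v) = v :=
  congrArg (fun f : Module.End ℂ (PolyPerm n) => f v) (isCoxeterFin_sHat.sq i)

theorem sHat_mulHat_of_symm (i : Fin n) {p : MvPolynomial (Fin (n + 1)) ℂ}
    (hp : swapVar (r := n + 1) i p = p) (v : PolyPerm n) :
    sHat i (mulHat p v) = mulHat p (sHat i v) := by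
  rw [sHat_mulHat, hp, demazure_eq_zero hp, mulHat_zero_left, sub_zero]

theorem sHat_mulHat_lo (i : Fin n) (v : PolyPerm n) :
    sHat i (mulHat (X i.castSucc) v) = mulHat (X i.succ) (sHat i v) - v := by
  rw [sHat_mulHat, show i.castSucc = lo (r := n + 1) i from rfl, demazure_X_lo, swapVar_X,
    Equiv.swap_apply_left, mulHat_one]
  rfl

theorem mulHat_lo_sHat (i : Fin n) (v : PolyPerm n) :
    mulHat (X i.castSucc) (sHat i v) = sHat i (mulHat (X i.succ) v) - v := by
  have := sHat_mulHat_lo i (sHat i v)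
  rw [sHat_sHat] at this
  have h2 := congrArg (sHat i) this
  rw [sHat_sHat, map_sub, sHat_sHat] at h2
  rw [h2]

/-- The operator s_j commutes with multiplication by x_0 and by f(x_0), so the commutator with the
reduction is a multiple of f(x_0). It is also reduced, hence zero. -/
theorem redHat_sHat_comm (hℓ : 0 < ℓ) {j : Fin n} (hj : 0 < j.val) {v : PolyPerm n}
    (hv : v ∈ stdSub ℓ n) : redHat ω (sHat j v) = sHat j (redHat ω v) := by
  have h1 : (0 : Fin (n + 1)) ≠ lo (r := n + 1) j := by
    intro e; have := congrArg Fin.val e; simp [lo] at this; omega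
  have h2 : (0 : Fin (n + 1)) ≠ hi (r := n + 1) j := by
    intro e; have := congrArg Fin.val e; simp [hi] at this
  have hX : swapVar (r := n + 1) j (X 0) = X 0 := by
    rw [swapVar_X, Equiv.swap_apply_of_ne_of_ne h1 h2]
  have hf : swapVar (r := n + 1) j (cycVar ω 0) = cycVar ω 0 := by
    rw [cycVar, ← Polynomial.aeval_algHom_apply, hX]
  have hm := Submodule.sub_mem _ (redHat_mem_stdSub ω hℓ (sHat_mem_stdSub j hv))
    (sHat_mem_stdSub j (redHat_mem_stdSub ω hℓ hv))
  have e : redHat ω (sHat j v) - sHat j (redHat ω v) =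
      mulHat (cycVar ω 0) (sHat j (topHat ℓ v) - topHat ℓ (sHat j v)) := by
    rw [redHat_eq, redHat_eq, map_sub, sHat_mulHat_of_symm j hX, sHat_mulHat_of_symm j hf, map_sub]
    abel
  rw [e] at hm
  rw [← sub_eq_zero, e, eq_zero_of_mulHat_cycVar ω hℓ hm, map_zero]

/-- The transposition turns f(x_0) into f(x_1), which gives the term with b; the divided difference
contributes `topHat ℓ v` by `topCoeff_demazure_cycVar_mul`. The precise form of b does not matter in
`redHat_comm`. -/
theorem topHat_sHat_cycVar (hℓ : 0 < ℓ) {i : Fin n} (hi0 : i.val = 0) {v : PolyPerm n}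
    (hv : v ∈ stdSub ℓ n) : ∃ b : PolyPerm n,
    topHat ℓ (sHat i (mulHat (cycVar ω 0) (topHat ℓ v))) =
      mulHat (cycVar ω i.succ) b - topHat ℓ v := by
  have hc : i.castSucc = 0 := Fin.ext hi0
  refine ⟨fun σ => topCoeff ℓ (swapVar (r := n + 1) i
    (topCoeff ℓ (v (σ * Equiv.swap (lo (r := n + 1) i) (hi (r := n + 1) i))))), ?_⟩
  funext σ
  rw [topHat_apply, sHat_apply, mulHat_apply, mulHat_apply, Pi.sub_apply, mulHat_apply,
    topHat_apply, topHat_apply]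
  rw [map_sub, topCoeff_demazure_cycVar_mul ω hℓ hi0 (mem_stdSub.1 hv σ), map_mul, ← hc,
    swapVar_cycVar_lo, topCoeff_cycVar_succ_mul]

/-- Multiplications by x_0 and x_1 commute, so the difference consists of reduction terms. After
cancellation, the only one that is not visibly a multiple of f(x_0) is s_i (f(x_0) f(x_1) b), and
here the symmetric factor f(x_0) f(x_1) can be pulled out. The difference is also reduced, so it
vanishes. -/
theorem redHat_comm (hℓ : 0 < ℓ) {i : Fin n} (hi0 : i.val = 0) {v : PolyPerm n}
    (hv : v ∈ stdSub ℓ n) :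
    redHat ω (sHat i (redHat ω (sHat i v)) + sHat i v) =
      sHat i (redHat ω (sHat i (redHat ω v))) + sHat i (redHat ω v) := by
  have hc : i.castSucc = 0 := Fin.ext hi0
  have E1 : ∀ u : PolyPerm n, sHat i (redHat ω (sHat i u)) + sHat i u =
      mulHat (X i.succ) u - sHat i (mulHat (cycVar ω 0) (topHat ℓ (sHat i u))) := by
    intro u
    have := sHat_mulHat_lo i (sHat i u)
    rw [hc, sHat_sHat] at this
    rw [redHat_eq, map_sub, this]
    abel
  obtain ⟨b, hb⟩ := topHat_sHat_cycVar ω hℓ hi0 hv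
  have E2 : topHat ℓ (sHat i (redHat ω v)) =
      mulHat (X i.succ) (topHat ℓ (sHat i v)) - mulHat (cycVar ω i.succ) b := by
    have h1 := sHat_mulHat_lo i v
    rw [hc] at h1
    have h2 : topHat ℓ (mulHat (X i.succ) (sHat i v)) =
        mulHat (X i.succ) (topHat ℓ (sHat i v)) := by
      funext σ; exact topCoeff_X_succ_mul i _
    rw [redHat_eq, map_sub, h1, map_sub, map_sub, hb, h2]
    abel
  have hf : swapVar (r := n + 1) i (cycVar ω 0 * cycVar ω i.succ) =
      cycVar ω 0 * cycVar ω i.succ := by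
    rw [map_mul, ← hc, swapVar_cycVar_lo, swapVar_cycVar_hi, mul_comm]
  have hm := Submodule.sub_mem _
    (redHat_mem_stdSub ω hℓ (Submodule.add_mem _ (sHat_mem_stdSub i (redHat_mem_stdSub ω hℓ
      (sHat_mem_stdSub i hv))) (sHat_mem_stdSub i hv)))
    (Submodule.add_mem _ (sHat_mem_stdSub i (redHat_mem_stdSub ω hℓ (sHat_mem_stdSub i
      (redHat_mem_stdSub ω hℓ hv)))) (sHat_mem_stdSub i (redHat_mem_stdSub ω hℓ hv)))
  have e : redHat ω (sHat i (redHat ω (sHat i v)) + sHat i v) -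
      (sHat i (redHat ω (sHat i (redHat ω v))) + sHat i (redHat ω v)) =
      mulHat (cycVar ω 0) (topHat ℓ (sHat i v) -
        topHat ℓ (sHat i (redHat ω (sHat i v)) + sHat i v) + mulHat (X i.succ) (topHat ℓ v) -
        mulHat (cycVar ω i.succ) (sHat i b)) := by
    have h3 := mulHat_lo_sHat i (mulHat (cycVar ω 0) (topHat ℓ (sHat i v)))
    rw [hc] at h3
    have h4 := sHat_mulHat_of_symm i hf b
    rw [E1 (redHat ω v), E2, redHat_eq ω (_ + _), E1 v]
    simp only [map_sub, map_add, mulHat_mulHat] at h3 ⊢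
    rw [h3, h4, redHat_eq ω v]
    simp only [map_sub, mulHat_mulHat]
    rw [mul_comm (X i.succ) (cycVar ω 0), mul_comm (X i.succ) (X 0)]
    abel
  rw [e] at hm
  rw [← sub_eq_zero, e, eq_zero_of_mulHat_cycVar ω hℓ hm, map_zero]

theorem aeval_redHat (P : Polynomial ℂ) (v : PolyPerm n) : ∃ u : PolyPerm n,
    Polynomial.aeval (R := ℂ) (A := Module.End ℂ (PolyPerm n)) (redHat ω) P v =
      mulHat (Polynomial.aeval (X 0) P) v + mulHat (cycVar ω 0) u := by
  induction P using Polynomial.induction_on generalizing v with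
  | C a =>
    refine ⟨0, ?_⟩
    rw [Polynomial.aeval_C, Polynomial.aeval_C, map_zero, add_zero]
    funext σ
    change a • v σ = algebraMap ℂ _ a * v σ
    rw [Algebra.smul_def]
  | add p q hp hq =>
    obtain ⟨u, hu⟩ := hp v
    obtain ⟨u', hu'⟩ := hq v
    refine ⟨u + u', ?_⟩
    rw [map_add, map_add, LinearMap.add_apply, hu, hu', map_add, mulHat_add]
    abel
  | monomial k a h =>
    obtain ⟨u, hu⟩ := h (redHat ω v)
    refine ⟨u - mulHat (Polynomial.aeval (X 0) (Polynomial.C a * Polynomial.X ^ k))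
      (topHat ℓ v), ?_⟩
    rw [pow_succ, ← mul_assoc, map_mul _ _ Polynomial.X, Polynomial.aeval_X, Module.End.mul_apply,
      hu, redHat_eq, map_mul _ _ Polynomial.X, Polynomial.aeval_X, map_sub, map_sub, mulHat_mulHat, mulHat_mulHat,
      mulHat_mulHat, mul_comm (cycVar ω 0)]
    abel

end Module

/-! ### The representation on reduced polynomials and its leading terms. -/

section Representation

open MvPolynomial

variable {ℓ : ℕ} (ω : Fin ℓ → ℂ) {n : ℕ} (hℓ : 0 < ℓ)

/-- The operators `s_i` on the module with basis `x^α w`. -/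
def sOp (ℓ : ℕ) (i : Fin n) : Module.End ℂ (stdSub ℓ n) :=
  (sHat i).restrict fun _ hv => sHat_mem_stdSub i hv

/-- The operator `x_0` on the module with basis `x^α w`. -/
def xOp : Module.End ℂ (stdSub ℓ n) :=
  (redHat ω).restrict fun _ hv => redHat_mem_stdSub ω hℓ hv

theorem isCoxeterFin_sOp : IsCoxeterFin (r := n + 1) (sOp ℓ (n := n)) where
  sq i := LinearMap.ext fun v => Subtype.ext
    (congrArg (fun f : Module.End ℂ (PolyPerm n) => f v.1) (isCoxeterFin_sHat.sq i))
  comm i j h := LinearMap.ext fun v => Subtype.ext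
    (congrArg (fun f : Module.End ℂ (PolyPerm n) => f v.1) (isCoxeterFin_sHat.comm i j h))
  braid i j h := LinearMap.ext fun v => Subtype.ext
    (congrArg (fun f : Module.End ℂ (PolyPerm n) => f v.1) (isCoxeterFin_sHat.braid i j h))

theorem aeval_xOp_coe (P : Polynomial ℂ) (v : stdSub ℓ n) :
    (Polynomial.aeval (xOp ω hℓ) P v).1 =
      Polynomial.aeval (R := ℂ) (A := Module.End ℂ (PolyPerm n)) (redHat ω) P v.1 := by
  induction P using Polynomial.induction_on generalizing v with
  | C a => rw [Polynomial.aeval_C, Polynomial.aeval_C]; rfl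
  | add p q hp hq => simp only [map_add, LinearMap.add_apply, Submodule.coe_add, hp, hq]
  | monomial k a h =>
    rw [pow_succ, ← mul_assoc, map_mul, Polynomial.aeval_X, Module.End.mul_apply, h, map_mul _ _
      Polynomial.X, Polynomial.aeval_X, Module.End.mul_apply]
    rfl

theorem xOp_commute_sOp (j : Fin n) (hj : 0 < j.val) : Commute (xOp ω hℓ) (sOp ℓ j) :=
  LinearMap.ext fun v => Subtype.ext (redHat_sHat_comm ω hℓ hj v.2)

theorem xOp_commute_next (j : Fin n) (hj : j.val = 0) :
    Commute (xOp ω hℓ) (sOp ℓ j * xOp ω hℓ * sOp ℓ j + sOp ℓ j) :=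
  LinearMap.ext fun v => Subtype.ext (redHat_comm ω hℓ hj v.2)

/-- Reduction changes multiplication by x_0 only by multiples of f(x_0). Hence the polynomial f of
the operator sends a reduced vector to a multiple of f(x_0), which is again reduced and therefore
zero. -/
theorem aeval_xOp : Polynomial.aeval (xOp (n := n) ω hℓ) (cycPoly ω) = 0 := by
  refine LinearMap.ext fun v => Subtype.ext ?_
  rw [aeval_xOp_coe]
  obtain ⟨u, hu⟩ := aeval_redHat ω (cycPoly ω) v.1
  have h1 : mulHat (cycVar ω 0) (v.1 + u) ∈ stdSub ℓ n := by
    have := (Polynomial.aeval (xOp ω hℓ) (cycPoly ω) v).2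
    rw [aeval_xOp_coe, hu] at this
    rw [map_add]
    exact this
  have h2 := eq_zero_of_mulHat_cycVar ω hℓ h1
  have h3 : mulHat (cycVar ω 0) (v.1 + u) = 0 := by rw [h2, map_zero]
  rw [hu]
  rw [map_add] at h3
  exact h3

/-- The representation on the module with basis `x^α w`. -/
def rep : Hecke ω (n + 1) →ₐ[ℂ] Module.End ℂ (stdSub ℓ n) :=
  heckeLift (S := sOp ℓ) (x0 := xOp ω hℓ) ω isCoxeterFin_sOp (xOp_commute_sOp ω hℓ)
    (xOp_commute_next ω hℓ) (aeval_xOp ω hℓ)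

theorem rep_s (i : Fin n) (v : stdSub ℓ n) : (rep ω hℓ (s ω (r := n + 1) i) v).1 = sHat i v.1 := by
  rw [rep, heckeLift_s]; rfl

theorem rep_x_zero (v : stdSub ℓ n) : (rep ω hℓ (x ω (r := n + 1) 0) v).1 = redHat ω v.1 := by
  rw [rep, heckeLift_x_zero]; rfl

theorem rep_mul (a b : Hecke ω (n + 1)) (v : stdSub ℓ n) :
    rep ω hℓ (a * b) v = rep ω hℓ a (rep ω hℓ b v) := by rw [map_mul]; rfl

theorem x_succ_eq (k : Fin n) : x ω k.succ =
    s ω (r := n + 1) k * x ω k.castSucc * s ω (r := n + 1) k + s ω (r := n + 1) k :=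
  x_hi_eq ω (r := n + 1) k

theorem rep_x_succ (k : Fin n) (v : stdSub ℓ n) :
    rep ω hℓ (x ω k.succ) v = rep ω hℓ (s ω (r := n + 1) k) (rep ω hℓ (x ω k.castSucc)
      (rep ω hℓ (s ω (r := n + 1) k) v)) + rep ω hℓ (s ω (r := n + 1) k) v := by
  rw [x_succ_eq, map_add, LinearMap.add_apply, rep_mul, rep_mul]

/-- Vectors whose coefficients have degree less than `d`. -/
def vecLT (n d : ℕ) : Submodule ℂ (PolyPerm n) := Submodule.pi Set.univ fun _ => degLT (n + 1) d

theorem mem_vecLT {d : ℕ} {v : PolyPerm n} : v ∈ vecLT n d ↔ ∀ σ, v σ ∈ degLT (n + 1) d := by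
  simp [vecLT]

theorem vecLT_mono {d e : ℕ} (h : d ≤ e) : vecLT n d ≤ vecLT n e := fun _ hv =>
  mem_vecLT.2 fun σ => degLT_mono h (mem_vecLT.1 hv σ)

theorem single_mem_vecLT {d : ℕ} {p : MvPolynomial (Fin (n + 1)) ℂ} (hp : p ∈ degLT (n + 1) d)
    (σ : Equiv.Perm (Fin (n + 1))) : (Pi.single σ p : PolyPerm n) ∈ vecLT n d := by
  rw [mem_vecLT]
  intro τ
  by_cases h : τ = σ
  · subst h; rwa [Pi.single_eq_same]
  · rw [Pi.single_eq_of_ne h]; exact Submodule.zero_mem _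

theorem sHat_mem_vecLT {d : ℕ} (i : Fin n) {v : PolyPerm n} (hv : v ∈ vecLT n d) :
    sHat i v ∈ vecLT n d := by
  rw [mem_vecLT] at hv ⊢
  exact fun σ => Submodule.sub_mem _ (swapVar_mem_degLT (hv _) _)
    (demazure_mem_degLT (degLT_mono (Nat.le_succ d) (hv _)) _)

theorem rep_x_mem_vecLT {d : ℕ} (k : Fin (n + 1)) {v : stdSub ℓ n} (hv : v.1 ∈ vecLT n d) :
    (rep ω hℓ (x ω k) v).1 ∈ vecLT n (d + 1) := by
  induction k using Fin.induction generalizing v with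
  | zero =>
    rw [rep_x_zero, mem_vecLT]
    exact fun σ => red_mem_degLT ω hℓ (mem_vecLT.1 hv σ)
  | succ k ih =>
    have h1 : (rep ω hℓ (s ω (r := n + 1) k) v).1 ∈ vecLT n d := by
      rw [rep_s]; exact sHat_mem_vecLT k hv
    rw [rep_x_succ, Submodule.coe_add, rep_s]
    exact Submodule.add_mem _ (sHat_mem_vecLT k (ih h1)) (vecLT_mono (Nat.le_succ d) h1)

theorem rep_monomial_mem_vecLT {d : ℕ} (m : Fin (n + 1) →₀ ℕ) {v : stdSub ℓ n}
    (hv : v.1 ∈ vecLT n d) : (rep ω hℓ (evX ω (monomial m 1)) v).1 ∈ vecLT n (d + m.degree) := by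
  induction hN : m.degree generalizing m with
  | zero =>
    have : m = 0 := (Finsupp.degree_eq_zero_iff m).1 hN
    subst this
    rw [monomial_zero', C_1, map_one, map_one]
    exact hv
  | succ N ih =>
    obtain ⟨k, hk⟩ : ∃ k, m k ≠ 0 := by
      by_contra! hc
      have : m = 0 := Finsupp.ext hc
      rw [this] at hN
      simp at hN
    have e : m = Finsupp.single k 1 + (m - Finsupp.single k 1) := by
      rw [add_tsub_cancel_of_le]
      rw [Finsupp.single_le_iff]; omega
    have hd : (m - Finsupp.single k 1).degree = N := by
      rw [e, map_add, Finsupp.degree_single] at hN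
      omega
    have e2 : (monomial m 1 : MvPolynomial (Fin (n + 1)) ℂ) =
        X k * monomial (m - Finsupp.single k 1) 1 := by
      conv_lhs => rw [e]
      rw [X, monomial_mul, one_mul]
    rw [e2, map_mul, rep_mul, evX_X, ← add_assoc]
    exact rep_x_mem_vecLT ω hℓ k (ih _ hd)

theorem sHat_single (i : Fin n) (σ : Equiv.Perm (Fin (n + 1))) (p : MvPolynomial (Fin (n + 1)) ℂ) :
    sHat i (Pi.single σ p) = Pi.single (σ * Equiv.swap (lo (r := n + 1) i) (hi (r := n + 1) i))
      (swapVar (r := n + 1) i p) - Pi.single σ (demazure (r := n + 1) i p) := by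
  funext τ
  rw [sHat_apply, Pi.sub_apply, Pi.single_apply, Pi.single_apply, Pi.single_apply, Pi.single_apply]
  have e : (τ * Equiv.swap (lo (r := n + 1) i) (hi (r := n + 1) i) = σ) ↔
      (τ = σ * Equiv.swap (lo (r := n + 1) i) (hi (r := n + 1) i)) := by
    constructor
    · rintro rfl; rw [mul_assoc, Equiv.swap_mul_self, mul_one]
    · rintro rfl; rw [mul_assoc, Equiv.swap_mul_self, mul_one]
  simp only [e]
  split_ifs <;> simp

theorem single_mem_stdSub {p : MvPolynomial (Fin (n + 1)) ℂ}
    (hp : p ∈ restrictDegree (Fin (n + 1)) ℂ (ℓ - 1)) (σ : Equiv.Perm (Fin (n + 1))) :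
    (Pi.single σ p : PolyPerm n) ∈ stdSub ℓ n := by
  rw [mem_stdSub]
  intro τ
  by_cases h : τ = σ
  · subst h; rwa [Pi.single_eq_same]
  · rw [Pi.single_eq_of_ne h]; exact Submodule.zero_mem _

/-- The element `p w` of the module. -/
def vec {p : MvPolynomial (Fin (n + 1)) ℂ} (hp : p ∈ restrictDegree (Fin (n + 1)) ℂ (ℓ - 1))
    (σ : Equiv.Perm (Fin (n + 1))) : stdSub ℓ n := ⟨Pi.single σ p, single_mem_stdSub hp σ⟩

theorem degreeOf_swapVar (k : Fin n) (p : MvPolynomial (Fin (n + 1)) ℂ) :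
    degreeOf k.castSucc (swapVar (r := n + 1) k p) = degreeOf k.succ p := by
  have : k.castSucc = Equiv.swap (lo (r := n + 1) k) (hi (r := n + 1) k) k.succ := by
    rw [show k.succ = hi (r := n + 1) k from rfl, Equiv.swap_apply_right]; rfl
  rw [this, swapVar, degreeOf_rename_of_injective (Equiv.injective _)]

theorem redHat_single (σ : Equiv.Perm (Fin (n + 1))) (p : MvPolynomial (Fin (n + 1)) ℂ) :
    redHat ω (Pi.single σ p) = Pi.single σ (red ω p) := by
  funext τ
  rw [redHat_apply, Pi.single_apply, Pi.single_apply]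
  split_ifs <;> simp

/-- To leading order x_k acts on p w as multiplication by x_k, provided that the exponent of x_k
stays below ℓ and no reduction takes place. In the induction x_{k+1} = s_k x_k s_k + s_k, the
condition on x_{k+1} in p becomes the condition on x_k in s_k p. -/
theorem rep_x_vec {d : ℕ} (k : Fin (n + 1)) {p : MvPolynomial (Fin (n + 1)) ℂ}
    (hp : p ∈ restrictDegree (Fin (n + 1)) ℂ (ℓ - 1)) (hk : degreeOf k p < ℓ - 1)
    (hd : p ∈ degLT (n + 1) (d + 1)) (σ : Equiv.Perm (Fin (n + 1))) :
    (rep ω hℓ (x ω k) (vec hp σ)).1 - Pi.single σ (X k * p) ∈ vecLT n (d + 1) := by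
  induction k using Fin.induction generalizing p σ with
  | zero =>
    rw [rep_x_zero, vec, redHat_single, red_apply, topCoeff_eq_zero_of_degreeOf le_rfl hk, mul_zero,
      sub_zero, sub_self]
    exact Submodule.zero_mem _
  | succ k ih =>
    have h1 := ih (swapVar_mem_restrictDegree (r := n + 1) hp k)
      (by rw [degreeOf_swapVar]; exact hk) (swapVar_mem_degLT (r := n + 1) hd k)
      (σ * Equiv.swap (lo (r := n + 1) k) (hi (r := n + 1) k))
    have h2 := rep_x_mem_vecLT ω hℓ k.castSucc
      (v := vec (demazure_mem_restrictDegree (r := n + 1) hp k) σ)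
      (single_mem_vecLT (demazure_mem_degLT (r := n + 1) hd k) σ)
    have hs : rep ω hℓ (s ω (r := n + 1) k) (vec hp σ) =
        vec (swapVar_mem_restrictDegree (r := n + 1) hp k)
          (σ * Equiv.swap (lo (r := n + 1) k) (hi (r := n + 1) k)) -
        vec (demazure_mem_restrictDegree (r := n + 1) hp k) σ :=
      Subtype.ext (by rw [rep_s]; exact sHat_single k σ p)
    have h3 := sHat_mem_vecLT k h1
    have h4 := sHat_mem_vecLT k h2
    have h5 := single_mem_vecLT (demazure_mem_degLT (r := n + 1)
      (X_mul_mem_degLT (swapVar_mem_degLT (r := n + 1) hd k) k.castSucc) k)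
      (σ * Equiv.swap (lo (r := n + 1) k) (hi (r := n + 1) k))
    have h6 : (rep ω hℓ (s ω (r := n + 1) k) (vec hp σ)).1 ∈ vecLT n (d + 1) := by
      rw [rep_s]; exact sHat_mem_vecLT k (single_mem_vecLT hd σ)
    have e : swapVar (r := n + 1) k (X k.castSucc * swapVar (r := n + 1) k p) = X k.succ * p := by
      rw [map_mul, swapVar_swapVar, swapVar_X, show k.castSucc = lo (r := n + 1) k from rfl,
        Equiv.swap_apply_left]
      rfl
    rw [map_sub, sHat_single, e, mul_assoc, Equiv.swap_mul_self, mul_one] at h3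
    rw [rep_x_succ, Submodule.coe_add, rep_s]
    have h7 := Submodule.add_mem _ (Submodule.sub_mem _ (Submodule.sub_mem _ h3 h4) h5) h6
    convert h7 using 1
    rw [hs, map_sub, Submodule.coe_sub, Submodule.coe_sub, map_sub]
    abel

theorem monomial_mem_restrictDegree {m : Fin (n + 1) →₀ ℕ} (hm : ∀ k, m k ≤ ℓ - 1) :
    (monomial m 1 : MvPolynomial (Fin (n + 1)) ℂ) ∈ restrictDegree (Fin (n + 1)) ℂ (ℓ - 1) :=
  (monomial_mem_restrictSupport ℂ).2 (Or.inl hm)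

theorem monomial_mem_degLT {m : Fin (n + 1) →₀ ℕ} :
    (monomial m 1 : MvPolynomial (Fin (n + 1)) ℂ) ∈ degLT (n + 1) (m.degree + 1) :=
  (monomial_mem_restrictSupport ℂ).2 (Or.inl (Nat.lt_succ_self _))

theorem one_mem_restrictDegree :
    (1 : MvPolynomial (Fin (n + 1)) ℂ) ∈ restrictDegree (Fin (n + 1)) ℂ (ℓ - 1) := by
  rw [mem_restrictDegree_iff_degreeOf]; intro k; rw [← C_1, degreeOf_C]; exact Nat.zero_le _

/-- The vector `1`. -/
def vecOne (ℓ n : ℕ) : stdSub ℓ n := vec one_mem_restrictDegree 1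

theorem rep_monomial_vec (m : Fin (n + 1) →₀ ℕ) (hm : ∀ k, m k ≤ ℓ - 1) :
    (rep ω hℓ (evX ω (monomial m 1)) (vecOne ℓ n)).1 -
      (Pi.single 1 (monomial m 1) : PolyPerm n) ∈ vecLT n m.degree := by
  induction hN : m.degree generalizing m with
  | zero =>
    have : m = 0 := (Finsupp.degree_eq_zero_iff m).1 hN
    subst this
    rw [monomial_zero', C_1, map_one, map_one]
    simp [vecOne, vec]
  | succ N ih =>
    obtain ⟨k, hk⟩ : ∃ k, m k ≠ 0 := by
      by_contra! hc
      have : m = 0 := Finsupp.ext hc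
      rw [this] at hN
      simp at hN
    have e : m = Finsupp.single k 1 + (m - Finsupp.single k 1) := by
      rw [add_tsub_cancel_of_le]
      rw [Finsupp.single_le_iff]; omega
    have hd : (m - Finsupp.single k 1).degree = N := by
      rw [e, map_add, Finsupp.degree_single] at hN
      omega
    have e2 : (monomial m 1 : MvPolynomial (Fin (n + 1)) ℂ) =
        X k * monomial (m - Finsupp.single k 1) 1 := by
      conv_lhs => rw [e]
      rw [X, monomial_mul, one_mul]
    have hm' : ∀ j, (m - Finsupp.single k 1 : Fin (n + 1) →₀ ℕ) j ≤ ℓ - 1 := fun j => (Nat.sub_le _ _).trans (hm j)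
    have ih' := ih _ hm' hd
    set p : MvPolynomial (Fin (n + 1)) ℂ := monomial (m - Finsupp.single k 1) 1 with hp
    have hpr : p ∈ restrictDegree (Fin (n + 1)) ℂ (ℓ - 1) := monomial_mem_restrictDegree hm'
    have hpk : degreeOf k p < ℓ - 1 := by
      have := hm k
      rw [hp, degreeOf_monomial_eq _ _ one_ne_zero, Finsupp.tsub_apply, Finsupp.single_eq_same]
      omega
    have hpd : p ∈ degLT (n + 1) (N + 1) := by rw [← hd]; exact monomial_mem_degLT
    have h1 := rep_x_vec ω hℓ k hpr hpk hpd 1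
    have h2 := rep_x_mem_vecLT ω hℓ k (v := rep ω hℓ (evX ω p) (vecOne ℓ n) - vec hpr 1) ih'
    rw [e2, map_mul, rep_mul, evX_X]
    have h3 := Submodule.add_mem _ h1 h2
    convert h3 using 1
    rw [map_sub, Submodule.coe_sub]
    abel

end Representation

/-! ### The top coefficient -/

section Top

open MvPolynomial

variable {ℓ : ℕ} (ω : Fin ℓ → ℂ) {n : ℕ} (hℓ : 0 < ℓ)

/-- The exponent with all entries `ℓ - 1`. -/
def topExp (ℓ n : ℕ) : Fin (n + 1) →₀ ℕ := Finsupp.equivFunOnFinite.symm fun _ => ℓ - 1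

theorem topExp_apply (k : Fin (n + 1)) : topExp ℓ n k = ℓ - 1 := rfl

theorem degree_topExp : (topExp ℓ n).degree = (n + 1) * (ℓ - 1) := by
  rw [Finsupp.degree_eq_sum]
  simp [topExp_apply]

/-- The coefficients of the elements `x^top w`. -/
def topFun : Hecke ω (n + 1) →ₗ[ℂ] (Equiv.Perm (Fin (n + 1)) → ℂ) where
  toFun a σ := coeff (topExp ℓ n) ((rep ω hℓ a (vecOne ℓ n)).1 σ)
  map_add' a b := by funext σ; simp
  map_smul' c a := by funext σ; simp

theorem topFun_apply (a : Hecke ω (n + 1)) (σ : Equiv.Perm (Fin (n + 1))) :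
    topFun ω hℓ a σ = coeff (topExp ℓ n) ((rep ω hℓ a (vecOne ℓ n)).1 σ) := rfl

theorem coeff_topExp_of_mem_degLT {p : MvPolynomial (Fin (n + 1)) ℂ}
    (hp : p ∈ degLT (n + 1) ((n + 1) * (ℓ - 1))) : coeff (topExp ℓ n) p = 0 := by
  by_contra h
  have := mem_degLT.1 hp _ h
  rw [degree_topExp] at this
  omega

theorem mem_degLT_of_restrictDegree {p : MvPolynomial (Fin (n + 1)) ℂ}
    (hp : p ∈ restrictDegree (Fin (n + 1)) ℂ (ℓ - 1)) :
    p ∈ degLT (n + 1) ((n + 1) * (ℓ - 1) + 1) := by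
  rw [mem_degLT]
  intro m hm
  rw [Finsupp.degree_eq_sum, Nat.lt_succ_iff]
  calc ∑ i, m i ≤ ∑ i : Fin (n + 1), (ℓ - 1) :=
        Finset.sum_le_sum fun i _ => (mem_restrictDegree _ _ _).1 hp m (mem_support_iff.2 hm) i
    _ = _ := by simp

theorem coeff_topExp_swapVar (i : Fin n) (p : MvPolynomial (Fin (n + 1)) ℂ) :
    coeff (topExp ℓ n) (swapVar (r := n + 1) i p) = coeff (topExp ℓ n) p := by
  have : topExp ℓ n = Finsupp.mapDomain
      (Equiv.swap (lo (r := n + 1) i) (hi (r := n + 1) i)) (topExp ℓ n) := by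
    ext k
    rw [← Equiv.swap_apply_self (lo (r := n + 1) i) (hi (r := n + 1) i) k,
      Finsupp.mapDomain_apply (Equiv.injective _)]
    rfl
  conv_lhs => rw [this]
  rw [swapVar, coeff_rename_mapDomain _ (Equiv.injective _)]

/-- The top monomial is symmetric, and the divided difference has too small a total degree to
contain it; only the translation of the permutations remains. -/
theorem topFun_s_mul (i : Fin n) (a : Hecke ω (n + 1)) (σ : Equiv.Perm (Fin (n + 1))) :
    topFun ω hℓ (s ω (r := n + 1) i * a) σ =
      topFun ω hℓ a (σ * Equiv.swap (lo (r := n + 1) i) (hi (r := n + 1) i)) := by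
  rw [topFun_apply, rep_mul, rep_s, sHat_apply, coeff_sub, coeff_topExp_swapVar, topFun_apply,
    coeff_topExp_of_mem_degLT (p := demazure (r := n + 1) i _), sub_zero]
  exact demazure_mem_degLT (mem_degLT_of_restrictDegree
    (mem_stdSub.1 (rep ω hℓ a (vecOne ℓ n)).2 σ)) _

theorem topFun_pm_mul (τ : Equiv.Perm (Fin (n + 1))) (a : Hecke ω (n + 1))
    (σ : Equiv.Perm (Fin (n + 1))) :
    topFun ω hℓ (pm ω τ * a) σ = topFun ω hℓ a (σ * τ⁻¹) := by
  induction τ using perm_induction generalizing σ with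
  | h1 => rw [pm_one, one_mul, inv_one, mul_one]
  | hs τ i ih =>
    rw [← s_mul_pm, mul_assoc, topFun_s_mul, ih, mul_inv_rev, Equiv.swap_inv, mul_assoc]

/-- Translation of the permutations. -/
def shiftVec (τ : Equiv.Perm (Fin (n + 1))) (v : stdSub ℓ n) : stdSub ℓ n :=
  ⟨fun σ => v.1 (τ⁻¹ * σ), mem_stdSub.2 fun _ => mem_stdSub.1 v.2 _⟩

theorem rep_s_shiftVec (τ : Equiv.Perm (Fin (n + 1))) (i : Fin n) (v : stdSub ℓ n) :
    rep ω hℓ (s ω (r := n + 1) i) (shiftVec τ v) =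
      shiftVec τ (rep ω hℓ (s ω (r := n + 1) i) v) := by
  refine Subtype.ext (funext fun σ => ?_)
  simp only [rep_s, shiftVec, sHat_apply, mul_assoc]

theorem rep_x_shiftVec (τ : Equiv.Perm (Fin (n + 1))) (k : Fin (n + 1)) (v : stdSub ℓ n) :
    rep ω hℓ (x ω k) (shiftVec τ v) = shiftVec τ (rep ω hℓ (x ω k) v) := by
  induction k using Fin.induction generalizing v with
  | zero =>
    refine Subtype.ext (funext fun σ => ?_)
    simp only [rep_x_zero, shiftVec, redHat_apply]
  | succ k ih =>
    rw [rep_x_succ, rep_s_shiftVec, ih, rep_s_shiftVec, rep_x_succ]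
    rfl

/-- The operators multiply the index σ on the right, translation multiplies it on the left. Applied
to the vector 1, translation is right multiplication by a permutation, which yields `topFun_mul_pm`.
-/
theorem rep_shiftVec (τ : Equiv.Perm (Fin (n + 1))) (a : Hecke ω (n + 1)) (v : stdSub ℓ n) :
    rep ω hℓ a (shiftVec τ v) = shiftVec τ (rep ω hℓ a v) := by
  induction a using hecke_induction generalizing v with
  | hC c => rw [AlgHom.commutes]; rfl
  | hs i => exact rep_s_shiftVec ω hℓ τ i v
  | hx i => exact rep_x_shiftVec ω hℓ τ i v
  | hadd a b ha hb => rw [map_add, LinearMap.add_apply, ha, hb, LinearMap.add_apply]; rfl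
  | hmul a b ha hb => rw [rep_mul, hb, ha, rep_mul]

theorem rep_pm_vecOne (τ : Equiv.Perm (Fin (n + 1))) :
    rep ω hℓ (pm ω τ) (vecOne ℓ n) = shiftVec τ (vecOne ℓ n) := by
  have key : (rep ω hℓ (pm ω τ) (vecOne ℓ n)).1 = Pi.single τ 1 := by
    induction τ using perm_induction with
    | h1 => rw [pm_one, map_one]; rfl
    | hs τ i ih =>
      have h1 : swapVar (r := n + 1) i 1 = 1 := map_one _
      rw [← s_mul_pm, rep_mul, rep_s, ih, sHat_single, h1, demazure_eq_zero h1]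
      simp
  refine Subtype.ext (key.trans ?_)
  funext σ
  change _ = (Pi.single 1 1 : PolyPerm n) (τ⁻¹ * σ)
  rw [Pi.single_apply, Pi.single_apply]
  have : τ⁻¹ * σ = 1 ↔ σ = τ := by rw [inv_mul_eq_one, eq_comm]
  simp only [this]

theorem topFun_mul_pm (τ : Equiv.Perm (Fin (n + 1))) (a : Hecke ω (n + 1))
    (σ : Equiv.Perm (Fin (n + 1))) :
    topFun ω hℓ (a * pm ω τ) σ = topFun ω hℓ a (τ⁻¹ * σ) := by
  rw [topFun_apply, rep_mul, rep_pm_vecOne, rep_shiftVec]; rfl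

theorem rep_evX_mem_vecLT {d : ℕ} {p : MvPolynomial (Fin (n + 1)) ℂ}
    (hp : p ∈ degLT (n + 1) d) : (rep ω hℓ (evX ω p) (vecOne ℓ n)).1 ∈ vecLT n d := by
  rw [degLT, restrictSupport_eq_span] at hp
  induction hp using Submodule.span_induction with
  | mem p h =>
    obtain ⟨m, hm, rfl⟩ := h
    refine vecLT_mono ?_ (rep_monomial_mem_vecLT ω hℓ m (d := 1) (single_mem_vecLT ?_ 1))
    · simp only [Set.mem_ofPred_eq] at hm; omega
    · rw [mem_degLT_iff]; right; rw [totalDegree_one]; exact one_pos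
  | zero => rw [map_zero, map_zero]; exact Submodule.zero_mem _
  | add a b _ _ ha hb =>
    rw [map_add, map_add]; exact Submodule.add_mem _ ha hb
  | smul c a _ ha =>
    rw [map_smul, map_smul]; exact Submodule.smul_mem _ _ ha

theorem topFun_eq_zero {a : Hecke ω (n + 1)} (ha : a ∈ heckeLT ω ((n + 1) * (ℓ - 1))) :
    topFun ω hℓ a = 0 := by
  unfold heckeLT at ha
  induction ha using Submodule.span_induction with
  | mem a h =>
    obtain ⟨p, hp, σ, rfl⟩ := h
    funext τ
    rw [topFun_mul_pm, topFun_apply]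
    exact coeff_topExp_of_mem_degLT (mem_vecLT.1 (rep_evX_mem_vecLT ω hℓ hp) _)
  | zero => rw [map_zero]
  | add a b _ _ ha hb => rw [map_add, ha, hb, add_zero]
  | smul c a _ ha => rw [map_smul, ha, smul_zero]

theorem topFun_evX {p : MvPolynomial (Fin (n + 1)) ℂ}
    (hp : p - monomial (topExp ℓ n) 1 ∈ degLT (n + 1) ((n + 1) * (ℓ - 1))) :
    topFun ω hℓ (evX ω p) = Pi.single 1 1 := by
  have h1 : topFun ω hℓ (evX ω (monomial (topExp ℓ n) 1)) = Pi.single 1 1 := by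
    funext σ
    have h := mem_vecLT.1 (rep_monomial_vec ω hℓ (topExp ℓ n) fun k => le_rfl) σ
    rw [degree_topExp] at h
    have h2 := coeff_topExp_of_mem_degLT h
    rw [Pi.sub_apply, coeff_sub, sub_eq_zero] at h2
    rw [topFun_apply, h2, Pi.single_apply, Pi.single_apply]
    split_ifs <;> simp
  have h2 := topFun_eq_zero ω hℓ (mem_heckeLT ω hp 1)
  rw [pm_one, mul_one, map_sub, map_sub, h1, sub_eq_zero] at h2
  exact h2

/-- Moving q through σ costs only terms of smaller total degree, which `topFun` does not see. -/
theorem topFun_evX_pm_evX {p q : MvPolynomial (Fin (n + 1)) ℂ} {d e : ℕ}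
    (σ : Equiv.Perm (Fin (n + 1))) (hp : p.totalDegree ≤ e) (hq : q ∈ degLT (n + 1) (d + 1))
    (hde : d + e = (n + 1) * (ℓ - 1))
    (h : p * rename σ.symm q - monomial (topExp ℓ n) 1 ∈ degLT (n + 1) ((n + 1) * (ℓ - 1))) :
    topFun ω hℓ (evX ω p * pm ω σ * evX ω q) = Pi.single σ 1 := by
  have h1 := evX_mul_mem_heckeLT ω hp (pm_mul_evX ω σ hq)
  rw [hde] at h1
  have h2 := topFun_eq_zero ω hℓ h1
  rw [mul_sub, ← mul_assoc, ← mul_assoc, ← map_mul, map_sub, sub_eq_zero] at h2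
  rw [h2]
  funext τ
  rw [topFun_mul_pm, topFun_evX ω hℓ h, Pi.single_apply, Pi.single_apply]
  have : σ⁻¹ * τ = 1 ↔ τ = σ := by rw [inv_mul_eq_one, eq_comm]
  simp only [this]

end Top

/-! ### Row vectors -/

section RowVectors

open MvPolynomial

variable {ℓ : ℕ} (ω : Fin ℓ → ℂ) {r : ℕ}

/-- The product of the factors `x_k - q_i` with `i > κ k`. -/
def piPoly (q : Fin ℓ → ℂ) (κ : Fin r → Fin ℓ) : MvPolynomial (Fin r) ℂ :=
  ∏ k, ∏ i with κ k < i, (X k - C (q i))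

theorem piPoly_dvd (q : Fin ℓ → ℂ) {κ κ' : Fin r → Fin ℓ} (h : ∀ k, κ k ≤ κ' k) :
    piPoly q κ' ∣ piPoly q κ := by
  refine Finset.prod_dvd_prod_of_dvd _ _ fun k _ => Finset.prod_dvd_prod_of_subset _ _ _ ?_
  intro i hi
  simp only [Finset.mem_filter, Finset.mem_univ, true_and] at hi ⊢
  exact (h k).trans_lt hi

theorem rename_piPoly (q : Fin ℓ → ℂ) (κ : Fin r → Fin ℓ) (σ : Equiv.Perm (Fin r)) :
    rename σ (piPoly q κ) = piPoly q fun k => κ (σ.symm k) := by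
  rw [piPoly, piPoly,
    ← Equiv.prod_comp σ (fun k => ∏ i with κ (σ.symm k) < i, (X k - C (q i)))]
  simp [map_prod]

theorem swapVar_piPoly (q : Fin ℓ → ℂ) {κ : Fin r → Fin ℓ} {i : Fin (r - 1)}
    (h : κ (lo i) = κ (hi i)) : swapVar i (piPoly q κ) = piPoly q κ := by
  rw [swapVar, rename_piPoly]
  congr 1
  funext k
  rw [Equiv.symm_swap]
  by_cases h1 : k = lo i
  · subst h1; rw [Equiv.swap_apply_left, h]
  by_cases h2 : k = hi i
  · subst h2; rw [Equiv.swap_apply_right, h]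
  rw [Equiv.swap_apply_of_ne_of_ne h1 h2]

theorem pm_comm_piPoly (q : Fin ℓ → ℂ) {κ : Fin r → Fin ℓ} (hκ : Monotone κ)
    (σ : Equiv.Perm (Fin r)) (hσ : ∀ k, κ (σ k) = κ k) :
    pm ω σ * evX ω (piPoly q κ) = evX ω (piPoly q κ) * pm ω σ :=
  pm_comm_evX ω hκ (fun _ h => swapVar_piPoly q h) σ hσ

/-- The position of `p` relative to `k`. -/
def relPos (k p : Fin r) : ℕ := if p < k then 0 else if p = k then 1 else 2

theorem relPos_mono (k : Fin r) : Monotone (relPos k) := by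
  intro a b h
  unfold relPos
  split_ifs <;> simp_all <;> omega

theorem swapVar_X_of_relPos {k : Fin r} {i : Fin (r - 1)} (h : relPos k (lo i) = relPos k (hi i)) :
    swapVar i (X k) = X k := by
  have hlt : lo i < hi i := by simp [lo, hi, Fin.lt_def]
  have h1 : k ≠ lo i := by
    rintro rfl
    simp [relPos, hlt.not_gt, hlt.ne'] at h
  have h2 : k ≠ hi i := by
    rintro rfl
    simp [relPos, hlt] at h
  rw [swapVar_X, Equiv.swap_apply_of_ne_of_ne h1 h2]

/-- The fibres of `relPos k` are the positions before k, the position k and those after k. Simple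
transpositions inside these fibres fix x_k, and `young_induction` does the rest. -/
theorem pm_comm_evX_single {k : Fin r} {p : MvPolynomial (Fin r) ℂ}
    (hp : ∀ i : Fin (r - 1), swapVar i (X k) = X k → swapVar i p = p)
    (σ : Equiv.Perm (Fin r)) (hσ : ∀ j, relPos k (σ j) = relPos k j) :
    pm ω σ * evX ω p = evX ω p * pm ω σ :=
  pm_comm_evX ω (relPos_mono k) (fun i h => hp i (swapVar_X_of_relPos h)) σ hσ

/-- The factors of `piPoly` in the variable `x_k`. -/
def piVar (q : Fin ℓ → ℂ) (k : Fin r) (j : Fin ℓ) : MvPolynomial (Fin r) ℂ :=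
  ∏ i with j < i, (X k - C (q i))

theorem piVar_dvd (q : Fin ℓ → ℂ) (κ : Fin r → Fin ℓ) (k : Fin r) :
    piVar q k (κ k) ∣ piPoly q κ :=
  Finset.dvd_prod_of_mem (fun k => ∏ i with κ k < i, (X k - C (q i))) (Finset.mem_univ k)

theorem swapVar_piVar (q : Fin ℓ → ℂ) (j : Fin ℓ) {k : Fin r} {i : Fin (r - 1)}
    (h : swapVar i (X k) = X k) : swapVar i (piVar q k j) = piVar q k j := by
  simp only [piVar, map_prod, map_sub, h]
  simp [swapVar]

variable {q : Fin ℓ → ℂ}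

theorem evX_prod_eq_zero (hq : cycPoly q = cycPoly ω) {z : Fin r} (hz : z.val = 0)
    {p : MvPolynomial (Fin r) ℂ} (hp : ∏ i, (X z - C (q i)) ∣ p) : evX ω p = 0 := by
  obtain ⟨p', rfl⟩ := hp
  have : (∏ i, (X z - C (q i)) : MvPolynomial (Fin r) ℂ) = Polynomial.aeval (X z) (cycPoly q) := by
    simp [cycPoly, algebraMap_eq]
  rw [map_mul, this, ← Polynomial.aeval_algHom_apply, evX_X, hq, aeval_x_zero ω z hz, zero_mul]

theorem relPos_of_fix {σ : Equiv.Perm (Fin r)} {z : Fin r} (hz : z.val = 0) (h : σ z = z)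
    (j : Fin r) : relPos z (σ j) = relPos z j := by
  have h1 : ∀ p : Fin r, ¬ p < z := fun p hp => by
    have := Fin.lt_def.1 hp; omega
  have h2 : σ j = z ↔ j = z := by
    constructor
    · intro e; exact σ.injective (e.trans h.symm)
    · rintro rfl; exact h
  simp [relPos, h1, h2]

/-- The first factor contains x_z - q_i for all i > θ, the second one for all i < `θ'.rev`; under
the hypothesis every index occurs. -/
theorem prod_dvd_piVar_mul {z : Fin r} {θ θ' : Fin ℓ} (h : θ < θ'.rev) :
    ∏ i, (X z - C (q i)) ∣ piVar q z θ * piVar (fun i => q i.rev) z θ' := by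
  have e : piVar (fun i => q i.rev) z θ' = ∏ i with i < θ'.rev, (X z - C (q i)) := by
    rw [piVar, Finset.prod_filter, Finset.prod_filter, ← Equiv.prod_comp Fin.revPerm]
    refine Finset.prod_congr rfl fun i _ => ?_
    simp only [Fin.revPerm_apply, Fin.rev_rev]
    have : θ' < i.rev ↔ i < θ'.rev := by rw [Fin.lt_rev_iff]
    simp only [this]
  rw [e, ← Finset.prod_filter_mul_prod_filter_not Finset.univ (θ < ·)]
  refine mul_dvd_mul dvd_rfl (Finset.prod_dvd_prod_of_subset _ _ _ ?_)
  intro i hi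
  simp only [Finset.mem_filter, Finset.mem_univ, true_and] at hi ⊢
  exact (not_lt.1 hi).trans_lt h

/-- Two products of linear factors annihilate each other along `σ`, if the factors at some
position exhaust the cyclotomic polynomial. -/
theorem evX_piPoly_pm_evX_piPoly (hq : cycPoly q = cycPoly ω) {κ κ' : Fin r → Fin ℓ}
    (hκ : Monotone κ) (hκ' : Monotone κ') (σ : Equiv.Perm (Fin r)) (k : Fin r)
    (hk : κ k < (κ' (σ k)).rev) :
    evX ω (piPoly q κ) * pm ω σ * evX ω (piPoly (fun i => q i.rev) κ') = 0 := by
  set z : Fin r := ⟨0, k.pos⟩ with hz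
  have hz0 : ∀ p : Fin r, z ≤ p := fun p => Nat.zero_le _
  -- Raising κ to at least κ k drops factors and makes κ constant from the first position z up to k,
  -- so the transposition (z k) commutes with the remaining product; likewise for κ' and σ k. After
  -- conjugation, σ may be replaced by a permutation τ that fixes z, where f(x_z) = 0 is available.
  set κ₁ : Fin r → Fin ℓ := fun p => max (κ p) (κ k)
  set κ₂ : Fin r → Fin ℓ := fun p => max (κ' p) (κ' (σ k))
  have m₁ : Monotone κ₁ := fun a b h => max_le_max (hκ h) le_rfl
  have m₂ : Monotone κ₂ := fun a b h => max_le_max (hκ' h) le_rfl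
  have k₁ : κ₁ z = κ k := max_eq_right (hκ (hz0 k))
  have k₁' : κ₁ k = κ k := max_self _
  have k₂ : κ₂ z = κ' (σ k) := max_eq_right (hκ' (hz0 _))
  have k₂' : κ₂ (σ k) = κ' (σ k) := max_self _
  obtain ⟨a, ha⟩ := piPoly_dvd q (κ := κ) (κ' := κ₁) fun p => le_max_left _ _
  obtain ⟨b, hb⟩ := piPoly_dvd (fun i => q i.rev) (κ := κ') (κ' := κ₂) fun p => le_max_left _ _
  have hswap : ∀ (f : Fin r → Fin ℓ) (y : Fin r), f z = f y → ∀ p, f (Equiv.swap z y p) = f p := by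
    intro f y h p
    by_cases h1 : p = z
    · subst h1; rw [Equiv.swap_apply_left, h]
    by_cases h2 : p = y
    · subst h2; rw [Equiv.swap_apply_right, h]
    rw [Equiv.swap_apply_of_ne_of_ne h1 h2]
  have c₁ := pm_comm_piPoly ω q m₁ (Equiv.swap z k) (hswap κ₁ k (k₁.trans k₁'.symm))
  have c₂ := pm_comm_piPoly ω (fun i => q i.rev) m₂ (Equiv.swap z (σ k))
    (hswap κ₂ (σ k) (k₂.trans k₂'.symm))
  set τ := Equiv.swap z (σ k) * σ * Equiv.swap z k with hτ
  have hτz : τ z = z := by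
    simp [hτ, Equiv.swap_apply_left, Equiv.swap_apply_right]
  have hσ : pm ω σ = pm ω (Equiv.swap z k) * pm ω τ * pm ω (Equiv.swap z (σ k)) := by
    rw [pm_mul, pm_mul, hτ]
    congr 1
    simp only [mul_assoc, Equiv.swap_mul_self, mul_one]
    rw [← mul_assoc, Equiv.swap_mul_self, one_mul]
  have core : evX ω (piPoly q κ₁) * pm ω τ * evX ω (piPoly (fun i => q i.rev) κ₂) = 0 := by
    obtain ⟨u, hu⟩ := piVar_dvd q κ₁ z
    obtain ⟨v, hv⟩ := piVar_dvd (fun i => q i.rev) κ₂ z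
    rw [k₁] at hu
    rw [k₂] at hv
    have c₃ := pm_comm_evX_single ω (fun i h => swapVar_piVar (fun i => q i.rev) (κ' (σ k)) h) τ
      (relPos_of_fix (z := z) rfl hτz)
    rw [hu, hv, mul_comm _ u, map_mul, map_mul]
    calc _ = evX ω u * evX ω (piVar q z (κ k)) * (pm ω τ *
          evX ω (piVar (fun i => q i.rev) z (κ' (σ k)))) * evX ω v := by simp only [mul_assoc]
      _ = evX ω u * (evX ω (piVar q z (κ k)) *
          evX ω (piVar (fun i => q i.rev) z (κ' (σ k)))) * pm ω τ * evX ω v := by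
        rw [c₃]; simp only [mul_assoc]
      _ = 0 := by
        rw [← map_mul, evX_prod_eq_zero ω hq (z := z) rfl (prod_dvd_piVar_mul hk), mul_zero,
          zero_mul, zero_mul]
  rw [ha, hb, hσ, map_mul, map_mul, ← map_mul, mul_comm _ a, map_mul]
  calc _ = evX ω a * (evX ω (piPoly q κ₁) * pm ω (Equiv.swap z k)) * pm ω τ *
        (pm ω (Equiv.swap z (σ k)) * evX ω (piPoly (fun i => q i.rev) κ₂)) * evX ω b := by
        simp only [mul_assoc]
    _ = evX ω a * pm ω (Equiv.swap z k) * (evX ω (piPoly q κ₁) * pm ω τ *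
        evX ω (piPoly (fun i => q i.rev) κ₂)) * pm ω (Equiv.swap z (σ k)) * evX ω b := by
        rw [← c₁, c₂]; simp only [mul_assoc]
    _ = 0 := by rw [core, mul_zero, zero_mul, zero_mul]

/-- The component of a row. -/
def rowComp (θ : Fin ℓ ×ₗ ℕ) : Fin ℓ := (ofLex θ).1

/-- Elements that have the factor `piPoly` on the right and are multiplied by a sign by
transpositions within the rows described by `ρ`. -/
structure IsRowVec (q ε : Fin ℓ → ℂ) (ρ : Fin r → Fin ℓ ×ₗ ℕ) (v : Hecke ω r) : Prop where
  mono : Monotone fun k => rowComp (ρ k)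
  dvd : ∃ v', v = v' * evX ω (piPoly q fun k => rowComp (ρ k))
  swap : ∀ a b, a ≠ b → ρ a = ρ b → v * pm ω (Equiv.swap a b) = ε (rowComp (ρ a)) • v

variable {ω} {ε : Fin ℓ → ℂ} {ρ : Fin r → Fin ℓ ×ₗ ℕ} {v : Hecke ω r}

theorem IsRowVec.mul_pm (h : IsRowVec ω q ε ρ v) (σ : Equiv.Perm (Fin r))
    (hσ : ∀ k, rowComp (ρ (σ k)) = rowComp (ρ k)) :
    IsRowVec ω q ε (fun k => ρ (σ.symm k)) (v * pm ω σ) := by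
  have e : (fun k => rowComp (ρ (σ.symm k))) = fun k => rowComp (ρ k) := by
    funext k
    rw [← hσ, Equiv.apply_symm_apply]
  refine ⟨by rw [e]; exact h.mono, ?_, ?_⟩
  · obtain ⟨v', hv'⟩ := h.dvd
    refine ⟨v' * pm ω σ, ?_⟩
    rw [e, hv', mul_assoc, mul_assoc, pm_comm_piPoly ω q h.mono σ hσ]
  · intro a b hab hρ
    have e1 : Equiv.swap a b * σ = σ * Equiv.swap (σ.symm a) (σ.symm b) := by
      rw [Equiv.mul_swap_eq_swap_mul, Equiv.apply_symm_apply, Equiv.apply_symm_apply]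
    rw [mul_assoc, pm_mul, e1, ← pm_mul, ← mul_assoc, h.swap _ _ (by simpa using hab) hρ,
      smul_mul_assoc]

theorem pm_swap_comm_x {k a b : Fin r} (ha : a ≠ k) (hb : b ≠ k) (hab : a < k ↔ b < k) :
    pm ω (Equiv.swap a b) * x ω k = x ω k * pm ω (Equiv.swap a b) := by
  rw [← evX_X]
  refine pm_comm_evX_single ω (fun i h => h) _ fun j => ?_
  have e : relPos k a = relPos k b := by simp [relPos, ha, hb, hab]
  by_cases h1 : j = a
  · subst h1; rw [Equiv.swap_apply_left, e]
  by_cases h2 : j = b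
  · subst h2; rw [Equiv.swap_apply_right, e]
  rw [Equiv.swap_apply_of_ne_of_ne h1 h2]

theorem piPoly_update (q : Fin ℓ → ℂ) {κ κ' : Fin r → Fin ℓ} {k : Fin r} {j : Fin ℓ}
    (hj : (κ' k).val + 1 = j.val) (hk : κ k = j) (h : ∀ p, p ≠ k → κ' p = κ p) :
    piPoly q κ' = piPoly q κ * (X k - C (q j)) := by
  unfold piPoly
  rw [← Finset.mul_prod_erase _ _ (Finset.mem_univ k),
    ← Finset.mul_prod_erase _ (fun k => ∏ i with κ k < i, (X k - C (q i))) (Finset.mem_univ k)]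
  have e1 : ∏ p ∈ Finset.univ.erase k, ∏ i with κ' p < i, (X p - C (q i)) =
      ∏ p ∈ Finset.univ.erase k, ∏ i with κ p < i, (X p - C (q i)) :=
    Finset.prod_congr rfl fun p hp => by rw [h p (Finset.ne_of_mem_erase hp)]
  have e2 : (Finset.univ.filter (κ' k < ·)) = insert j (Finset.univ.filter (κ k < ·)) := by
    ext i
    simp only [Finset.mem_filter, Finset.mem_univ, true_and, Finset.mem_insert, hk, Fin.lt_def,
      Fin.ext_iff]
    omega
  rw [e1, e2, Finset.prod_insert (by simp [hk])]
  ring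

/-- `ρ'` arises from a rearrangement of `ρ` by moving rows to smaller ones. -/
def IsDescent (ρ ρ' : Fin r → Fin ℓ ×ₗ ℕ) : Prop :=
  ∃ τ : Equiv.Perm (Fin r), (∀ p, ρ' p ≤ ρ (τ p)) ∧ ∃ p, ρ' p < ρ (τ p)

/-- The factor x_k - q_j, with j the component of k, is the one by which the product of linear
factors grows when k moves from component j to j - 1; monotonicity survives because k is the first
position of its component. If j is the first component, then k is the first position and f(x_k) = 0.
-/
theorem IsRowVec.mul_x_first (hq : cycPoly q = cycPoly ω) (h : IsRowVec ω q ε ρ v) (k : Fin r)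
    (hk : ∀ p < k, rowComp (ρ p) < rowComp (ρ k)) :
    v * x ω k = q (rowComp (ρ k)) • v ∨ ∃ ρ' v', IsDescent ρ ρ' ∧ IsRowVec ω q ε ρ' v' ∧
      v * x ω k = q (rowComp (ρ k)) • v + v' := by
  set j := rowComp (ρ k) with hj
  obtain ⟨v', hv'⟩ := h.dvd
  have hsub : v * (x ω k - algebraMap ℂ _ (q j)) =
      v' * evX ω (piPoly q (fun k => rowComp (ρ k)) * (X k - C (q j))) := by
    rw [map_mul, map_sub, evX_X, evX_C, ← mul_assoc, ← hv']
  have hx : v * x ω k = q j • v + v * (x ω k - algebraMap ℂ _ (q j)) := by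
    rw [mul_sub, ← Algebra.commutes, ← Algebra.smul_def]; abel
  by_cases hj0 : j.val = 0
  · left
    have hk0 : k.val = 0 := by
      by_contra hc
      have := hk ⟨0, k.pos⟩ (by rw [Fin.lt_def]; exact Nat.pos_of_ne_zero hc)
      rw [Fin.lt_def] at this
      omega
    rw [hx, hsub, evX_prod_eq_zero ω hq hk0, mul_zero, add_zero]
    obtain ⟨u, hu⟩ := piVar_dvd q (fun k => rowComp (ρ k)) k
    rw [hu]
    refine Dvd.intro u ?_
    have e2 : (Finset.univ : Finset (Fin ℓ)) = insert j (Finset.univ.filter (j < ·)) := by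
      ext i
      simp only [Finset.mem_insert, Finset.mem_filter, Finset.mem_univ, true_and, Fin.lt_def,
        Fin.ext_iff, true_iff]
      omega
    have e3 : (∏ i, (X k - C (q i)) : MvPolynomial (Fin r) ℂ) =
        (X k - C (q j)) * ∏ i with j < i, (X k - C (q i)) := by
      conv_lhs => rw [e2]
      rw [Finset.prod_insert (by simp)]
    rw [piVar, ← hj, e3]
    ring
  · right
    -- N exceeds all row indices in use, so k forms a row of its own in the preceding component and
    -- no new sign condition arises. The new row is still smaller than the old one, since components
    -- are compared first.
    obtain ⟨N, hN⟩ : ∃ N, ∀ p, (ofLex (ρ p)).2 < N :=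
      ⟨(Finset.univ.sup fun p => (ofLex (ρ p)).2) + 1, fun p =>
        Nat.lt_succ_of_le (Finset.le_sup (f := fun p => (ofLex (ρ p)).2) (Finset.mem_univ p))⟩
    set j' : Fin ℓ := ⟨j.val - 1, by omega⟩ with hj'
    have hjj : j' < j := by rw [Fin.lt_def]; simp only [hj']; omega
    set ρ' : Fin r → Fin ℓ ×ₗ ℕ := Function.update ρ k (toLex (j', N)) with hρ'
    have r1 : ρ' k = toLex (j', N) := Function.update_self _ _ _
    have r2 : ∀ p, p ≠ k → ρ' p = ρ p := fun p hp => Function.update_of_ne hp _ _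
    have c1 : rowComp (ρ' k) = j' := by rw [r1]; rfl
    have hlt : ρ' k < ρ k := by
      rw [r1, Prod.Lex.lt_iff]
      exact Or.inl hjj
    have hpoly := piPoly_update q (κ := fun k => rowComp (ρ k)) (κ' := fun k => rowComp (ρ' k))
      (k := k) (j := j) (by simp only [c1, hj']; omega) rfl (fun p hp => by rw [r2 p hp])
    refine ⟨ρ', v * (x ω k - algebraMap ℂ _ (q j)), ⟨1, fun p => ?_, k, hlt⟩, ⟨?_, ?_, ?_⟩, hx⟩
    · rw [Equiv.Perm.one_apply]
      by_cases hp : p = k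
      · rw [hp]; exact hlt.le
      · rw [r2 p hp]
    · intro a b hab
      simp only
      by_cases ha : a = k
      · by_cases hb : b = k
        · rw [ha, hb]
        · rw [ha, c1, r2 b hb]
          exact hjj.le.trans (h.mono (ha ▸ hab))
      · by_cases hb : b = k
        · rw [hb, c1, r2 a ha]
          have := hk a (lt_of_le_of_ne (hb ▸ hab) ha)
          rw [Fin.lt_def] at this
          rw [Fin.le_def]
          simp only [hj']
          omega
        · rw [r2 a ha, r2 b hb]; exact h.mono hab
    · exact ⟨v', by rw [hsub, hpoly]⟩
    · intro a b hab hρab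
      have ha : a ≠ k := by
        rintro rfl
        have := congrArg (fun θ => (ofLex θ).2) hρab
        rw [r1, r2 b hab.symm] at this
        exact absurd this.symm (hN b).ne
      have hb : b ≠ k := by
        rintro rfl
        have := congrArg (fun θ => (ofLex θ).2) hρab
        rw [r1, r2 a hab] at this
        exact absurd this (hN a).ne
      rw [r2 a ha, r2 b hb] at hρab
      have hside : ∀ a b : Fin r, b ≠ k → ρ a = ρ b → a < k → b < k := by
        intro a b hb e hlt
        refine lt_of_le_of_ne (not_lt.1 fun hc => ?_) hb
        have h1 := hk a hlt
        rw [e] at h1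
        exact absurd h1 (h.mono hc.le).not_gt
      have hc := pm_swap_comm_x (ω := ω) ha hb ⟨hside a b hb hρab, hside b a ha hρab.symm⟩
      rw [r2 a ha, mul_assoc, sub_mul, Algebra.commutes, ← hc, ← mul_sub, ← mul_assoc,
        h.swap a b hab hρab, smul_mul_assoc]

/-- The span of the elements `v w`. -/
def permSpan (v : Hecke ω r) : Submodule ℂ (Hecke ω r) :=
  Submodule.span ℂ (Set.range fun σ : Equiv.Perm (Fin r) => v * pm ω σ)

/-- The span of the elements `v' w`, for row vectors `v'` whose rows satisfy `P`. -/
def rowSpan (ω : Fin ℓ → ℂ) (q ε : Fin ℓ → ℂ) (P : (Fin r → Fin ℓ ×ₗ ℕ) → Prop) :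
    Submodule ℂ (Hecke ω r) :=
  Submodule.span ℂ {a | ∃ ρ v σ, P ρ ∧ IsRowVec ω q ε ρ v ∧ a = v * pm ω σ}

theorem mul_mem_of_span {S : Set (Hecke ω r)} {N : Submodule ℂ (Hecke ω r)} {b : Hecke ω r}
    (h : ∀ a ∈ S, a * b ∈ N) {a : Hecke ω r} (ha : a ∈ Submodule.span ℂ S) : a * b ∈ N := by
  induction ha using Submodule.span_induction with
  | mem a ha => exact h a ha
  | zero => rw [zero_mul]; exact Submodule.zero_mem _
  | add a b _ _ ha hb => rw [add_mul]; exact Submodule.add_mem _ ha hb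
  | smul c a _ ha => rw [smul_mul_assoc]; exact Submodule.smul_mem _ _ ha

theorem permSpan_mul_pm {a : Hecke ω r} (ha : a ∈ permSpan v) (σ : Equiv.Perm (Fin r)) :
    a * pm ω σ ∈ permSpan v := by
  refine mul_mem_of_span ?_ ha
  rintro _ ⟨τ, rfl⟩
  exact Submodule.subset_span ⟨σ * τ, by simp only; rw [mul_assoc, pm_mul]⟩

theorem rowSpan_mul_pm {P : (Fin r → Fin ℓ ×ₗ ℕ) → Prop} {a : Hecke ω r}
    (ha : a ∈ rowSpan ω q ε P) (σ : Equiv.Perm (Fin r)) : a * pm ω σ ∈ rowSpan ω q ε P := by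
  refine mul_mem_of_span ?_ ha
  rintro _ ⟨ρ, v, τ, hP, hv, rfl⟩
  exact Submodule.subset_span ⟨ρ, v, σ * τ, hP, hv, by rw [mul_assoc, pm_mul]⟩

theorem mem_permSpan (v : Hecke ω r) : v ∈ permSpan v :=
  Submodule.subset_span ⟨1, by simp only [pm_one, mul_one]⟩

theorem rowSpan_mono {P P' : (Fin r → Fin ℓ ×ₗ ℕ) → Prop} (h : ∀ ρ, P ρ → P' ρ) :
    rowSpan ω q ε P ≤ rowSpan ω q ε P' :=
  Submodule.span_mono fun _ ⟨ρ, v, σ, hP, hv, e⟩ => ⟨ρ, v, σ, h ρ hP, hv, e⟩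

theorem IsDescent.of_swap {ρ ρ' : Fin r → Fin ℓ ×ₗ ℕ} {σ : Equiv.Perm (Fin r)}
    (h : IsDescent (fun k => ρ (σ k)) ρ') : IsDescent ρ ρ' := by
  obtain ⟨τ, h1, h2⟩ := h
  exact ⟨σ * τ, h1, h2⟩

/-- Multiplication of a row vector by `x_k`. -/
theorem IsRowVec.mul_x (hq : cycPoly q = cycPoly ω) (h : IsRowVec ω q ε ρ v) (k : Fin r) :
    v * x ω k ∈ permSpan v ⊔ rowSpan ω q ε (IsDescent ρ) := by
  induction hk : k.val generalizing k ρ v with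
  | zero =>
    rcases h.mul_x_first hq k (fun p hp => by
      have := Fin.lt_def.1 hp; omega) with e | ⟨ρ', v', hd, hv', e⟩
    · rw [e]
      exact Submodule.mem_sup_left (Submodule.smul_mem _ _ (mem_permSpan v))
    · rw [e]
      refine Submodule.add_mem _ (Submodule.mem_sup_left (Submodule.smul_mem _ _ (mem_permSpan v)))
        (Submodule.mem_sup_right (Submodule.subset_span ⟨ρ', v', 1, hd, hv', ?_⟩))
      rw [pm_one, mul_one]
  | succ m ih =>
    by_cases hfirst : ∀ p < k, rowComp (ρ p) < rowComp (ρ k)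
    · rcases h.mul_x_first hq k hfirst with e | ⟨ρ', v', hd, hv', e⟩
      · rw [e]
        exact Submodule.mem_sup_left (Submodule.smul_mem _ _ (mem_permSpan v))
      · rw [e]
        refine Submodule.add_mem _ (Submodule.mem_sup_left (Submodule.smul_mem _ _
          (mem_permSpan v))) (Submodule.mem_sup_right
          (Submodule.subset_span ⟨ρ', v', 1, hd, hv', ?_⟩))
        rw [pm_one, mul_one]
    · push Not at hfirst
      obtain ⟨p, hp, hpk⟩ := hfirst
      -- Here k - 1 lies in the same component as k. So v s_i is a row vector with permuted rows,
      -- and x_k = s_i x_{k-1} s_i + s_i reduces the claim to the product of v s_i with x_{k-1}.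
      set i : Fin (r - 1) := ⟨m, by omega⟩ with hi'
      have e1 : hi i = k := Fin.ext (by simp [hi, hi', hk])
      have e2 : rowComp (ρ (lo i)) = rowComp (ρ (hi i)) := by
        refine le_antisymm (h.mono (by simp [lo, hi, Fin.le_def])) ?_
        rw [e1]
        refine hpk.trans (h.mono ?_)
        have := Fin.lt_def.1 hp
        simp only [Fin.le_def, lo, hi']
        omega
      have hσ : ∀ j, rowComp (ρ (Equiv.swap (lo i) (hi i) j)) = rowComp (ρ j) := by
        intro j
        by_cases h1 : j = lo i
        · subst h1; rw [Equiv.swap_apply_left, e2]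
        by_cases h2 : j = hi i
        · subst h2; rw [Equiv.swap_apply_right, e2]
        rw [Equiv.swap_apply_of_ne_of_ne h1 h2]
      have hv := h.mul_pm _ hσ
      have h3 := ih hv (lo i) rfl
      rw [pm_swap] at h3
      rw [← e1, x_hi_eq, mul_add, ← mul_assoc, ← mul_assoc]
      refine Submodule.add_mem _ ?_ (Submodule.mem_sup_left
        (Submodule.subset_span ⟨Equiv.swap (lo i) (hi i), by simp only [pm_swap]⟩))
      obtain ⟨a, ha, b, hb, hab⟩ := Submodule.mem_sup.1 h3
      rw [← hab, add_mul, ← pm_swap]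
      refine Submodule.add_mem _ (Submodule.mem_sup_left (permSpan_mul_pm ?_ _))
        (Submodule.mem_sup_right (rowSpan_mul_pm (rowSpan_mono ?_ hb) _))
      · have hle : permSpan (v * s ω i) ≤ permSpan v := by
          rw [permSpan, Submodule.span_le]
          rintro _ ⟨σ, rfl⟩
          simp only
          rw [← pm_swap, mul_assoc, pm_mul]
          exact Submodule.subset_span ⟨_, rfl⟩
        exact hle ha
      · intro ρ' hρ'
        exact IsDescent.of_swap hρ'

theorem heckeLT_one_le {N : Submodule ℂ (Hecke ω r)} (w : Hecke ω r)
    (h : ∀ σ, w * pm ω σ ∈ N) {a : Hecke ω r} (ha : a ∈ heckeLT ω 1) : w * a ∈ N := by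
  unfold heckeLT at ha
  induction ha using Submodule.span_induction with
  | mem a ha =>
    obtain ⟨p, hp, σ, rfl⟩ := ha
    obtain ⟨c, rfl⟩ : ∃ c, p = C c := by
      rcases mem_degLT_iff.1 hp with rfl | h0
      · exact ⟨0, C_0.symm⟩
      · exact ⟨_, totalDegree_eq_zero_iff_eq_C.1 (by omega)⟩
    rw [evX_C, ← Algebra.smul_def, mul_smul_comm]
    exact Submodule.smul_mem _ _ (h σ)
  | zero => rw [mul_zero]; exact Submodule.zero_mem _
  | add a b _ _ ha hb => rw [mul_add]; exact Submodule.add_mem _ ha hb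
  | smul c a _ ha => rw [mul_smul_comm]; exact Submodule.smul_mem _ _ ha

theorem pm_mul_x_sub (σ : Equiv.Perm (Fin r)) (k : Fin r) :
    pm ω σ * x ω k - x ω (σ.symm k) * pm ω σ ∈ heckeLT ω 1 := by
  have := pm_mul_evX ω σ (d := 1) (p := X k) (mem_degLT_iff.2 (Or.inr (by simp)))
  rwa [rename_X, evX_X, evX_X] at this

theorem IsRowVec.mul_pm_mul_x (hq : cycPoly q = cycPoly ω) (h : IsRowVec ω q ε ρ v)
    (σ : Equiv.Perm (Fin r)) (k : Fin r) :
    v * pm ω σ * x ω k ∈ permSpan v ⊔ rowSpan ω q ε (IsDescent ρ) := by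
  have h1 : v * (pm ω σ * x ω k - x ω (σ.symm k) * pm ω σ) ∈ permSpan v :=
    heckeLT_one_le (N := permSpan v) v (fun τ => Submodule.subset_span ⟨τ, rfl⟩) (pm_mul_x_sub σ k)
  have h2 := h.mul_x hq (σ.symm k)
  obtain ⟨a, ha, b, hb, hab⟩ := Submodule.mem_sup.1 h2
  have e : v * pm ω σ * x ω k = v * (pm ω σ * x ω k - x ω (σ.symm k) * pm ω σ) +
      v * x ω (σ.symm k) * pm ω σ := by
    rw [mul_sub, mul_assoc, mul_assoc]; abel
  rw [e, ← hab, add_mul]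
  exact Submodule.add_mem _ (Submodule.mem_sup_left h1) (Submodule.add_mem _
    (Submodule.mem_sup_left (permSpan_mul_pm ha σ)) (Submodule.mem_sup_right (rowSpan_mul_pm hb σ)))

theorem mul_mem_of_generators {N : Submodule ℂ (Hecke ω r)}
    (hs : ∀ a ∈ N, ∀ i, a * s ω i ∈ N) (hx : ∀ a ∈ N, ∀ k, a * x ω k ∈ N) {a : Hecke ω r}
    (ha : a ∈ N) (b : Hecke ω r) : a * b ∈ N := by
  induction b using hecke_induction generalizing a with
  | hC c => rw [← Algebra.commutes, ← Algebra.smul_def]; exact Submodule.smul_mem _ _ ha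
  | hs i => exact hs a ha i
  | hx k => exact hx a ha k
  | hadd b c hb hc => rw [mul_add]; exact Submodule.add_mem _ (hb ha) (hc ha)
  | hmul b c hb hc => rw [← mul_assoc]; exact hc (hb ha)

/-- The span of the row vectors whose rows satisfy `P` is a right ideal, if `P` is preserved by
descents. -/
theorem rowSpan_mul (hq : cycPoly q = cycPoly ω) {P : (Fin r → Fin ℓ ×ₗ ℕ) → Prop}
    (hP : ∀ ρ ρ', P ρ → IsDescent ρ ρ' → P ρ') {a : Hecke ω r} (ha : a ∈ rowSpan ω q ε P)
    (b : Hecke ω r) : a * b ∈ rowSpan ω q ε P := by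
  refine mul_mem_of_generators (fun a ha i => ?_) (fun a ha k => mul_mem_of_span ?_ ha) ha b
  · rw [← pm_swap]; exact rowSpan_mul_pm ha _
  · rintro _ ⟨ρ, v, σ, hρ, hv, rfl⟩
    obtain ⟨a, ha, b, hb, hab⟩ := Submodule.mem_sup.1 (hv.mul_pm_mul_x hq σ k)
    rw [← hab]
    refine Submodule.add_mem _ ?_ (rowSpan_mono (fun ρ' => hP ρ ρ' hρ) hb)
    have : permSpan v ≤ rowSpan ω q ε P := by
      rw [permSpan, Submodule.span_le]
      rintro _ ⟨σ, rfl⟩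
      exact Submodule.subset_span ⟨ρ, v, σ, hρ, hv, rfl⟩
    exact this ha

theorem IsRowVec.mul_mem (hq : cycPoly q = cycPoly ω) (h : IsRowVec ω q ε ρ v)
    {P : (Fin r → Fin ℓ ×ₗ ℕ) → Prop} (hP : ∀ ρ ρ', P ρ → IsDescent ρ ρ' → P ρ')
    (hρ : ∀ ρ', IsDescent ρ ρ' → P ρ') (b : Hecke ω r) :
    v * b ∈ permSpan v ⊔ rowSpan ω q ε P := by
  refine mul_mem_of_generators (fun a ha i => ?_) (fun a ha k => ?_)
    (Submodule.mem_sup_left (mem_permSpan v)) b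
  · obtain ⟨a₁, h₁, a₂, h₂, rfl⟩ := Submodule.mem_sup.1 ha
    rw [← pm_swap, add_mul]
    exact Submodule.add_mem _ (Submodule.mem_sup_left (permSpan_mul_pm h₁ _))
      (Submodule.mem_sup_right (rowSpan_mul_pm h₂ _))
  · obtain ⟨a₁, h₁, a₂, h₂, rfl⟩ := Submodule.mem_sup.1 ha
    rw [add_mul]
    refine Submodule.add_mem _ (mul_mem_of_span ?_ h₁)
      (Submodule.mem_sup_right (rowSpan_mul hq hP h₂ _))
    rintro _ ⟨σ, rfl⟩
    exact sup_le_sup_left (rowSpan_mono hρ) _ (h.mul_pm_mul_x hq σ k)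

/-! ### Products of row vectors and column vectors -/

variable {ε' : Fin ℓ → ℂ} {ρ' : Fin r → Fin ℓ ×ₗ ℕ} {u : Hecke ω r}

theorem IsRowVec.mul_pm_mul_st_eq_zero_of_lt (hq : cycPoly q = cycPoly ω)
    (h : IsRowVec ω q ε ρ v) (h' : IsRowVec ω (fun i => q i.rev) ε' ρ' u) (σ : Equiv.Perm (Fin r))
    (k : Fin r) (hk : rowComp (ρ k) < (rowComp (ρ' (σ k))).rev) : v * pm ω σ * st ω u = 0 := by
  obtain ⟨a, rfl⟩ := h.dvd
  obtain ⟨b, rfl⟩ := h'.dvd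
  have := evX_piPoly_pm_evX_piPoly ω hq h.mono h'.mono σ k hk
  rw [st_mul, st_evX]
  calc _ = a * (evX ω (piPoly q fun k => rowComp (ρ k)) * pm ω σ *
      evX ω (piPoly (fun i => q i.rev) fun k => rowComp (ρ' k))) * st ω b := by
        simp only [mul_assoc]
    _ = 0 := by rw [this, mul_zero, zero_mul]

/-- The transposition of a and b can be absorbed into v, or be moved through σ and absorbed into u.
The two scalars are opposite and nonzero. -/
theorem IsRowVec.mul_pm_mul_st_eq_zero_of_eq (h : IsRowVec ω q ε ρ v)
    {q' : Fin ℓ → ℂ} (h' : IsRowVec ω q' ε' ρ' u) (σ : Equiv.Perm (Fin r))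
    {a b : Fin r} (hab : a ≠ b) (hρ : ρ a = ρ b) (hρ' : ρ' (σ a) = ρ' (σ b))
    (hε : ε' (rowComp (ρ' (σ a))) = -ε (rowComp (ρ a))) (hε0 : ε (rowComp (ρ a)) ≠ 0) :
    v * pm ω σ * st ω u = 0 := by
  have h1 := h.swap a b hab hρ
  have h2 := congrArg (st ω) (h'.swap (σ a) (σ b) (by simpa using hab) hρ')
  rw [st_mul, st_pm, st_smul, Equiv.swap_inv] at h2
  have e : pm ω (Equiv.swap a b) * pm ω σ = pm ω σ * pm ω (Equiv.swap (σ a) (σ b)) := by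
    rw [pm_mul, pm_mul, Equiv.mul_swap_eq_swap_mul]
  have key : ε (rowComp (ρ a)) • (v * pm ω σ * st ω u) =
      ε' (rowComp (ρ' (σ a))) • (v * pm ω σ * st ω u) := by
    rw [← smul_mul_assoc, ← smul_mul_assoc, ← h1, mul_assoc v, e, ← mul_assoc v, mul_assoc, h2,
      mul_smul_comm]
  rw [hε, neg_smul, ← add_eq_zero_iff_eq_neg, ← add_smul] at key
  exact (smul_eq_zero.1 key).resolve_left (by simpa [← two_mul] using hε0)

end RowVectors

/-! ### Boxes, rows and columns -/

theorem card_le_of_card_fiber_le {α β γ : Type*} [DecidableEq γ] {S : Finset α} {S' : Finset β}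
    (f : α → γ) (g : β → γ)
    (h : ∀ c, (S.filter (f · = c)).card ≤ (S'.filter (g · = c)).card) : S.card ≤ S'.card := by
  rw [Finset.card_eq_sum_card_fiberwise (f := f) (t := S.image f ∪ S'.image g)
      fun a ha => by
        simp only [Finset.coe_union, Finset.coe_image]; exact Or.inl ⟨a, ha, rfl⟩,
    Finset.card_eq_sum_card_fiberwise (s := S') (f := g) (t := S.image f ∪ S'.image g)
      fun a ha => by
        simp only [Finset.coe_union, Finset.coe_image]; exact Or.inr ⟨a, ha, rfl⟩]
  exact Finset.sum_le_sum fun c _ => h c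

theorem card_fiber_eq_of_card_eq {α β γ : Type*} [DecidableEq γ] {S : Finset α} {S' : Finset β}
    (f : α → γ) (g : β → γ)
    (h : ∀ c, (S.filter (f · = c)).card ≤ (S'.filter (g · = c)).card) (hc : S'.card ≤ S.card)
    (c : γ) : (S.filter (f · = c)).card = (S'.filter (g · = c)).card := by
  refine le_antisymm (h c) (not_lt.1 fun hlt => ?_)
  have h1 := Finset.card_filter_add_card_filter_not (s := S) (f · = c)
  have h2 := Finset.card_filter_add_card_filter_not (s := S') (g · = c)
  have h3 : (S.filter (¬ f · = c)).card ≤ (S'.filter (¬ g · = c)).card := by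
    refine card_le_of_card_fiber_le f g fun d => ?_
    rw [Finset.filter_filter, Finset.filter_filter]
    by_cases hd : d = c
    · subst hd; simp
    · have e1 : S.filter (fun a => ¬ f a = c ∧ f a = d) = S.filter (f · = d) :=
        Finset.filter_congr fun a _ => ⟨And.right, fun e => ⟨e ▸ hd, e⟩⟩
      have e2 : S'.filter (fun a => ¬ g a = c ∧ g a = d) = S'.filter (g · = d) :=
        Finset.filter_congr fun a _ => ⟨And.right, fun e => ⟨e ▸ hd, e⟩⟩
      rw [e1, e2]
      exact h d
  omega

namespace MultiPartition

variable {ℓ r : ℕ} {l : MultiPartition ℓ r}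

theorem Box.ext {b b' : l.Box} (h₁ : b.comp = b'.comp) (h₂ : b.row = b'.row)
    (h₃ : b.col = b'.col) : b = b' :=
  Subtype.ext (Prod.ext h₁ (Prod.ext h₂ h₃))

theorem Box.mem (b : l.Box) : (b.row, b.col) ∈ l.comp b.comp := b.2

def mkBox (l : MultiPartition ℓ r) (i : Fin ℓ) (k j : ℕ) (h : (k, j) ∈ l.comp i) : l.Box :=
  ⟨toLex (i, toLex (k, j)), h⟩

/-- The row of a box, together with its component. -/
def Box.rowIdx (b : l.Box) : Fin ℓ ×ₗ ℕ := toLex (b.comp, b.row)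

theorem Box.rowIdx_eq_iff {b b' : l.Box} :
    b.rowIdx = b'.rowIdx ↔ b.comp = b'.comp ∧ b.row = b'.row := by
  simp [rowIdx]

theorem Box.rowIdx_mono : Monotone (Box.rowIdx (l := l)) := by
  intro b b' h
  have h' : b.1 ≤ b'.1 := h
  rw [Prod.Lex.le_iff] at h'
  unfold rowIdx
  rw [Prod.Lex.le_iff]
  rcases h' with h' | ⟨h1, h2⟩
  · exact Or.inl h'
  · refine Or.inr ⟨h1, ?_⟩
    rw [Prod.Lex.le_iff] at h2
    rcases h2 with h2 | ⟨h2, -⟩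
    · exact h2.le
    · exact h2.le

/-- The row of `t^λ` that contains `p`. -/
def rowFn (l : MultiPartition ℓ r) (p : Fin r) : Fin ℓ ×ₗ ℕ := (l.initial.symm p).rowIdx

theorem rowFn_mono (l : MultiPartition ℓ r) : Monotone l.rowFn := fun _ _ h =>
  Box.rowIdx_mono ((monoEquivOfFin l.Box l.card_box).monotone h)

theorem rowComp_mono : Monotone (rowComp (ℓ := ℓ)) := by
  intro a b h
  rw [Prod.Lex.le_iff] at h
  rcases h with h | h
  · exact h.le
  · exact h.1.le

theorem IsStandard.lt {t : l.Box ≃ Fin r} (ht : IsStandard t) {b b' : l.Box}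
    (hc : b.comp = b'.comp) (hr : b.row ≤ b'.row) (hk : b.col ≤ b'.col) (hne : b ≠ b') :
    t b < t b' := by
  rcases hr.eq_or_lt with hr | hr
  · exact (ht b b' hc).1 hr (lt_of_le_of_ne hk fun e => hne (Box.ext hc hr e))
  · have hm : (b'.row, b.col) ∈ l.comp b'.comp := (l.comp b'.comp).up_left_mem le_rfl hk b'.mem
    have h1 : t b < t (l.mkBox b'.comp b'.row b.col hm) :=
      (ht b (l.mkBox b'.comp b'.row b.col hm) hc).2 rfl hr
    rcases hk.eq_or_lt with hk | hk
    · have e : l.mkBox b'.comp b'.row b.col hm = b' := Box.ext rfl rfl hk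
      rwa [e] at h1
    · exact h1.trans ((ht (l.mkBox b'.comp b'.row b.col hm) b' rfl).1 rfl hk)

/-- Necessary conditions for a product of a row vector and a column vector not to vanish. -/
structure Survives (ρ : Fin r → Fin ℓ ×ₗ ℕ) (T : Fin r → l.Box) : Prop where
  comp_le : ∀ p, (T p).comp ≤ rowComp (ρ p)
  col_ne : ∀ a b, a ≠ b → ρ a = ρ b → (T a).comp = rowComp (ρ a) → (T b).comp = rowComp (ρ b) →
    (T a).col ≠ (T b).col

/-- Fix column j of component i and count what lies before row (s, K). If i < s, or if this column
has no box in row K or below, then T itself is an injection into the boxes. Otherwise there is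
nothing to count unless i = s; then the positions lie in distinct rows among the first K, as two in
one row would share a column, and the column has a box in each of these rows. -/
theorem Survives.card_fiber_le {ρ : Fin r → Fin ℓ ×ₗ ℕ} {T : Fin r → l.Box} (h : Survives ρ T)
    (hT : Function.Injective T) (s : Fin ℓ) (K : ℕ) (c : Fin ℓ × ℕ) :
    ((Finset.univ.filter fun p => ρ p < toLex (s, K)).filter
      fun p => ((T p).comp, (T p).col) = c).card ≤
    ((Finset.univ.filter fun b : l.Box => b.rowIdx < toLex (s, K)).filter
      fun b => (b.comp, b.col) = c).card := by
  classical
  obtain ⟨i, j⟩ := c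
  by_cases hi : i < s ∨ ∀ b : l.Box, b.comp = i → b.col = j → b.row < K
  · refine Finset.card_le_card_of_injOn T ?_ hT.injOn
    intro p hp
    simp only [Finset.coe_filter, Set.mem_ofPred_eq, Finset.mem_filter, Finset.mem_univ, true_and,
      Prod.mk.injEq] at hp ⊢
    refine ⟨?_, hp.2⟩
    unfold Box.rowIdx
    rw [Prod.Lex.toLex_lt_toLex]
    rcases hi with hi | hi
    · exact Or.inl (hp.2.1 ▸ hi)
    · have h1 := h.comp_le p
      have h2 : rowComp (ρ p) ≤ s := rowComp_mono hp.1.le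
      rcases (h1.trans h2).lt_or_eq with h3 | h3
      · exact Or.inl h3
      · exact Or.inr ⟨h3, hi _ hp.2.1 hp.2.2⟩
  · push Not at hi
    obtain ⟨hsi, b, hb1, hb2, hbK⟩ := hi
    have hmem : ∀ p, ρ p < toLex (s, K) → (T p).comp = i → s = i ∧ rowComp (ρ p) = s ∧
        (ofLex (ρ p)).2 < K := by
      intro p hp hc
      have h1 := h.comp_le p
      have h2 : rowComp (ρ p) ≤ s := rowComp_mono hp.le
      have h3 : s = i := le_antisymm hsi (hc ▸ h1.trans h2)
      have h4 : rowComp (ρ p) = s := le_antisymm h2 (by rw [h3, ← hc]; exact h1)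
      refine ⟨h3, h4, ?_⟩
      rw [Prod.Lex.lt_iff] at hp
      rcases hp with hp | hp
      · exact absurd h4 (ne_of_lt hp)
      · exact hp.2
    by_cases hs : s = i
    swap
    · rw [Finset.card_eq_zero.2]
      · exact Nat.zero_le _
      · rw [Finset.eq_empty_iff_forall_notMem]
        intro p hp
        simp only [Finset.mem_filter, Finset.mem_univ, true_and, Prod.mk.injEq] at hp
        exact hs (hmem p hp.1 hp.2.1).1
    calc _ ≤ (Finset.range K).card := by
          refine Finset.card_le_card_of_injOn (fun p => (ofLex (ρ p)).2) ?_ ?_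
          · intro p hp
            simp only [Finset.coe_filter, Set.mem_ofPred_eq, Finset.mem_filter, Finset.mem_univ,
              true_and, Prod.mk.injEq] at hp
            simpa using (hmem p hp.1 hp.2.1).2.2
          · intro p hp p' hp' e
            simp only [Finset.coe_filter, Set.mem_ofPred_eq, Finset.mem_filter, Finset.mem_univ,
              true_and, Prod.mk.injEq] at hp hp' e
            by_contra hne
            obtain ⟨a1, a2, -⟩ := hmem p hp.1 hp.2.1
            obtain ⟨b1, b2, -⟩ := hmem p' hp'.1 hp'.2.1
            refine h.col_ne p p' hne (Prod.ext (a2.trans b2.symm) e) ?_ ?_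
              (hp.2.2.trans hp'.2.2.symm)
            · rw [hp.2.1, a2, a1]
            · rw [hp'.2.1, b2, b1]
      _ ≤ _ := by
          refine Finset.card_le_card_of_surjOn Box.row ?_
          intro k hk
          have hk' : k < K := by simpa using hk
          have hm : (k, j) ∈ l.comp i := by
            have := b.mem
            rw [hb1, hb2] at this
            exact (l.comp i).up_left_mem (hk'.le.trans hbK) le_rfl this
          refine ⟨l.mkBox i k j hm, ?_, rfl⟩
          simp only [Finset.coe_filter, Set.mem_ofPred_eq, Finset.mem_filter, Finset.mem_univ,
            true_and]
          refine ⟨?_, rfl⟩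
          unfold Box.rowIdx
          rw [Prod.Lex.toLex_lt_toLex]
          exact Or.inr ⟨hs.symm, hk'⟩

/-- The number of boxes in the rows before the given one. -/
def boxCount (l : MultiPartition ℓ r) (θ : Fin ℓ ×ₗ ℕ) : ℕ :=
  (Finset.univ.filter fun b : l.Box => b.rowIdx < θ).card

theorem card_filter_rowFn (l : MultiPartition ℓ r) (θ : Fin ℓ ×ₗ ℕ) :
    (Finset.univ.filter fun p => l.rowFn p < θ).card = l.boxCount θ :=
  Finset.card_equiv l.initial.symm fun _ =>
    ⟨fun h => Finset.mem_filter.2 ⟨Finset.mem_univ _, (Finset.mem_filter.1 h).2⟩,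
      fun h => Finset.mem_filter.2 ⟨Finset.mem_univ _, (Finset.mem_filter.1 h).2⟩⟩

theorem card_cells_filter (μ : YoungDiagram) (K : ℕ) :
    (μ.cells.filter fun c => c.1 < K).card = ∑ j ∈ Finset.range K, μ.rowLen j := by
  rw [Finset.card_eq_sum_card_fiberwise (f := Prod.fst) (t := Finset.range K)
    fun c hc => by simpa using (Finset.mem_filter.1 hc).2]
  refine Finset.sum_congr rfl fun j hj => ?_
  rw [YoungDiagram.rowLen_eq_card, YoungDiagram.row, Finset.filter_filter]
  congr 1
  refine Finset.filter_congr fun c _ => ⟨And.right, fun e => ⟨?_, e⟩⟩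
  rw [e]
  simpa using hj

theorem boxCount_eq (l : MultiPartition ℓ r) (s : Fin ℓ) (K : ℕ) :
    l.boxCount (toLex (s, K)) = l.partialSize s + ∑ j ∈ Finset.range K, (l.comp s).rowLen j := by
  classical
  have h1 : l.boxCount (toLex (s, K)) = ∑ i : Fin ℓ, ((l.comp i).cells.filter
      fun c => (toLex (i, c.1) : Fin ℓ ×ₗ ℕ) < toLex (s, K)).card := by
    rw [boxCount, Finset.card_eq_sum_card_fiberwise (f := Box.comp) (t := Finset.univ)
      fun _ _ => Finset.mem_coe.2 (Finset.mem_univ _)]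
    refine Finset.sum_congr rfl fun i _ => ?_
    refine Finset.card_bij (fun b _ => (b.row, b.col)) ?_ ?_ ?_
    · intro b hb
      simp only [Finset.mem_filter, Finset.mem_univ, true_and] at hb ⊢
      obtain ⟨hb, rfl⟩ := hb
      exact ⟨b.mem, hb⟩
    · intro b hb b' hb' e
      simp only [Finset.mem_filter, Finset.mem_univ, true_and, Prod.mk.injEq] at hb hb' e
      exact Box.ext (hb.2.trans hb'.2.symm) e.1 e.2
    · rintro ⟨k, j⟩ hc
      simp only [Finset.mem_filter] at hc
      refine ⟨l.mkBox i k j hc.1, ?_, rfl⟩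
      simp only [Finset.mem_filter, Finset.mem_univ, true_and]
      exact ⟨hc.2, rfl⟩
  have h2 : ∀ i : Fin ℓ, ((l.comp i).cells.filter
      fun c => (toLex (i, c.1) : Fin ℓ ×ₗ ℕ) < toLex (s, K)).card =
      (if i.val < s.val then (l.comp i).card else 0) +
        if i = s then ∑ j ∈ Finset.range K, (l.comp s).rowLen j else 0 := by
    intro i
    simp only [Prod.Lex.toLex_lt_toLex]
    rcases lt_trichotomy i s with h | rfl | h
    · simp [h, h.ne]
    · simp [card_cells_filter]
    · simp [h.not_gt, h.ne']
  rw [h1, Finset.sum_congr rfl fun i _ => h2 i, Finset.sum_add_distrib, partialSize,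
    Finset.sum_filter]
  simp

/-- Row functions that violate the dominance inequalities for `λ`. -/
def Exceeds (l : MultiPartition ℓ r) (ρ : Fin r → Fin ℓ ×ₗ ℕ) : Prop :=
  ∃ θ, l.boxCount θ < (Finset.univ.filter fun p => ρ p < θ).card

theorem Survives.not_exceeds {ρ : Fin r → Fin ℓ ×ₗ ℕ} {T : Fin r → l.Box} (h : Survives ρ T)
    (hT : Function.Injective T) : ¬ l.Exceeds ρ := by
  rintro ⟨θ, hθ⟩
  exact absurd (card_le_of_card_fiber_le _ _
    (h.card_fiber_le hT (ofLex θ).1 (ofLex θ).2)) (not_le.2 hθ)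

theorem exceeds_rowFn_of_not_le {m l : MultiPartition ℓ r} (h : ¬ m ≤ l) : l.Exceeds m.rowFn := by
  by_contra hc
  refine h fun s k => ?_
  rw [← boxCount_eq, ← boxCount_eq, ← card_filter_rowFn]
  exact not_lt.1 fun hlt => hc ⟨_, hlt⟩

theorem card_filter_lt_of_isDescent {ρ ρ' : Fin r → Fin ℓ ×ₗ ℕ} {τ : Equiv.Perm (Fin r)}
    (h : ∀ p, ρ' p ≤ ρ (τ p)) (θ : Fin ℓ ×ₗ ℕ) : (Finset.univ.filter fun p => ρ p < θ).card =
      (Finset.univ.filter fun p => ρ (τ p) < θ).card ∧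
      (Finset.univ.filter fun p => ρ (τ p) < θ) ⊆ Finset.univ.filter fun p => ρ' p < θ := by
  refine ⟨Finset.card_equiv τ.symm fun p => by simp, fun p hp => ?_⟩
  simp only [Finset.mem_filter, Finset.mem_univ, true_and] at hp ⊢
  exact (h p).trans_lt hp

theorem Exceeds.of_isDescent {ρ ρ' : Fin r → Fin ℓ ×ₗ ℕ} (h : l.Exceeds ρ)
    (hd : IsDescent ρ ρ') : l.Exceeds ρ' := by
  obtain ⟨θ, hθ⟩ := h
  obtain ⟨τ, h1, -⟩ := hd
  obtain ⟨h2, h3⟩ := card_filter_lt_of_isDescent h1 θ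
  exact ⟨θ, hθ.trans_le (h2 ▸ Finset.card_le_card h3)⟩

/-- Take θ to be the row of τ p, where p strictly moves: then p lies before θ for ρ', but not for
the rearranged rows of t^λ. -/
theorem exceeds_of_isDescent_rowFn {ρ' : Fin r → Fin ℓ ×ₗ ℕ} (hd : IsDescent l.rowFn ρ') :
    l.Exceeds ρ' := by
  obtain ⟨τ, h1, p, hp⟩ := hd
  obtain ⟨h2, h3⟩ := card_filter_lt_of_isDescent h1 (l.rowFn (τ p))
  refine ⟨l.rowFn (τ p), ?_⟩
  rw [← card_filter_rowFn, h2]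
  refine Finset.card_lt_card (Finset.ssubset_iff_subset_ne.2 ⟨h3, fun e => ?_⟩)
  have : p ∈ Finset.univ.filter fun p' => l.rowFn (τ p') < l.rowFn (τ p) := by
    rw [e]; simpa using hp
  simp at this

/-- The conditions of `Survives` for a permutation of the boxes. -/
structure BoxSurvives (g : Equiv.Perm l.Box) : Prop where
  comp_eq : ∀ b, (g b).comp = b.comp
  col_ne : ∀ b b', b ≠ b' → b.rowIdx = b'.rowIdx → (g b).col ≠ (g b').col

/-- For a bijection the component indices have the same sum on both sides, so the inequalities
between them are equalities. -/
theorem Survives.boxSurvives {T : Fin r ≃ l.Box} (h : Survives l.rowFn T) :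
    BoxSurvives (l.initial.trans T) := by
  have hr : ∀ b : l.Box, rowComp (l.rowFn (l.initial b)) = b.comp := fun b => by
    simp [rowFn, rowComp, Box.rowIdx]
  have h1 : ∀ b : l.Box, (T (l.initial b)).comp ≤ b.comp := fun b =>
    (h.comp_le _).trans_eq (hr b)
  have h2 : ∑ b : l.Box, (T (l.initial b)).comp.val = ∑ b : l.Box, b.comp.val :=
    Equiv.sum_comp (l.initial.trans T) fun b => b.comp.val
  have h3 : ∀ b, (T (l.initial b)).comp = b.comp := fun b =>
    Fin.ext ((Finset.sum_eq_sum_iff_of_le fun b _ => Fin.le_def.1 (h1 b)).1 h2 b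
      (Finset.mem_univ b))
  refine ⟨h3, fun b b' hne e => h.col_ne _ _ (by simpa using hne) (by simpa [rowFn] using e) ?_ ?_⟩
  · rw [h3, hr]
  · rw [h3, hr]

/-- The totals agree, so the inequalities of `Survives.card_fiber_le` are equalities for every K. If
the column of g b did not reach the row of b, its number of boxes would not change when K passes
that row, while b adds a new position on the other side. -/
theorem BoxSurvives.mem {g : Equiv.Perm l.Box} (h : BoxSurvives g) (b : l.Box) :
    (b.row, (g b).col) ∈ l.comp b.comp := by
  classical
  have hS : Survives l.rowFn fun p => g (l.initial.symm p) :=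
    ⟨fun p => (h.comp_eq _).le, fun p p' hne e _ _ => h.col_ne _ _ (by simpa using hne) e⟩
  have hinj : Function.Injective fun p => g (l.initial.symm p) :=
    g.injective.comp l.initial.symm.injective
  have hfib := fun K => card_fiber_eq_of_card_eq _ _ (hS.card_fiber_le hinj b.comp K)
    (card_filter_rowFn l (toLex (b.comp, K))).ge (b.comp, (g b).col)
  by_contra hc
  have hK := hfib b.row
  have hK1 := hfib (b.row + 1)
  have e1 : ((Finset.univ.filter fun b' : l.Box => b'.rowIdx < toLex (b.comp, b.row + 1)).filter
      fun b' => (b'.comp, b'.col) = (b.comp, (g b).col)) =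
      ((Finset.univ.filter fun b' : l.Box => b'.rowIdx < toLex (b.comp, b.row)).filter
      fun b' => (b'.comp, b'.col) = (b.comp, (g b).col)) := by
    ext b'
    simp only [Finset.mem_filter, Finset.mem_univ, true_and, Prod.mk.injEq, Box.rowIdx,
      Prod.Lex.toLex_lt_toLex]
    constructor
    · rintro ⟨h1 | h1, h2, h3⟩
      · exact ⟨Or.inl h1, h2, h3⟩
      · refine ⟨Or.inr ⟨h1.1, lt_of_le_of_ne (Nat.lt_succ_iff.1 h1.2) fun e => hc ?_⟩, h2, h3⟩
        have := b'.mem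
        rwa [e, h2, h3] at this
    · rintro ⟨h1 | h1, h2, h3⟩
      · exact ⟨Or.inl h1, h2, h3⟩
      · exact ⟨Or.inr ⟨h1.1, h1.2.trans (Nat.lt_succ_self _)⟩, h2, h3⟩
  rw [e1, ← hK] at hK1
  refine absurd hK1 (ne_of_gt (Finset.card_lt_card (Finset.ssubset_iff_subset_ne.2 ⟨?_, ?_⟩)))
  · refine Finset.filter_subset_filter _ fun p hp => ?_
    simp only [Finset.mem_filter, Finset.mem_univ, true_and] at hp ⊢
    refine hp.trans ?_
    rw [Prod.Lex.toLex_lt_toLex]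
    exact Or.inr ⟨rfl, Nat.lt_succ_self _⟩
  · intro e
    have : l.initial b ∈ ((Finset.univ.filter fun p => l.rowFn p <
        toLex (b.comp, b.row + 1)).filter fun p => ((g (l.initial.symm p)).comp,
          (g (l.initial.symm p)).col) = (b.comp, (g b).col)) := by
      simp only [Finset.mem_filter, Finset.mem_univ, true_and, Equiv.symm_apply_apply, h.comp_eq,
        and_true, rowFn, Box.rowIdx, Prod.Lex.toLex_lt_toLex]
      exact Or.inr (Nat.lt_succ_self _)
    rw [← e] at this
    simp [rowFn, Box.rowIdx, Prod.Lex.toLex_lt_toLex] at this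

/-- A surviving permutation of the boxes is the product of a row permutation and a column
permutation. -/
theorem BoxSurvives.exists_factor {g : Equiv.Perm l.Box} (h : BoxSurvives g) :
    ∃ u c : Equiv.Perm l.Box, g = c * u ∧ (∀ b, (u b).rowIdx = b.rowIdx) ∧
      ∀ b, (c b).comp = b.comp ∧ (c b).col = b.col := by
  -- The row permutation u moves b within its row to the column of g b; what remains of g stays in
  -- that column. Such a box exists by `BoxSurvives.mem`.
  let f : l.Box → l.Box := fun b => l.mkBox b.comp b.row (g b).col (h.mem b)
  have hf : Function.Injective f := by
    intro b b' e
    by_contra hne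
    have h1 : (f b).comp = (f b').comp := congrArg Box.comp e
    have h2 : (f b).row = (f b').row := congrArg Box.row e
    have h3 : (f b).col = (f b').col := congrArg Box.col e
    exact h.col_ne b b' hne (Box.rowIdx_eq_iff.2 ⟨h1, h2⟩) h3
  let u : Equiv.Perm l.Box := Equiv.ofBijective f (Finite.injective_iff_bijective.1 hf)
  refine ⟨u, g * u⁻¹, by simp, fun b => rfl, fun b => ?_⟩
  obtain ⟨b, rfl⟩ := u.surjective b
  have e : (g * u⁻¹) (u b) = g b := by simp
  rw [e]
  exact ⟨h.comp_eq b, rfl⟩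

theorem boxSurvives_of_factor {u c : Equiv.Perm l.Box} (hu : ∀ b, (u b).rowIdx = b.rowIdx)
    (hc : ∀ b, (c b).comp = b.comp ∧ (c b).col = b.col) : BoxSurvives (c * u) := by
  refine ⟨fun b => (hc _).1.trans (Box.rowIdx_eq_iff.1 (hu b)).1, fun b b' hne e e' => ?_⟩
  simp only [Equiv.Perm.mul_apply, hc] at e'
  have h1 := (hu b).trans (e.trans (hu b').symm)
  rw [Box.rowIdx_eq_iff] at h1
  exact hne (u.injective (Box.ext h1.1 h1.2 e'))

/-- The sequence of the rows of `1, …, r` in a tableau. -/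
def rowSeq (t : l.Std) : Lex (Fin r → ℕ) := toLex fun k => (t.1.symm k).row

/-- A surviving permutation that relates two standard tableaux is the identity or lowers the
sequence of rows. -/
theorem eq_or_rowSeq_lt {t q : l.Std} (h : BoxSurvives (t.1.trans q.1.symm)) :
    t = q ∨ rowSeq q < rowSeq t := by
  by_cases htq : t = q
  · exact Or.inl htq
  right
  have hex : ∃ k, t.1.symm k ≠ q.1.symm k := by
    by_contra hc
    push Not at hc
    refine htq (Subtype.ext ?_)
    rw [← Equiv.symm_symm t.1, ← Equiv.symm_symm q.1, Equiv.ext hc]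
  obtain ⟨k, hk, hmin⟩ := WellFounded.has_min (wellFounded_lt (α := Fin r)) {k | _} hex
  have hlt : ∀ i < k, t.1.symm i = q.1.symm i := fun i hi => by
    by_contra hc
    exact hmin i hc hi
  have hfix : ∀ b, t.1 b < k → q.1 b = t.1 b := fun b hb => by
    have := hlt _ hb
    rw [Equiv.symm_apply_apply] at this
    rw [Equiv.eq_symm_apply] at this
    exact this
  have hfix' : ∀ b, q.1 b < k → t.1 b = q.1 b := fun b hb => by
    have := (hlt _ hb).symm
    rw [Equiv.symm_apply_apply] at this
    rw [Equiv.eq_symm_apply] at this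
    exact this
  set b := t.1.symm k with hb
  set b' := q.1.symm k with hb'
  have htb : t.1 b = k := Equiv.apply_symm_apply _ _
  have hqb : q.1 b' = k := Equiv.apply_symm_apply _ _
  have hgb : (t.1.trans q.1.symm) b = b' := by simp [hb, hb']
  have hne : b ≠ b' := hk
  have hcomp : b'.comp = b.comp := hgb ▸ h.comp_eq b
  have hq : ¬ q.1 b < k := fun hlt' => by
    have := hfix' b hlt'
    rw [htb] at this
    exact absurd hlt' (this ▸ lt_irrefl _)
  have ht : ¬ t.1 b' < k := fun hlt' => by
    have := hfix b' hlt'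
    rw [hqb] at this
    exact absurd hlt' (this ▸ lt_irrefl _)
  refine ⟨k, fun i hi => ?_, ?_⟩
  · simp only [rowSeq, Pi.toLex_apply, hlt i hi]
  · simp only [rowSeq, Pi.toLex_apply]
    rw [← hb, ← hb']
    -- Otherwise b' is weakly below b. It lies strictly to its left, since else q would have an
    -- entry less than k at b. The box c in the row of b and the column of b' then has an entry less
    -- than k in t, so it is fixed. Thus b and c share a row and have images in the same column.
    by_contra hrow
    rw [not_lt] at hrow
    have hcol : b'.col < b.col := by
      by_contra hcol
      exact hq (hqb ▸ q.2.lt hcomp.symm hrow (not_lt.1 hcol) hne)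
    have hm : (b.row, b'.col) ∈ l.comp b.comp := (l.comp b.comp).up_left_mem le_rfl hcol.le b.mem
    set c := l.mkBox b.comp b.row b'.col hm
    have hcb : c ≠ b := fun e => hcol.ne (show c.col = b.col from congrArg Box.col e)
    have hc1 : t.1 c < k := htb ▸ t.2.lt (b := c) rfl le_rfl hcol.le hcb
    have hgc : (t.1.trans q.1.symm) c = c := by
      simp [← hfix c hc1]
    refine h.col_ne c b hcb rfl ?_
    rw [hgc, hgb]
    rfl

/-! ### The dual multipartition -/

theorem dual_dual (l : MultiPartition ℓ r) : l.dual.dual = l := by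
  ext i c
  simp [dual]

/-- The boxes of `λ'` correspond to those of `λ`. -/
def dualBox (l : MultiPartition ℓ r) : l.dual.Box ≃ l.Box where
  toFun b := l.mkBox b.comp.rev b.col b.row (YoungDiagram.mem_transpose.1 b.mem)
  invFun b := l.dual.mkBox b.comp.rev b.col b.row (by
    have := b.mem
    simpa [dual, YoungDiagram.mem_transpose] using this)
  left_inv b := Box.ext (Fin.rev_rev _) rfl rfl
  right_inv b := Box.ext (Fin.rev_rev _) rfl rfl

theorem isStandard_dualBox_trans {t : l.Box ≃ Fin r} :
    IsStandard (l.dualBox.trans t) ↔ IsStandard t := by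
  constructor
  · intro h b b' e
    have := h (l.dualBox.symm b) (l.dualBox.symm b') (congrArg Fin.rev e)
    simp only [Equiv.trans_apply, Equiv.apply_symm_apply] at this
    exact ⟨this.2, this.1⟩
  · intro h b b' e
    have := h (l.dualBox b) (l.dualBox b') (congrArg Fin.rev e)
    exact ⟨this.2, this.1⟩

/-- The standard tableaux of shape `λ'` are the transposes of those of shape `λ`. -/
def dualStd (l : MultiPartition ℓ r) : l.Std ≃ l.dual.Std where
  toFun t := ⟨l.dualBox.trans t.1, isStandard_dualBox_trans.2 t.2⟩
  invFun t := ⟨l.dualBox.symm.trans t.1, isStandard_dualBox_trans.1 (by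
    convert t.2 using 1
    ext b; simp)⟩
  left_inv t := Subtype.ext (by ext b; simp)
  right_inv t := Subtype.ext (by ext b; simp)

end MultiPartition

/-! ### The elements `x_λ` -/

section RowSums

open MvPolynomial

variable {ℓ : ℕ} (ω : Fin ℓ → ℂ) {r : ℕ}

/-- The trivial character or the sign character. -/
def signChar (a : Fin 2) (w : Equiv.Perm (Fin r)) : ℂ :=
  if a = 0 then 1 else ((Equiv.Perm.sign w : ℤˣ) : ℤ)

theorem signChar_one (a : Fin 2) : signChar a (1 : Equiv.Perm (Fin r)) = 1 := by
  simp [signChar]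

theorem signChar_mul (a : Fin 2) (w w' : Equiv.Perm (Fin r)) :
    signChar a (w * w') = signChar a w * signChar a w' := by
  unfold signChar
  split_ifs <;> simp

theorem signChar_inv (a : Fin 2) (w : Equiv.Perm (Fin r)) : signChar a w⁻¹ = signChar a w := by
  simp [signChar]

/-- The sign by which transpositions act. -/
def swapSign (a : Fin 2) : ℂ := if a = 0 then 1 else -1

theorem swapSign_mul_self (a : Fin 2) : swapSign a * swapSign a = 1 := by
  unfold swapSign
  split_ifs <;> simp

theorem signChar_swap (a : Fin 2) {p p' : Fin r} (h : p ≠ p') :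
    signChar a (Equiv.swap p p') = swapSign a := by
  unfold signChar swapSign
  split_ifs
  · rfl
  · rw [Equiv.Perm.sign_swap h]; simp

theorem mem_rowStabilizer {l : MultiPartition ℓ r} {i : Fin ℓ} {w : Equiv.Perm (Fin r)} :
    w ∈ rowStabilizer l i ↔
      ∀ p, (rowComp (l.rowFn p) ≠ i → w p = p) ∧ l.rowFn (w p) = l.rowFn p := by
  unfold rowStabilizer
  rw [Finset.mem_filter]
  simp only [Finset.mem_univ, true_and]
  constructor
  · intro h p
    have := h (l.initial.symm p)
    rw [Equiv.apply_symm_apply] at this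
    exact ⟨this.1, MultiPartition.Box.rowIdx_eq_iff.2 this.2⟩
  · intro h b
    have := h (l.initial b)
    simp only [MultiPartition.rowFn, Equiv.symm_apply_apply] at this
    exact ⟨this.1, MultiPartition.Box.rowIdx_eq_iff.1 this.2⟩

theorem one_mem_rowStabilizer (l : MultiPartition ℓ r) (i : Fin ℓ) : 1 ∈ rowStabilizer l i :=
  mem_rowStabilizer.2 fun _ => ⟨fun _ => rfl, rfl⟩

theorem inv_mem_rowStabilizer {l : MultiPartition ℓ r} {i : Fin ℓ} {w : Equiv.Perm (Fin r)}
    (h : w ∈ rowStabilizer l i) : w⁻¹ ∈ rowStabilizer l i := by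
  rw [mem_rowStabilizer] at h ⊢
  intro p
  refine ⟨fun hp => Equiv.Perm.inv_eq_iff_eq.2 ((h p).1 hp).symm, ?_⟩
  rw [← (h _).2]
  simp

theorem swap_mul_mem_rowStabilizer {l : MultiPartition ℓ r} {i : Fin ℓ} {a b : Fin r}
    (hab : l.rowFn a = l.rowFn b) (hi : rowComp (l.rowFn a) = i) {w : Equiv.Perm (Fin r)}
    (h : w ∈ rowStabilizer l i) : Equiv.swap a b * w ∈ rowStabilizer l i := by
  rw [mem_rowStabilizer] at h ⊢
  intro p
  have hf : ∀ p, l.rowFn (Equiv.swap a b p) = l.rowFn p := by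
    intro p
    by_cases h1 : p = a
    · subst h1; rw [Equiv.swap_apply_left, hab]
    by_cases h2 : p = b
    · subst h2; rw [Equiv.swap_apply_right, hab]
    rw [Equiv.swap_apply_of_ne_of_ne h1 h2]
  refine ⟨fun hp => ?_, ?_⟩
  · rw [Equiv.Perm.mul_apply, (h p).1 hp, Equiv.swap_apply_of_ne_of_ne]
    · rintro rfl; exact hp hi
    · rintro rfl; exact hp (hab ▸ hi)
  · rw [Equiv.Perm.mul_apply, hf, (h p).2]

/-- The (signed) sum of the row stabilizer of a component. -/
def blockSum (c : Fin ℓ → Fin 2) (l : MultiPartition ℓ r) (i : Fin ℓ) : Hecke ω r :=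
  ∑ w ∈ rowStabilizer l i, signChar (c i) w • pm ω w

theorem xElt_eq (c : Fin ℓ → Fin 2) (l : MultiPartition ℓ r) :
    xElt ω c l = ((List.finRange ℓ).map (blockSum ω c l)).prod := by
  rw [xElt, List.ofFn_eq_map]
  congr 2
  funext i
  unfold blockSum rowSum signedRowSum signChar
  split_ifs
  · simp only [one_smul]; rfl
  · refine Finset.sum_congr rfl fun w _ => ?_
    rw [Int.cast_smul_eq_zsmul]; rfl

variable {c : Fin ℓ → Fin 2} {l : MultiPartition ℓ r}

theorem blockSum_mul_swap {a b : Fin r} (hne : a ≠ b) (hab : l.rowFn a = l.rowFn b) :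
    blockSum ω c l (rowComp (l.rowFn a)) * pm ω (Equiv.swap a b) =
      swapSign (c (rowComp (l.rowFn a))) • blockSum ω c l (rowComp (l.rowFn a)) := by
  unfold blockSum
  rw [Finset.sum_mul, Finset.smul_sum]
  refine Finset.sum_bij' (fun w _ => Equiv.swap a b * w) (fun w _ => Equiv.swap a b * w)
    (fun w hw => swap_mul_mem_rowStabilizer hab rfl hw)
    (fun w hw => swap_mul_mem_rowStabilizer hab rfl hw) ?_ ?_ ?_
  · intro w _; rw [← mul_assoc, Equiv.swap_mul_self, one_mul]
  · intro w _; rw [← mul_assoc, Equiv.swap_mul_self, one_mul]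
  · intro w _
    rw [smul_mul_assoc, pm_mul, signChar_mul, signChar_swap _ hne, smul_smul, ← mul_assoc,
      swapSign_mul_self, one_mul]

theorem commute_of_disjoint {w w' : Equiv.Perm (Fin r)} (h : ∀ p, w p = p ∨ w' p = p) :
    Commute (pm ω w) (pm ω w') := by
  have : w' * w = w * w' := (Equiv.Perm.Disjoint.commute (fun p => h p)).symm
  rw [Commute, SemiconjBy, pm_mul, pm_mul, this]

theorem blockSum_commute_swap {a b : Fin r} (hab : l.rowFn a = l.rowFn b) {i : Fin ℓ}
    (hi : rowComp (l.rowFn a) ≠ i) : Commute (blockSum ω c l i) (pm ω (Equiv.swap a b)) := by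
  refine Commute.sum_left _ _ _ fun w hw => Commute.smul_left (commute_of_disjoint ω fun p => ?_) _
  by_cases hp : rowComp (l.rowFn p) = i
  · right
    rw [Equiv.swap_apply_of_ne_of_ne]
    · rintro rfl; exact hi hp
    · rintro rfl; exact hi (hab ▸ hp)
  · exact Or.inl ((mem_rowStabilizer.1 hw p).1 hp)

theorem blockSum_commute {i j : Fin ℓ} (hij : i ≠ j) :
    Commute (blockSum ω c l i) (blockSum ω c l j) := by
  refine Commute.sum_left _ _ _ fun w hw => Commute.smul_left (Commute.sum_right _ _ _ fun w' hw' =>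
    Commute.smul_right (commute_of_disjoint ω fun p => ?_) _) _
  by_cases hp : rowComp (l.rowFn p) = i
  · exact Or.inr ((mem_rowStabilizer.1 hw' p).1 (hp ▸ hij))
  · exact Or.inl ((mem_rowStabilizer.1 hw p).1 hp)

theorem xElt_mul_swap {a b : Fin r} (hne : a ≠ b) (hab : l.rowFn a = l.rowFn b) :
    xElt ω c l * pm ω (Equiv.swap a b) = swapSign (c (rowComp (l.rowFn a))) • xElt ω c l := by
  rw [xElt_eq]
  obtain ⟨L₁, L₂, hL⟩ := List.append_of_mem (List.mem_finRange (rowComp (l.rowFn a)))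
  have hnd := List.nodup_finRange ℓ
  rw [hL] at hnd
  have hnot : ∀ i ∈ L₂, rowComp (l.rowFn a) ≠ i := by
    rintro i hi rfl
    exact (List.nodup_cons.1 (List.nodup_append.1 hnd).2.1).1 hi
  have hcomm : Commute (L₂.map (blockSum ω c l)).prod (pm ω (Equiv.swap a b)) := by
    refine Commute.list_prod_left _ _ fun y hy => ?_
    obtain ⟨i, hi, rfl⟩ := List.mem_map.1 hy
    exact blockSum_commute_swap ω hab (hnot i hi)
  rw [hL, List.map_append, List.prod_append, List.map_cons, List.prod_cons, mul_assoc, mul_assoc,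
    hcomm.eq, ← mul_assoc (blockSum ω c l _), blockSum_mul_swap ω hne hab, smul_mul_assoc,
    mul_smul_comm]

theorem st_blockSum (i : Fin ℓ) : st ω (blockSum ω c l i) = blockSum ω c l i := by
  unfold blockSum
  rw [st_sum]
  refine Finset.sum_bij' (fun w _ => w⁻¹) (fun w _ => w⁻¹) (fun w hw => inv_mem_rowStabilizer hw)
    (fun w hw => inv_mem_rowStabilizer hw) (fun w _ => inv_inv w) (fun w _ => inv_inv w) ?_
  intro w _
  rw [st_smul, st_pm, signChar_inv]

theorem st_list_prod (L : List (Hecke ω r)) : st ω L.prod = (L.map (st ω)).reverse.prod := by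
  induction L with
  | nil => simp [st_one]
  | cons a L ih => simp [st_mul, ih]

theorem st_xElt : st ω (xElt ω c l) = xElt ω c l := by
  rw [xElt_eq, st_list_prod, List.map_map]
  have e : st ω ∘ blockSum ω c l = blockSum ω c l := funext fun i => st_blockSum ω i
  rw [e]
  refine ((List.reverse_perm _).symm.prod_eq' ?_).symm
  rw [List.pairwise_map]
  exact (List.nodup_finRange ℓ).imp fun h => blockSum_commute ω h

/-- `x_λ` as a linear combination of row permutations. -/
theorem xElt_eq_sum : ∃ f : Equiv.Perm (Fin r) → ℂ, xElt ω c l = ∑ w, f w • pm ω w ∧ f 1 = 1 ∧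
    ∀ w, f w ≠ 0 → ∀ p, l.rowFn (w p) = l.rowFn p := by
  classical
  rw [xElt_eq]
  -- The statement is strengthened for the induction: partial products also fix the components
  -- outside L. Hence distinct blocks interact only through the identity, which keeps the
  -- coefficient of 1 equal to 1.
  suffices h : ∀ L : List (Fin ℓ), L.Nodup → ∃ f : Equiv.Perm (Fin r) → ℂ,
      (L.map (blockSum ω c l)).prod = ∑ w, f w • pm ω w ∧ f 1 = 1 ∧
      ∀ w, f w ≠ 0 → ∀ p, l.rowFn (w p) = l.rowFn p ∧ (rowComp (l.rowFn p) ∉ L → w p = p) by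
    obtain ⟨f, h1, h2, h3⟩ := h _ (List.nodup_finRange ℓ)
    exact ⟨f, h1, h2, fun w hw p => (h3 w hw p).1⟩
  intro L hL
  induction L with
  | nil =>
    refine ⟨Pi.single 1 1, ?_, by simp, fun w hw p => ?_⟩
    · rw [Finset.sum_eq_single 1 (fun w _ hw => by simp [hw]) (by simp)]
      simp [pm_one]
    · have : w = 1 := by
        by_contra hc
        simp [hc] at hw
      subst this
      simp
  | cons i L ih =>
    obtain ⟨hi, hL⟩ := List.nodup_cons.1 hL
    obtain ⟨f, h1, h2, h3⟩ := ih hL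
    refine ⟨fun v => ∑ w ∈ rowStabilizer l i, signChar (c i) w * f (v * w⁻¹), ?_, ?_, ?_⟩
    · rw [List.map_cons, List.prod_cons, h1, blockSum, Finset.sum_mul_sum]
      simp only [Finset.sum_smul]
      rw [Finset.sum_comm (s := Finset.univ)]
      refine Finset.sum_congr rfl fun w _ => ?_
      rw [← Equiv.sum_comp (Equiv.mulRight w)
        (fun v => (signChar (c i) w * f (v * w⁻¹)) • pm ω v)]
      refine Finset.sum_congr rfl fun v _ => ?_
      simp only [Equiv.coe_mulRight, mul_inv_cancel_right]
      rw [smul_mul_smul_comm, pm_mul]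
    · beta_reduce
      rw [Finset.sum_eq_single 1]
      · simp [signChar_one, h2]
      · intro w hw hw1
        have : f (1 * w⁻¹) = 0 := by
          by_contra hc
          refine hw1 (inv_eq_one.1 (Equiv.ext fun p => ?_))
          rw [Equiv.Perm.one_apply]
          rw [one_mul] at hc
          by_cases hp : rowComp (l.rowFn p) = i
          · exact (h3 _ hc p).2 (hp ▸ hi)
          · exact (mem_rowStabilizer.1 (inv_mem_rowStabilizer hw) p).1 hp
        rw [this, mul_zero]
      · exact fun h => absurd (one_mem_rowStabilizer l i) h
    · intro v hv p
      obtain ⟨w, hw, hne⟩ := Finset.exists_ne_zero_of_sum_ne_zero hv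
      have hf := h3 _ (right_ne_zero_of_mul hne) (w p)
      have hvw : (v * w⁻¹) (w p) = v p := by simp
      have hw' := mem_rowStabilizer.1 hw p
      rw [hvw] at hf
      refine ⟨hf.1.trans hw'.2, fun hp => ?_⟩
      rw [List.mem_cons, not_or] at hp
      have e := hw'.1 hp.1
      rw [e] at hf
      exact hf.2 hp.2

/-! ### The elements `π_{[λ]}` -/

theorem piFactor_eq (a : ℕ) (z : ℂ) :
    piFactor ω a z = evX ω (∏ k : Fin r with k.val < a, (X k - C z)) := by
  have e : (Finset.univ.filter fun k : Fin r => k.val < a) =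
      ((List.finRange r).take a).toFinset := by
    ext k
    simp only [Finset.mem_filter, Finset.mem_univ, true_and, List.mem_toFinset,
      List.mem_take_iff_getElem, List.getElem_finRange]
    constructor
    · intro h
      exact ⟨k.val, by simp [h], by simp⟩
    · rintro ⟨j, hj, rfl⟩
      simp only [List.length_finRange, lt_min_iff] at hj
      exact hj.1
  rw [e, List.prod_toFinset _ ((List.nodup_finRange r).sublist (List.take_sublist _ _)),
    map_list_prod, List.map_map, piFactor]
  congr 2
  funext k
  simp [evX_X]

/-- A downward closed set of positions is an initial segment, so it is determined by its size. This
translates the bounds k ≤ a_i in π_[λ] into conditions on components. -/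
theorem iff_val_lt_card_filter {P : Fin r → Prop} [DecidablePred P]
    (hP : ∀ a b, a ≤ b → P b → P a) (p : Fin r) : P p ↔ p.val < (Finset.univ.filter P).card := by
  constructor
  · intro h
    have : Finset.Iic p ⊆ Finset.univ.filter P := fun a ha => by
      simpa using hP a p (Finset.mem_Iic.1 ha) h
    have := Finset.card_le_card this
    rw [Fin.card_Iic] at this
    omega
  · intro h
    by_contra hc
    have : Finset.univ.filter P ⊆ Finset.Iio p := fun a ha => by
      rw [Finset.mem_filter] at ha
      exact Finset.mem_Iio.2 (not_le.1 fun hle => hc (hP p a hle ha.2))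
    have := Finset.card_le_card this
    rw [Fin.card_Iio] at this
    omega

theorem val_lt_partialSize_iff (l : MultiPartition ℓ r) (p : Fin r) (i : Fin ℓ) :
    p.val < l.partialSize i ↔ rowComp (l.rowFn p) < i := by
  have h1 : l.partialSize i = (Finset.univ.filter fun p => l.rowFn p < toLex (i, 0)).card := by
    rw [l.card_filter_rowFn, l.boxCount_eq]; simp
  rw [h1, ← iff_val_lt_card_filter fun a b hab hb => (l.rowFn_mono hab).trans_lt hb,
    Prod.Lex.lt_iff]
  simp [rowComp]

theorem piPoly_eq_prod (q : Fin ℓ → ℂ) (l : MultiPartition ℓ r) :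
    (piPoly q fun k => rowComp (l.rowFn k)) =
      ∏ i : Fin ℓ, ∏ k : Fin r with k.val < l.partialSize i, (X k - C (q i)) := by
  unfold piPoly
  simp only [Finset.prod_filter]
  rw [Finset.prod_comm]
  simp only [val_lt_partialSize_iff]

theorem prod_piFactor (q : Fin ℓ → ℂ) (l : MultiPartition ℓ r) :
    (List.ofFn fun k : Fin (ℓ - 1) =>
      piFactor ω (l.partialSize (k.val + 1)) (q ⟨k.val + 1, by omega⟩)).prod =
    evX ω (piPoly q fun k => rowComp (l.rowFn k)) := by
  have e : (List.ofFn fun k : Fin (ℓ - 1) =>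
      piFactor ω (l.partialSize (k.val + 1)) (q ⟨k.val + 1, by omega⟩)).prod =
      evX ω (∏ i : Fin (ℓ - 1), ∏ k : Fin r with k.val < l.partialSize (i.val + 1),
        (X k - C (q ⟨i.val + 1, by omega⟩))) := by
    rw [← List.prod_ofFn, map_list_prod, List.map_ofFn]
    congr 2
    funext k
    exact piFactor_eq ω _ _
  rw [e, piPoly_eq_prod]
  congr 1
  -- The factor of index 0 in `piPoly_eq_prod` is empty because a_0 = 0, so only the ℓ - 1 factors
  -- of π_[λ] remain.
  obtain _ | m := ℓ
  · simp
  · rw [Fin.prod_univ_succ]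
    have e0 : l.partialSize ((0 : Fin (m + 1)) : ℕ) = 0 := by
      simp [MultiPartition.partialSize]
    rw [e0]
    simp only [Nat.not_lt_zero, Finset.filter_false, Finset.prod_empty, one_mul]
    rfl

end RowSums

/-! ### The generators of the cell ideals -/

section CellGenerators

open MvPolynomial

variable {ℓ : ℕ} (ω : Fin ℓ → ℂ) {r : ℕ}

/-- The element `π_{[λ]} x_λ`, for arbitrary parameters `q` of the linear factors. -/
def cellGen (q : Fin ℓ → ℂ) (c : Fin ℓ → Fin 2) (l : MultiPartition ℓ r) : Hecke ω r :=
  evX ω (piPoly q fun k => rowComp (l.rowFn k)) * xElt ω c l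

/-- The choice of signs that belongs to `y_λ`. -/
def coSign (c : Fin ℓ → Fin 2) (i : Fin ℓ) : Fin 2 := if c i.rev = 0 then 1 else 0

theorem coSign_coSign (c : Fin ℓ → Fin 2) : coSign (coSign c) = c := by
  funext i
  have h : ∀ a : Fin 2, (if (if a = 0 then (1 : Fin 2) else 0) = 0 then (1 : Fin 2) else 0) = a := by
    decide
  rw [coSign, coSign, Fin.rev_rev]
  exact h _

theorem swapSign_coSign (c : Fin ℓ → Fin 2) (i : Fin ℓ) :
    swapSign (coSign c i) = -swapSign (c i.rev) := by
  unfold coSign swapSign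
  split_ifs <;> simp_all

theorem piElt_mul_xElt (c : Fin ℓ → Fin 2) (l : MultiPartition ℓ r) :
    piElt ω l * xElt ω c l = cellGen ω ω c l := by
  rw [cellGen, ← prod_piFactor]; rfl

/-- This reduces the n-basis to the m-basis: the parameters are reversed, which leaves the
cyclotomic polynomial unchanged, and the signs are replaced by `coSign c`. -/
theorem piTildeElt_mul_yElt (c : Fin ℓ → Fin 2) (l : MultiPartition ℓ r) :
    piTildeElt ω l * yElt ω c l = cellGen ω (fun i => ω i.rev) (coSign c) l := by
  rw [cellGen, ← prod_piFactor]
  congr 1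
  · unfold piTildeElt
    congr 2
    funext k
    congr 2
    simp only [Fin.ext_iff, Fin.val_rev]
    omega
  · unfold yElt xElt
    congr 2
    funext i
    unfold coSign
    split_ifs <;> simp_all

theorem cellGen_eq (q : Fin ℓ → ℂ) (c : Fin ℓ → Fin 2) (l : MultiPartition ℓ r) :
    cellGen ω q c l = xElt ω c l * evX ω (piPoly q fun k => rowComp (l.rowFn k)) := by
  obtain ⟨f, hf, -, hs⟩ := xElt_eq_sum ω (c := c) (l := l)
  rw [cellGen, hf, Finset.mul_sum, Finset.sum_mul]
  refine Finset.sum_congr rfl fun w _ => ?_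
  by_cases hw : f w = 0
  · simp [hw]
  · rw [mul_smul_comm, smul_mul_assoc, pm_comm_piPoly ω q
      (fun a b h => MultiPartition.rowComp_mono (l.rowFn_mono h)) w fun k => by rw [hs w hw]]

theorem st_cellGen (q : Fin ℓ → ℂ) (c : Fin ℓ → Fin 2) (l : MultiPartition ℓ r) :
    st ω (cellGen ω q c l) = cellGen ω q c l := by
  rw [cellGen_eq, st_mul, st_evX, st_xElt, ← cellGen_eq, cellGen]

theorem isRowVec_cellGen (q : Fin ℓ → ℂ) (c : Fin ℓ → Fin 2) (l : MultiPartition ℓ r) :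
    IsRowVec ω q (fun i => swapSign (c i)) l.rowFn (cellGen ω q c l) := by
  refine ⟨fun a b h => MultiPartition.rowComp_mono (l.rowFn_mono h), ⟨_, cellGen_eq ω q c l⟩, ?_⟩
  intro a b hne hab
  rw [cellGen, mul_assoc, xElt_mul_swap ω hne hab, mul_smul_comm]

theorem cellGen_mul_pm (q : Fin ℓ → ℂ) (c : Fin ℓ → Fin 2) (l : MultiPartition ℓ r)
    (σ : Equiv.Perm (Fin r)) (hσ : ∀ k, l.rowFn (σ k) = l.rowFn k) :
    ∃ z : ℂ, cellGen ω q c l * pm ω σ = z • cellGen ω q c l := by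
  refine young_induction l.rowFn_mono (P := fun σ => ∃ z : ℂ, cellGen ω q c l * pm ω σ =
    z • cellGen ω q c l) ⟨1, by rw [pm_one, mul_one, one_smul]⟩ ?_ σ hσ
  rintro σ i hi ⟨z, hz⟩
  refine ⟨swapSign (c (rowComp (l.rowFn (lo i)))) * z, ?_⟩
  rw [← pm_mul, ← mul_assoc, (isRowVec_cellGen ω q c l).swap _ _ (lo_ne_hi i) hi, smul_mul_assoc,
    hz, smul_smul]

theorem pm_mul_cellGen (q : Fin ℓ → ℂ) (c : Fin ℓ → Fin 2) (l : MultiPartition ℓ r)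
    (σ : Equiv.Perm (Fin r)) (hσ : ∀ k, l.rowFn (σ k) = l.rowFn k) :
    ∃ z : ℂ, pm ω σ * cellGen ω q c l = z • cellGen ω q c l := by
  obtain ⟨z, hz⟩ := cellGen_mul_pm ω q c l σ⁻¹ fun k => by
    rw [← hσ]; simp
  have := congrArg (st ω) hz
  rw [st_mul, st_pm, st_smul, st_cellGen, inv_inv] at this
  exact ⟨z, this⟩

variable {ω} {q : Fin ℓ → ℂ} {c : Fin ℓ → Fin 2} {l : MultiPartition ℓ r}

theorem rowComp_dual_rowFn (p : Fin r) :
    (rowComp (l.dual.rowFn p)).rev = (l.dualBox (l.dual.initial.symm p)).comp := rfl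

/-- Under `dualBox` the rows of λ' are the columns of λ with components reversed, and `coSign` makes
the signs of a component and of its conjugate opposite. The two conditions are then the
contrapositives of the two vanishing lemmas for row vectors. -/
theorem survives_of_mul_ne_zero (hq : cycPoly q = cycPoly ω) {ρ : Fin r → Fin ℓ ×ₗ ℕ}
    {v : Hecke ω r} (h : IsRowVec ω q (fun i => swapSign (c i)) ρ v) {σ : Equiv.Perm (Fin r)}
    (hne : v * pm ω σ * cellGen ω (fun i => q i.rev) (coSign c) l.dual ≠ 0) :
    MultiPartition.Survives ρ fun p => l.dualBox (l.dual.initial.symm (σ p)) := by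
  have h' := isRowVec_cellGen ω (fun i => q i.rev) (coSign c) l.dual
  rw [← st_cellGen] at hne
  refine ⟨fun p => ?_, fun a b hab hρ ha hb hcol => ?_⟩
  · by_contra hp
    exact hne (h.mul_pm_mul_st_eq_zero_of_lt hq h' σ p (not_le.1 hp))
  · refine hne (h.mul_pm_mul_st_eq_zero_of_eq h' σ hab hρ
      (MultiPartition.Box.rowIdx_eq_iff.2 ⟨Fin.rev_injective ?_, hcol⟩) ?_ ?_)
    · change (l.dualBox (l.dual.initial.symm (σ a))).comp =
        (l.dualBox (l.dual.initial.symm (σ b))).comp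
      rw [ha, hb, hρ]
    · rw [swapSign_coSign, rowComp_dual_rowFn, ha]
    · unfold swapSign
      split_ifs <;> simp

theorem rowSpan_mul_cellGen (hq : cycPoly q = cycPoly ω) {a : Hecke ω r}
    (ha : a ∈ rowSpan ω q (fun i => swapSign (c i)) l.Exceeds) :
    a * cellGen ω (fun i => q i.rev) (coSign c) l.dual = 0 := by
  rw [← Submodule.mem_bot ℂ]
  refine mul_mem_of_span ?_ ha
  rintro _ ⟨ρ, v, σ, hρ, hv, rfl⟩
  rw [Submodule.mem_bot]
  by_contra hne
  exact (survives_of_mul_ne_zero hq hv hne).not_exceeds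
    (l.dualBox.injective.comp (l.dual.initial.symm.injective.comp σ.injective)) hρ

/-- The rows of t^μ violate a dominance inequality for λ. Right multiplication only leads to
descents, which preserve the violation, and rows with a nonzero product satisfy all the
inequalities. -/
theorem cellGen_mul_mul_eq_zero (hq : cycPoly q = cycPoly ω) {m : MultiPartition ℓ r}
    (hm : ¬ m ≤ l) (a : Hecke ω r) :
    cellGen ω q c m * a * cellGen ω (fun i => q i.rev) (coSign c) l.dual = 0 := by
  refine rowSpan_mul_cellGen hq (rowSpan_mul hq (fun _ _ h hd => h.of_isDescent hd) ?_ a)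
  exact Submodule.subset_span ⟨m.rowFn, cellGen ω q c m, 1,
    MultiPartition.exceeds_rowFn_of_not_le hm, isRowVec_cellGen ω q c m, by rw [pm_one, mul_one]⟩

/-- The permutation `w_λ`, which takes `t^λ` to the transpose of `t^{λ'}`. -/
def transPerm (l : MultiPartition ℓ r) : Equiv.Perm (Fin r) :=
  l.initial.symm.trans (l.dualBox.symm.trans l.dual.initial)

variable (ω q c l) in
/-- The element `π_{[λ]} x_λ w_λ π̃_{[λ']} y_{λ'}`. -/
def spechtGen : Hecke ω r :=
  cellGen ω q c l * pm ω (transPerm l) * cellGen ω (fun i => q i.rev) (coSign c) l.dual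

/-- If the product does not vanish, the box permutation attached to σ is a row permutation followed
by a column permutation. The first is absorbed by m_λ and the second by n_λ', each up to a scalar,
and w_λ remains between them. -/
theorem cellGen_mul_pm_mul_cellGen (hq : cycPoly q = cycPoly ω) (σ : Equiv.Perm (Fin r)) :
    ∃ z : ℂ, cellGen ω q c l * pm ω σ * cellGen ω (fun i => q i.rev) (coSign c) l.dual =
      z • spechtGen ω q c l := by
  by_cases h0 : cellGen ω q c l * pm ω σ * cellGen ω (fun i => q i.rev) (coSign c) l.dual = 0
  · exact ⟨0, by rw [h0, zero_smul]⟩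
  let T : Fin r ≃ l.Box := σ.trans (l.dual.initial.symm.trans l.dualBox)
  have hT : MultiPartition.Survives l.rowFn T :=
    survives_of_mul_ne_zero hq (isRowVec_cellGen ω q c l) h0
  obtain ⟨u, k, hg, hu, hk⟩ := hT.boxSurvives.exists_factor
  set û : Equiv.Perm (Fin r) := l.initial.permCongr u with hû
  set kd : Equiv.Perm (Fin r) := (l.dualBox.symm.trans l.dual.initial).permCongr k with hkd
  have hσ : σ = kd * (transPerm l * û) := by
    ext p
    have := congrArg (fun g : Equiv.Perm l.Box => g (l.initial.symm p)) hg
    simp only [Equiv.trans_apply, Equiv.apply_symm_apply, T, Equiv.Perm.mul_apply] at this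
    simp only [Equiv.Perm.mul_apply, hû, hkd, transPerm, Equiv.permCongr_apply, Equiv.symm_trans,
      Equiv.trans_apply, Equiv.symm_symm, Equiv.symm_apply_apply, Equiv.apply_symm_apply, ← this]
  obtain ⟨z₁, h₁⟩ := cellGen_mul_pm ω q c l û fun p => by
    simp [MultiPartition.rowFn, hû, hu]
  obtain ⟨z₂, h₂⟩ := pm_mul_cellGen ω (fun i => q i.rev) (coSign c) l.dual kd fun p => by
    simp only [MultiPartition.rowFn, hkd, Equiv.permCongr_apply, Equiv.symm_trans,
      Equiv.trans_apply, Equiv.symm_symm, Equiv.symm_apply_apply]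
    have := hk (l.dualBox (l.dual.initial.symm p))
    exact MultiPartition.Box.rowIdx_eq_iff.2 ⟨(congrArg Fin.rev this.1).trans (Fin.rev_rev _),
      this.2⟩
  refine ⟨z₁ * z₂, ?_⟩
  rw [hσ, ← pm_mul, ← pm_mul, mul_assoc, mul_assoc, h₂, mul_smul_comm, mul_smul_comm, ← mul_assoc,
    ← mul_assoc, h₁, smul_mul_assoc, smul_mul_assoc, smul_smul, mul_comm z₂, spechtGen]

/-- Modulo row vectors that violate dominance, which n_λ' annihilates, m_λ a is a combination of the
m_λ w. -/
theorem cellGen_mul_mul_cellGen (hq : cycPoly q = cycPoly ω) (a : Hecke ω r) :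
    ∃ z : ℂ, cellGen ω q c l * a * cellGen ω (fun i => q i.rev) (coSign c) l.dual =
      z • spechtGen ω q c l := by
  have h := (isRowVec_cellGen ω q c l).mul_mem hq (P := l.Exceeds)
    (fun _ _ h hd => h.of_isDescent hd)
    (fun _ hd => MultiPartition.exceeds_of_isDescent_rowFn hd) a
  obtain ⟨a₁, h₁, a₂, h₂, e⟩ := Submodule.mem_sup.1 h
  rw [← e, add_mul, rowSpan_mul_cellGen hq h₂, add_zero]
  have := mul_mem_of_span (N := Submodule.span ℂ {spechtGen ω q c l})
    (b := cellGen ω (fun i => q i.rev) (coSign c) l.dual) ?_ h₁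
  · obtain ⟨z, hz⟩ := Submodule.mem_span_singleton.1 this
    exact ⟨z, hz.symm⟩
  · rintro _ ⟨σ, rfl⟩
    obtain ⟨z, hz⟩ := cellGen_mul_pm_mul_cellGen (c := c) (l := l) hq σ
    exact Submodule.mem_span_singleton.2 ⟨z, hz.symm⟩

/-- The permutation `d(t)`. -/
def tabPerm (t : l.Std) : Equiv.Perm (Fin r) := l.initial.symm.trans t.1

variable (ω q c l) in
/-- The basis elements `d(s)⁻¹ π_{[λ]} x_λ d(t)`. -/
def cellElt (u t : l.Std) : Hecke ω r :=
  pm ω (tabPerm u)⁻¹ * cellGen ω q c l * pm ω (tabPerm t)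

variable (ω c) in
theorem mBasis_eq : mBasis ω c = cellElt (r := r) ω ω c := by
  funext l u t
  rw [mBasis, piElt_mul_xElt]; rfl

variable (ω c) in
theorem nBasis_eq : nBasis ω c = cellElt (r := r) ω (fun i => ω i.rev) (coSign c) := by
  funext l u t
  rw [nBasis, piTildeElt_mul_yElt]; rfl

theorem st_cellElt (u t : l.Std) : st ω (cellElt ω q c l u t) = cellElt ω q c l t u := by
  rw [cellElt, st_mul, st_mul, st_pm, st_pm, st_cellGen, inv_inv, cellElt, mul_assoc]

variable (ω q c l) in
/-- The elements `d(t)⁻¹ π̃_{[λ']} y_{λ'}`. -/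
def coElt (t : l.dual.Std) : Hecke ω r :=
  pm ω (tabPerm t)⁻¹ * cellGen ω (fun i => q i.rev) (coSign c) l.dual

variable (ω q c l) in
/-- The elements `d(s)⁻¹ z_λ`, which form a basis of the cell module. -/
def spechtElt (u : l.Std) : Hecke ω r := pm ω (tabPerm u)⁻¹ * spechtGen ω q c l

theorem cellElt_mul_mul_coElt_eq_zero (hq : cycPoly q = cycPoly ω) {m : MultiPartition ℓ r}
    (hm : ¬ m ≤ l) (u t : m.Std) (a : Hecke ω r) (p : l.dual.Std) :
    cellElt ω q c m u t * a * coElt ω q c l p = 0 := by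
  have := cellGen_mul_mul_eq_zero (c := c) hq hm (pm ω (tabPerm t) * a * pm ω (tabPerm p)⁻¹)
  rw [cellElt, coElt]
  calc _ = pm ω (tabPerm u)⁻¹ * (cellGen ω q c m * (pm ω (tabPerm t) * a * pm ω (tabPerm p)⁻¹) *
        cellGen ω (fun i => q i.rev) (coSign c) l.dual) := by simp only [mul_assoc]
    _ = 0 := by rw [this, mul_zero]

/-- The matrix of the pairing between the two cell modules. -/
def pairing (hq : cycPoly q = cycPoly ω) (c : Fin ℓ → Fin 2) (l : MultiPartition ℓ r) (t : l.Std)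
    (p : l.dual.Std) : ℂ :=
  Classical.choose (cellGen_mul_mul_cellGen (c := c) (l := l) hq
    (pm ω (tabPerm t) * pm ω (tabPerm p)⁻¹))

theorem pairing_spec (hq : cycPoly q = cycPoly ω) (t : l.Std) (p : l.dual.Std) :
    cellGen ω q c l * (pm ω (tabPerm t) * pm ω (tabPerm p)⁻¹) *
      cellGen ω (fun i => q i.rev) (coSign c) l.dual = pairing hq c l t p • spechtGen ω q c l :=
  Classical.choose_spec (cellGen_mul_mul_cellGen (c := c) (l := l) hq
    (pm ω (tabPerm t) * pm ω (tabPerm p)⁻¹))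

theorem cellElt_mul_coElt (hq : cycPoly q = cycPoly ω) (u t : l.Std) (p : l.dual.Std) :
    cellElt ω q c l u t * coElt ω q c l p = pairing hq c l t p • spechtElt ω q c l u := by
  rw [spechtElt, ← mul_smul_comm, ← pairing_spec, cellElt, coElt]
  simp only [mul_assoc]

theorem tabPerm_dualStd (u : l.Std) : tabPerm (l.dualStd u) = tabPerm u * (transPerm l)⁻¹ := by
  rw [eq_mul_inv_iff_mul_eq]
  ext p
  change (u.1 (l.dualBox (l.dual.initial.symm (l.dual.initial (l.dualBox.symm
    (l.initial.symm p)))))).val = (u.1 (l.initial.symm p)).val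
  rw [Equiv.symm_apply_apply, Equiv.apply_symm_apply]

theorem pairing_dualStd_self (hq : cycPoly q = cycPoly ω) (hz : spechtGen ω q c l ≠ 0)
    (t : l.Std) : pairing hq c l t (l.dualStd t) = 1 := by
  have h := pairing_spec (c := c) hq t (l.dualStd t)
  rw [pm_mul, tabPerm_dualStd, mul_inv_rev, inv_inv, mul_assoc (transPerm l), inv_mul_cancel,
    mul_one] at h
  have h' : (pairing hq c l t (l.dualStd t) - 1) • spechtGen ω q c l = 0 := by
    rw [sub_smul, ← h, one_smul, spechtGen, sub_self]
  exact sub_eq_zero.1 ((smul_eq_zero.1 h').resolve_right hz)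

/-- A nonzero entry means that the box permutation from t to u survives, and `eq_or_rowSeq_lt`
compares the tableaux. Together with the diagonal entries this makes the pairing unitriangular. -/
theorem pairing_dualStd_of_ne_zero (hq : cycPoly q = cycPoly ω) (hz : spechtGen ω q c l ≠ 0)
    {t u : l.Std} (h : pairing hq c l t (l.dualStd u) ≠ 0) :
    t = u ∨ MultiPartition.rowSeq u < MultiPartition.rowSeq t := by
  refine MultiPartition.eq_or_rowSeq_lt ?_
  have h1 := pairing_spec (c := c) hq t (l.dualStd u)
  rw [pm_mul] at h1
  have h2 := survives_of_mul_ne_zero hq (isRowVec_cellGen ω q c l) (h1 ▸ smul_ne_zero h hz)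
  have h3 := MultiPartition.Survives.boxSurvives (T := ((tabPerm (l.dualStd u))⁻¹ *
    tabPerm t).trans (l.dual.initial.symm.trans l.dualBox)) h2
  convert h3 using 1
  ext1 b
  have e1 : tabPerm t (l.initial b) = t.1 b := congrArg t.1 (Equiv.symm_apply_apply _ _)
  have e2 : (tabPerm u)⁻¹ (t.1 b) = l.initial (u.1.symm (t.1 b)) := rfl
  simp only [Equiv.trans_apply, Equiv.Perm.mul_apply, tabPerm_dualStd, mul_inv_rev, inv_inv, e1,
    e2, transPerm, Equiv.symm_apply_apply, Equiv.apply_symm_apply]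

end CellGenerators

/-! ### Linear independence in the cell modules -/

/-- At an index j where f is maximal on the support of v, only the diagonal term contributes to the
sum. -/
theorem eq_zero_of_triangular {ι α : Type*} [Fintype ι] [LinearOrder α] (f : ι → α)
    {M : ι → ι → ℂ} (hd : ∀ i, M i i = 1) (ht : ∀ i j, M i j ≠ 0 → i = j ∨ f j < f i)
    {v : ι → ℂ} (hv : ∀ j, ∑ i, v i * M i j = 0) : v = 0 := by
  classical
  by_contra hne
  have hS : (Finset.univ.filter fun i => v i ≠ 0).Nonempty := by
    obtain ⟨i, hi⟩ := Function.ne_iff.1 hne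
    exact ⟨i, by simpa using hi⟩
  obtain ⟨j, hj, hmax⟩ := Finset.exists_max_image _ f hS
  have hj' : v j ≠ 0 := by simpa using hj
  have := hv j
  rw [Finset.sum_eq_single j, hd, mul_one] at this
  · exact hj' this
  · intro i _ hij
    by_cases hM : M i j = 0
    · rw [hM, mul_zero]
    · have hlt := (ht i j hM).resolve_left hij
      have : v i = 0 := by
        by_contra hc
        exact absurd (hmax i (by simpa using hc)) (not_le.2 hlt)
      rw [this, zero_mul]
  · exact fun h => absurd (Finset.mem_univ j) h

section Independence

open MvPolynomial

variable {ℓ : ℕ} {ω : Fin ℓ → ℂ} {n r : ℕ}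

theorem prod_X_sub_C_mem_degLT {ι : Type*} (S : Finset ι) (f : ι → Fin r) (a : ι → ℂ) :
    ∏ j ∈ S, (X (f j) - C (a j)) ∈ degLT r (S.card + 1) ∧
      ∏ j ∈ S, (X (f j) - C (a j)) - ∏ j ∈ S, X (f j) ∈ degLT r S.card := by
  classical
  induction S using Finset.induction_on with
  | empty =>
    refine ⟨mem_degLT_iff.2 (Or.inr (by simp)), by simp⟩
  | insert j S hj ih =>
    rw [Finset.prod_insert hj, Finset.prod_insert hj, Finset.card_insert_of_notMem hj]
    obtain ⟨h1, h2⟩ := ih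
    have e1 : (X (f j) - C (a j)) * ∏ j ∈ S, (X (f j) - C (a j)) - X (f j) * ∏ j ∈ S, X (f j) =
        X (f j) * (∏ j ∈ S, (X (f j) - C (a j)) - ∏ j ∈ S, X (f j)) -
          a j • ∏ j ∈ S, (X (f j) - C (a j)) := by
      rw [smul_eq_C_mul]; ring
    have e2 : (X (f j) - C (a j)) * ∏ j ∈ S, (X (f j) - C (a j)) =
        X (f j) * ∏ j ∈ S, (X (f j) - C (a j)) - a j • ∏ j ∈ S, (X (f j) - C (a j)) := by
      rw [smul_eq_C_mul]; ring
    rw [e1, e2]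
    exact ⟨Submodule.sub_mem _ (X_mul_mem_degLT h1 _) (degLT_mono (Nat.le_succ _)
      (Submodule.smul_mem _ _ h1)), Submodule.sub_mem _ (X_mul_mem_degLT h2 _)
      (Submodule.smul_mem _ _ h1)⟩

theorem piPoly_eq_prod_filter (q : Fin ℓ → ℂ) (κ : Fin r → Fin ℓ) :
    piPoly q κ = ∏ j : Fin r × Fin ℓ with κ j.1 < j.2, (X j.1 - C (q j.2)) := by
  unfold piPoly
  simp only [Finset.prod_filter]
  rw [Fintype.prod_prod_type]

theorem piPoly_rev (q : Fin ℓ → ℂ) (κ : Fin r → Fin ℓ) :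
    (piPoly (fun i => q i.rev) fun k => (κ k).rev) =
      ∏ j : Fin r × Fin ℓ with j.2 < κ j.1, (X j.1 - C (q j.2)) := by
  rw [piPoly_eq_prod_filter, Finset.prod_filter, Finset.prod_filter,
    ← Equiv.prod_comp ((Equiv.refl (Fin r)).prodCongr Fin.revPerm)]
  refine Finset.prod_congr rfl fun j _ => ?_
  simp [Fin.rev_lt_rev]

theorem piPoly_mul_piPoly_rev (q : Fin (ℓ) → ℂ) (κ : Fin r → Fin ℓ) :
    piPoly q κ * (piPoly (fun i => q i.rev) fun k => (κ k).rev) =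
      ∏ j : Fin r × Fin ℓ with j.2 ≠ κ j.1, (X j.1 - C (q j.2)) := by
  rw [piPoly_rev, piPoly_eq_prod_filter, ← Finset.prod_union]
  · refine Finset.prod_congr ?_ fun _ _ => rfl
    ext j
    simp only [Finset.mem_union, Finset.mem_filter, Finset.mem_univ, true_and]
    rw [ne_iff_lt_or_gt, or_comm]
  · rw [Finset.disjoint_filter]
    exact fun j _ h1 h2 => lt_asymm h1 h2

theorem card_filter_ne (κ : Fin r → Fin ℓ) :
    (Finset.univ.filter fun j : Fin r × Fin ℓ => j.2 ≠ κ j.1).card = r * (ℓ - 1) := by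
  rw [Finset.card_filter, Fintype.sum_prod_type]
  have : ∀ k : Fin r, ∑ i : Fin ℓ, (if i ≠ κ k then 1 else 0) = ℓ - 1 := fun k => by
    rw [← Finset.card_filter, Finset.filter_ne' Finset.univ (κ k),
      Finset.card_erase_of_mem (Finset.mem_univ _)]
    simp
  rw [Finset.sum_congr rfl fun k _ => this k]
  simp

theorem prod_X_filter_ne (κ : Fin (n + 1) → Fin ℓ) :
    (∏ j : Fin (n + 1) × Fin ℓ with j.2 ≠ κ j.1, X j.1 : MvPolynomial (Fin (n + 1)) ℂ) =
      monomial (topExp ℓ n) 1 := by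
  rw [Finset.prod_filter, Fintype.prod_prod_type, monomial_eq, C_1, one_mul,
    Finsupp.prod_fintype _ _ fun _ => pow_zero _]
  refine Finset.prod_congr rfl fun k _ => ?_
  simp only
  rw [← Finset.prod_filter, Finset.prod_const, Finset.filter_ne' Finset.univ (κ k),
    Finset.card_erase_of_mem (Finset.mem_univ _), topExp_apply]
  simp

/-- Moved through σ, the second product supplies the factors x_k - q_j with j < κ k, and the first
one has those with j > κ k. Together they contain ℓ - 1 linear factors in each variable, so the
leading term is the top monomial with coefficient 1. -/
theorem topFun_piPoly (hℓ : 0 < ℓ) (q : Fin ℓ → ℂ) {κ κ' : Fin (n + 1) → Fin ℓ}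
    (σ : Equiv.Perm (Fin (n + 1))) (h : ∀ k, κ' (σ k) = (κ k).rev) :
    topFun ω hℓ (evX ω (piPoly q κ) * pm ω σ * evX ω (piPoly (fun i => q i.rev) κ')) =
      Pi.single σ 1 := by
  have hκ : rename σ.symm (piPoly (fun i => q i.rev) κ') =
      piPoly (fun i => q i.rev) fun k => (κ k).rev := by
    rw [rename_piPoly]
    congr 1
    funext k
    exact h k
  set S₁ := Finset.univ.filter fun j : Fin (n + 1) × Fin ℓ => κ j.1 < j.2
  set S₂ := Finset.univ.filter fun j : Fin (n + 1) × Fin ℓ => j.2 < κ j.1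
  have hc : S₂.card + S₁.card = (n + 1) * (ℓ - 1) := by
    rw [← card_filter_ne κ, ← Finset.card_union_of_disjoint]
    · congr 1
      ext j
      simp only [S₁, S₂, Finset.mem_union, Finset.mem_filter, Finset.mem_univ, true_and]
      rw [ne_iff_lt_or_gt]
    · rw [Finset.disjoint_filter]
      exact fun j _ h1 h2 => lt_asymm h1 h2
  refine topFun_evX_pm_evX ω hℓ σ (d := S₂.card) (e := S₁.card) ?_ ?_ hc ?_
  · have := (prod_X_sub_C_mem_degLT S₁ Prod.fst fun j => q j.2).1
    rw [← piPoly_eq_prod_filter] at this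
    rcases mem_degLT_iff.1 this with h0 | h0
    · rw [h0]; simp
    · omega
  · have := (prod_X_sub_C_mem_degLT S₂ Prod.fst fun j => q j.2).1
    rw [← piPoly_rev, ← hκ] at this
    have := rename_mem_degLT this σ
    rw [rename_rename] at this
    simpa using this
  · rw [hκ, piPoly_mul_piPoly_rev, ← prod_X_filter_ne κ, ← card_filter_ne κ]
    exact (prod_X_sub_C_mem_degLT _ _ _).2

variable {q : Fin ℓ → ℂ} {c : Fin ℓ → Fin 2} {l : MultiPartition ℓ (n + 1)}

/-- The matrix that detects linear independence of the elements `d(s)⁻¹ z_λ`. -/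
theorem topFun_spechtElt_eq_sum (hℓ : 0 < ℓ) : ∃ f f' : Equiv.Perm (Fin (n + 1)) → ℂ, f 1 = 1 ∧ f' 1 = 1 ∧
    (∀ w, f w ≠ 0 → ∀ p, l.rowFn (w p) = l.rowFn p) ∧
    (∀ w, f' w ≠ 0 → ∀ p, l.dual.rowFn (w p) = l.dual.rowFn p) ∧
    ∀ s u : l.Std, topFun ω hℓ (spechtElt ω q c l s) (transPerm l * (tabPerm u)⁻¹) =
      ∑ w, ∑ w', if (tabPerm u)⁻¹ * tabPerm s = (transPerm l)⁻¹ * w' * transPerm l * w then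
        f w * f' w' else 0 := by
  obtain ⟨f, hf, hf1, hfs⟩ := xElt_eq_sum ω (c := c) (l := l)
  obtain ⟨f', hf', hf1', hfs'⟩ := xElt_eq_sum ω (c := coSign c) (l := l.dual)
  refine ⟨f, f', hf1, hf1', hfs, hfs', fun s u => ?_⟩
  have htop := topFun_piPoly (ω := ω) hℓ q (κ := fun k => rowComp (l.rowFn k))
    (κ' := fun k => rowComp (l.dual.rowFn k)) (transPerm l) fun k => by
      simp [transPerm, MultiPartition.rowFn, MultiPartition.dualBox, rowComp,
        MultiPartition.Box.rowIdx]
      rfl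
  set E := evX ω (piPoly q fun k => rowComp (l.rowFn k)) * pm ω (transPerm l) *
    evX ω (piPoly (fun i => q i.rev) fun k => rowComp (l.dual.rowFn k)) with hE
  have hZ : spechtElt ω q c l s = ∑ w, ∑ w', (f w * f' w') •
      (pm ω (w * (tabPerm s)⁻¹) * E * pm ω w') := by
    rw [spechtElt, spechtGen, cellGen_eq, cellGen, hf, hf', hE]
    simp only [Finset.sum_mul, Finset.mul_sum, smul_mul_assoc, mul_smul_comm, Finset.smul_sum,
      smul_smul]
    rw [Finset.sum_comm]
    refine Finset.sum_congr rfl fun w _ => Finset.sum_congr rfl fun w' _ => ?_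
    rw [← pm_mul]
    simp only [mul_assoc, mul_comm (f w)]
  rw [hZ]
  simp only [map_sum, map_smul, Finset.sum_apply, Pi.smul_apply, topFun_mul_pm, topFun_pm_mul,
    htop, Pi.single_apply, smul_eq_mul, mul_ite, mul_one, mul_zero]
  refine Finset.sum_congr rfl fun w _ => Finset.sum_congr rfl fun w' _ => ?_
  congr 1
  rw [eq_iff_iff, mul_inv_rev, inv_inv, mul_assoc, inv_mul_eq_iff_eq_mul, mul_assoc (transPerm l),
    mul_assoc (transPerm l)⁻¹, mul_assoc (transPerm l)⁻¹, eq_inv_mul_iff_mul_eq, ← mul_assoc,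
    ← mul_assoc, ← mul_assoc, mul_inv_eq_iff_eq_mul]

theorem factor_of_eq {s u : l.Std} {w w' : Equiv.Perm (Fin (n + 1))}
    (hw : ∀ p, l.rowFn (w p) = l.rowFn p) (hw' : ∀ p, l.dual.rowFn (w' p) = l.dual.rowFn p)
    (h : (tabPerm u)⁻¹ * tabPerm s = (transPerm l)⁻¹ * w' * transPerm l * w) :
    ∃ a b : Equiv.Perm l.Box, s.1.trans u.1.symm = b * a ∧ (∀ x, (a x).rowIdx = x.rowIdx) ∧
      (∀ x, (b x).comp = x.comp ∧ (b x).col = x.col) ∧ (a = 1 → w = 1) := by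
  refine ⟨l.initial.symm.permCongr w, (l.dual.initial.symm.trans l.dualBox).permCongr w', ?_, ?_,
    ?_, ?_⟩
  · ext1 x
    have := congrArg (fun g : Equiv.Perm (Fin (n + 1)) => l.initial.symm (g (l.initial x))) h
    have e1 : tabPerm s (l.initial x) = s.1 x := congrArg s.1 (Equiv.symm_apply_apply _ _)
    have e2 : (tabPerm u)⁻¹ (s.1 x) = l.initial (u.1.symm (s.1 x)) := rfl
    simp only [Equiv.Perm.mul_apply, e1, e2, Equiv.symm_apply_apply] at this
    rw [Equiv.trans_apply, this]
    simp only [Equiv.Perm.mul_apply, Equiv.permCongr_apply, Equiv.symm_symm, Equiv.symm_trans,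
      Equiv.trans_apply]
    change l.initial.symm (l.initial (l.dualBox (l.dual.initial.symm _))) = _
    rw [Equiv.symm_apply_apply]
    rfl
  · intro x
    have := hw (l.initial x)
    simpa [MultiPartition.rowFn] using this
  · intro x
    have := hw' (l.dual.initial (l.dualBox.symm x))
    simp only [MultiPartition.rowFn, Equiv.symm_apply_apply,
      MultiPartition.Box.rowIdx_eq_iff] at this
    refine ⟨?_, this.2⟩
    have h2 := congrArg Fin.rev this.1
    exact h2.trans (Fin.rev_rev _)
  · intro e
    exact (l.initial.symm.permCongr).injective (e.trans (by ext1; simp))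

/-- The top coefficients of d(s)⁻¹ z_λ at w_λ d(u)⁻¹ form a unitriangular matrix: a nonzero entry
forces the box permutation from s to u to be a row permutation followed by a column permutation. -/
theorem linearIndependent_spechtElt (hℓ : 0 < ℓ) : LinearIndependent ℂ (spechtElt ω q c l) := by
  obtain ⟨f, f', hf1, hf1', hfs, hfs', hsum⟩ :=
    topFun_spechtElt_eq_sum (ω := ω) (q := q) (c := c) (l := l) hℓ
  rw [Fintype.linearIndependent_iff]
  intro v hv
  refine congrFun (eq_zero_of_triangular (v := v) MultiPartition.rowSeq
    (M := fun s u => topFun ω hℓ (spechtElt ω q c l s) (transPerm l * (tabPerm u)⁻¹)) ?_ ?_ ?_)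
  · intro s
    simp only [hsum]
    rw [Finset.sum_eq_single 1, Finset.sum_eq_single 1]
    · simp [hf1, hf1']
    · intro w' _ hne
      rw [if_neg]
      intro h
      rw [inv_mul_cancel, mul_one, mul_assoc, eq_inv_mul_iff_mul_eq, mul_one] at h
      exact hne (mul_eq_right.1 h.symm)
    · simp
    · intro w _ hne
      refine Finset.sum_eq_zero fun w' _ => ?_
      split_ifs with h
      -- On the diagonal the row permutation a followed by the column permutation b is the identity.
      -- Then a fixes both the row and the column of every box, so w = 1.
      · by_contra hc
        obtain ⟨a, b, h1, h2, h3, h4⟩ := factor_of_eq (hfs w (left_ne_zero_of_mul hc))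
          (hfs' w' (right_ne_zero_of_mul hc)) h
        refine hne (h4 (Equiv.ext fun x => ?_))
        have h5 : b (a x) = x := by
          rw [← Equiv.Perm.mul_apply, ← h1]; simp
        have h6 := h3 (a x)
        rw [h5] at h6
        exact MultiPartition.Box.ext h6.1.symm (MultiPartition.Box.rowIdx_eq_iff.1 (h2 x)).2
          h6.2.symm
      · rfl
    · simp
  · intro s u hne
    simp only [hsum] at hne
    obtain ⟨w, -, hw⟩ := Finset.exists_ne_zero_of_sum_ne_zero hne
    obtain ⟨w', -, hw'⟩ := Finset.exists_ne_zero_of_sum_ne_zero hw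
    split_ifs at hw' with h
    · obtain ⟨a, b, h1, h2, h3, -⟩ := factor_of_eq (hfs w (left_ne_zero_of_mul hw'))
        (hfs' w' (right_ne_zero_of_mul hw')) h
      refine MultiPartition.eq_or_rowSeq_lt ?_
      rw [h1]
      exact MultiPartition.boxSurvives_of_factor h2 h3
    · exact absurd rfl hw'
  · intro u
    have := congrArg (fun a => topFun ω hℓ a (transPerm l * (tabPerm u)⁻¹)) hv
    simpa [map_sum, Finset.sum_apply] using this

end Independence

/-! ### Counting standard tableaux -/

section YoungDiagrams

variable {μ : YoungDiagram}

theorem row_lt_card {k j : ℕ} (h : (k, j) ∈ μ) : k < μ.card := by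
  have h1 : k < μ.colLen j := YoungDiagram.mem_iff_lt_colLen.1 h
  rw [YoungDiagram.colLen_eq_card] at h1
  exact h1.trans_le (Finset.card_le_card (Finset.filter_subset _ _))

theorem col_lt_card {k j : ℕ} (h : (k, j) ∈ μ) : j < μ.card := by
  have h1 : j < μ.rowLen k := YoungDiagram.mem_iff_lt_rowLen.1 h
  rw [YoungDiagram.rowLen_eq_card] at h1
  exact h1.trans_le (Finset.card_le_card (Finset.filter_subset _ _))

/-- The diagram with an additional box at the end of row `k`. -/
def addBox (μ : YoungDiagram) (k : ℕ) (h : k = 0 ∨ μ.rowLen k < μ.rowLen (k - 1)) :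
    YoungDiagram where
  cells := insert (k, μ.rowLen k) μ.cells
  isLowerSet := by
    rintro ⟨a, b⟩ ⟨a', b'⟩ hle hmem
    obtain ⟨h1, h2⟩ := Prod.mk_le_mk.1 hle
    simp only [Finset.coe_insert, Set.mem_insert_iff, Finset.mem_coe, YoungDiagram.mem_cells,
      Prod.mk.injEq] at hmem ⊢
    rcases hmem with ⟨rfl, rfl⟩ | hmem
    · rcases h1.eq_or_lt with rfl | h1
      · rcases h2.eq_or_lt with rfl | h2
        · exact Or.inl ⟨rfl, rfl⟩
        · exact Or.inr (YoungDiagram.mem_iff_lt_rowLen.2 h2)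
      · right
        have h3 : (a - 1, μ.rowLen a) ∈ μ := YoungDiagram.mem_iff_lt_rowLen.2 (by omega)
        exact μ.up_left_mem (by omega) h2 h3
    · exact Or.inr (μ.up_left_mem h1 h2 hmem)

theorem mem_addBox {k : ℕ} {h : k = 0 ∨ μ.rowLen k < μ.rowLen (k - 1)} {x : ℕ × ℕ} :
    x ∈ addBox μ k h ↔ x = (k, μ.rowLen k) ∨ x ∈ μ := by
  rw [← YoungDiagram.mem_cells, addBox]
  simp

theorem le_addBox {k : ℕ} (h : k = 0 ∨ μ.rowLen k < μ.rowLen (k - 1)) : μ ≤ addBox μ k h :=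
  fun _ hx => mem_addBox.2 (Or.inr hx)

theorem card_addBox {k : ℕ} (h : k = 0 ∨ μ.rowLen k < μ.rowLen (k - 1)) :
    (addBox μ k h).card = μ.card + 1 := by
  refine Finset.card_insert_of_notMem ?_
  rw [YoungDiagram.mem_cells, YoungDiagram.mem_iff_lt_rowLen]
  exact lt_irrefl _

/-- The diagram without the last box of row `k`. -/
def eraseBox (μ : YoungDiagram) (k : ℕ) (h : μ.rowLen (k + 1) < μ.rowLen k) : YoungDiagram where
  cells := μ.cells.erase (k, μ.rowLen k - 1)
  isLowerSet := by
    rintro ⟨a, b⟩ ⟨a', b'⟩ hle hmem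
    obtain ⟨h1, h2⟩ := Prod.mk_le_mk.1 hle
    simp only [Finset.coe_erase, Set.mem_sdiff, Finset.mem_coe, YoungDiagram.mem_cells,
      Set.mem_singleton_iff, Prod.mk.injEq] at hmem ⊢
    refine ⟨μ.up_left_mem h1 h2 hmem.1, ?_⟩
    rintro ⟨rfl, rfl⟩
    refine hmem.2 ?_
    have h3 := YoungDiagram.mem_iff_lt_rowLen.1 hmem.1
    rcases h1.eq_or_lt with rfl | h1
    · exact ⟨rfl, by omega⟩
    · have := μ.rowLen_anti a' (a' + 1) (Nat.le_succ _)
      have := μ.rowLen_anti (a' + 1) a h1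
      omega

theorem mem_eraseBox {k : ℕ} {h : μ.rowLen (k + 1) < μ.rowLen k} {x : ℕ × ℕ} :
    x ∈ eraseBox μ k h ↔ x ≠ (k, μ.rowLen k - 1) ∧ x ∈ μ := by
  rw [← YoungDiagram.mem_cells, eraseBox]
  simp

theorem eraseBox_le {k : ℕ} (h : μ.rowLen (k + 1) < μ.rowLen k) : eraseBox μ k h ≤ μ :=
  fun _ hx => (mem_eraseBox.1 hx).2

theorem card_eraseBox {k : ℕ} (h : μ.rowLen (k + 1) < μ.rowLen k) :
    (eraseBox μ k h).card + 1 = μ.card := by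
  refine Finset.card_erase_add_one ?_
  rw [YoungDiagram.mem_cells, YoungDiagram.mem_iff_lt_rowLen]
  omega

/-- The number of boxes of a family of diagrams. -/
def size {ℓ : ℕ} (f : Fin ℓ → YoungDiagram) : ℕ := ∑ i, (f i).card

theorem size_mono {ℓ : ℕ} {f g : Fin ℓ → YoungDiagram} (h : f ≤ g) : size f ≤ size g :=
  Finset.sum_le_sum fun i _ => Finset.card_le_card (YoungDiagram.cells_subset_iff.2 (h i))

theorem eq_of_le_of_size_le {ℓ : ℕ} {f g : Fin ℓ → YoungDiagram} (h : f ≤ g)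
    (hs : size g ≤ size f) : f = g := by
  have h1 : ∀ i, (f i).card ≤ (g i).card := fun i =>
    Finset.card_le_card (YoungDiagram.cells_subset_iff.2 (h i))
  have h2 := (Finset.sum_eq_sum_iff_of_le fun i _ => h1 i).1 (le_antisymm (size_mono h) hs)
  funext i
  exact YoungDiagram.ext (Finset.eq_of_subset_of_card_le (YoungDiagram.cells_subset_iff.2 (h i))
    (h2 i (Finset.mem_univ i)).ge)

theorem size_sup_add_size_inf {ℓ : ℕ} (f g : Fin ℓ → YoungDiagram) :
    size (f ⊔ g) + size (f ⊓ g) = size f + size g := by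
  simp only [size, ← Finset.sum_add_distrib, Pi.sup_apply, Pi.inf_apply, YoungDiagram.card,
    YoungDiagram.cells_sup, YoungDiagram.cells_inf, Finset.card_union_add_card_inter]

theorem size_update {ℓ : ℕ} (f : Fin ℓ → YoungDiagram) (i : Fin ℓ) (ν : YoungDiagram) :
    size (Function.update f i ν) + (f i).card = size f + ν.card := by
  classical
  unfold size
  rw [← Finset.add_sum_erase _ _ (Finset.mem_univ i),
    ← Finset.add_sum_erase _ (fun i => (f i).card) (Finset.mem_univ i), Function.update_self,
    Finset.sum_congr rfl fun j hj => by rw [Function.update_of_ne (Finset.ne_of_mem_erase hj)]]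
  ring

end YoungDiagrams

/-! ### Adding and removing boxes. -/

namespace MultiPartition

variable {ℓ n : ℕ}

theorem card_comp_le (l : MultiPartition ℓ n) (i : Fin ℓ) : (l.comp i).card ≤ n :=
  (Finset.single_le_sum (f := fun i => (l.comp i).card) (fun _ _ => Nat.zero_le _)
    (Finset.mem_univ i)).trans_eq l.card_eq

instance : Finite (MultiPartition ℓ n) := by
  refine Finite.of_injective (β := Fin ℓ → (Finset.range n ×ˢ Finset.range n).powerset)
    (fun l i => ⟨(l.comp i).cells, ?_⟩) ?_
  · rw [Finset.mem_powerset]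
    rintro ⟨k, j⟩ h
    rw [YoungDiagram.mem_cells] at h
    simp only [Finset.mem_product, Finset.mem_range]
    exact ⟨(row_lt_card h).trans_le (l.card_comp_le i), (col_lt_card h).trans_le (l.card_comp_le i)⟩
  · intro l m h
    refine MultiPartition.ext (funext fun i => YoungDiagram.ext ?_)
    exact congrArg Subtype.val (congrFun h i)

instance : Fintype (MultiPartition ℓ n) := Fintype.ofFinite _

instance : Subsingleton (MultiPartition ℓ 0) := ⟨fun l m => MultiPartition.ext
  (eq_of_le_of_size_le (fun i x hx => absurd (row_lt_card hx)
    (by have := l.card_comp_le i; omega)) (m.card_eq.trans_le (Nat.zero_le _)))⟩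

/-- `λ` arises from `μ` by adding a box. -/
def Covers (m : MultiPartition ℓ n) (l : MultiPartition ℓ (n + 1)) : Prop := m.comp ≤ l.comp

open Classical in
/-- The incidence matrix of `Covers`. -/
def inc (m : MultiPartition ℓ n) (l : MultiPartition ℓ (n + 1)) : ℕ := if m.Covers l then 1 else 0

/-- The rows to which a box may be added. -/
def addable (m : MultiPartition ℓ n) : Finset (Fin ℓ × ℕ) :=
  (Finset.univ ×ˢ Finset.range (n + 1)).filter fun a =>
    a.2 = 0 ∨ (m.comp a.1).rowLen a.2 < (m.comp a.1).rowLen (a.2 - 1)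

/-- The rows from which a box may be removed. -/
def removable (m : MultiPartition ℓ n) : Finset (Fin ℓ × ℕ) :=
  (Finset.univ ×ˢ Finset.range n).filter fun a =>
    (m.comp a.1).rowLen (a.2 + 1) < (m.comp a.1).rowLen a.2

/-- A box can be added to row k + 1 exactly when one can be removed from row k; in addition, row 0
of each of the ℓ components is always available. -/
theorem card_addable (m : MultiPartition ℓ n) : m.addable.card = m.removable.card + ℓ := by
  classical
  have e : m.addable = m.removable.image (fun a => (a.1, a.2 + 1)) ∪
      Finset.univ.image (fun i : Fin ℓ => (i, 0)) := by
    ext ⟨i, k⟩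
    simp only [addable, removable, Finset.mem_filter, Finset.mem_product, Finset.mem_univ,
      Finset.mem_range, true_and, Finset.mem_union, Finset.mem_image, Prod.mk.injEq, Prod.exists]
    obtain _ | k := k
    · simp
    · simp
  rw [e, Finset.card_union_of_disjoint, Finset.card_image_of_injective,
    Finset.card_image_of_injective, Finset.card_univ, Fintype.card_fin]
  · intro i j h; simpa using h
  · rintro ⟨i, k⟩ ⟨j, k'⟩ h; simpa using h
  · rw [Finset.disjoint_left]
    rintro ⟨i, k⟩ h1 h2
    simp only [Finset.mem_image, Prod.mk.injEq, Finset.mem_univ, true_and] at h1 h2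
    obtain ⟨a, -, -, h1⟩ := h1
    obtain ⟨j, -, h2⟩ := h2
    omega

open Classical in
theorem card_covers (m : MultiPartition ℓ n) :
    (Finset.univ.filter fun l => m.Covers l).card = m.addable.card := by
  symm
  refine Finset.card_bij (fun a ha => ⟨Function.update m.comp a.1
    (addBox (m.comp a.1) a.2 (Finset.mem_filter.1 ha).2), ?_⟩) ?_ ?_ ?_
  · have h1 := size_update m.comp a.1 (addBox (m.comp a.1) a.2 (Finset.mem_filter.1 ha).2)
    rw [card_addBox] at h1
    have h2 : size m.comp = n := m.card_eq
    change size _ = _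
    omega
  · intro a ha
    exact Finset.mem_filter.2 ⟨Finset.mem_univ _, le_update_self_iff.2 (le_addBox _)⟩
  · rintro ⟨i, k⟩ ha ⟨j, k'⟩ hb e
    have e1 := congrArg MultiPartition.comp e
    simp only at e1
    have h1 : (k, (m.comp i).rowLen k) ∈ Function.update m.comp i
        (addBox (m.comp i) k (Finset.mem_filter.1 ha).2) i := by
      rw [Function.update_self]; exact mem_addBox.2 (Or.inl rfl)
    have h2 : (k, (m.comp i).rowLen k) ∉ m.comp i := by
      rw [YoungDiagram.mem_iff_lt_rowLen]; exact lt_irrefl _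
    rw [e1] at h1
    by_cases hij : i = j
    · subst hij
      rw [Function.update_self] at h1
      have := (mem_addBox.1 h1).resolve_right h2
      rw [Prod.mk.injEq] at this
      rw [this.1]
    · rw [Function.update_of_ne hij] at h1
      exact absurd h1 h2
  · intro l hl
    have hl' : m.comp ≤ l.comp := (Finset.mem_filter.1 hl).2
    -- The first row in which λ is longer than μ is addable for μ: the row above it, if any, is no
    -- longer in λ than in μ.
    have hex : ∃ k, ∃ i, (m.comp i).rowLen k < (l.comp i).rowLen k := by
      by_contra hc
      push Not at hc
      have := size_mono (f := l.comp) (g := m.comp) fun i x hx =>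
        YoungDiagram.mem_iff_lt_rowLen.2 ((YoungDiagram.mem_iff_lt_rowLen.1 hx).trans_le
          (hc x.1 i))
      have h1 : size m.comp = n := m.card_eq
      have h2 : size l.comp = n + 1 := l.card_eq
      omega
    obtain ⟨i, hi⟩ := Nat.find_spec hex
    set k := Nat.find hex with hk
    have hmem : (k, (m.comp i).rowLen k) ∈ l.comp i := YoungDiagram.mem_iff_lt_rowLen.2 hi
    have hadd : k = 0 ∨ (m.comp i).rowLen k < (m.comp i).rowLen (k - 1) := by
      by_cases h0 : k = 0
      · exact Or.inl h0
      right
      have h1 : ¬ ∃ i, (m.comp i).rowLen (k - 1) < (l.comp i).rowLen (k - 1) :=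
        Nat.find_min hex (by omega)
      push Not at h1
      exact (hi.trans_le ((l.comp i).rowLen_anti (k - 1) k (by omega))).trans_le (h1 i)
    have hkn : k < n + 1 := (row_lt_card hmem).trans_le (l.card_comp_le i)
    have ha : (i, k) ∈ m.addable := Finset.mem_filter.2
      ⟨Finset.mem_product.2 ⟨Finset.mem_univ _, Finset.mem_range.2 hkn⟩, hadd⟩
    refine ⟨(i, k), ha, MultiPartition.ext (eq_of_le_of_size_le ?_ ?_)⟩
    · refine update_le_iff.2 ⟨fun x hx => ?_, fun j _ => hl' j⟩
      rcases mem_addBox.1 hx with rfl | hx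
      · exact hmem
      · exact hl' i hx
    · have h1 := size_update m.comp i (addBox (m.comp i) k hadd)
      rw [card_addBox] at h1
      have h2 : size m.comp = n := m.card_eq
      have h3 : size l.comp = n + 1 := l.card_eq
      simp only
      omega

open Classical in
theorem card_covered (l : MultiPartition ℓ (n + 1)) :
    (Finset.univ.filter fun m : MultiPartition ℓ n => m.Covers l).card = l.removable.card := by
  symm
  refine Finset.card_bij (fun a ha => ⟨Function.update l.comp a.1
    (eraseBox (l.comp a.1) a.2 (Finset.mem_filter.1 ha).2), ?_⟩) ?_ ?_ ?_
  · have h1 := size_update l.comp a.1 (eraseBox (l.comp a.1) a.2 (Finset.mem_filter.1 ha).2)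
    have h2 : size l.comp = n + 1 := l.card_eq
    have h3 := card_eraseBox (Finset.mem_filter.1 ha).2
    change size _ = _
    omega
  · intro a ha
    exact Finset.mem_filter.2 ⟨Finset.mem_univ _, update_le_self_iff.2 (eraseBox_le _)⟩
  · rintro ⟨i, k⟩ ha ⟨j, k'⟩ hb e
    have e1 := congrArg MultiPartition.comp e
    simp only at e1
    have h1 : (k, (l.comp i).rowLen k - 1) ∉ Function.update l.comp i
        (eraseBox (l.comp i) k (Finset.mem_filter.1 ha).2) i := by
      rw [Function.update_self]; exact fun h => (mem_eraseBox.1 h).1 rfl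
    have h2 : (k, (l.comp i).rowLen k - 1) ∈ l.comp i := by
      have := (Finset.mem_filter.1 ha).2
      rw [YoungDiagram.mem_iff_lt_rowLen]; simp only at this; omega
    rw [e1] at h1
    by_cases hij : i = j
    · subst hij
      rw [Function.update_self, mem_eraseBox] at h1
      have : (k, (l.comp i).rowLen k - 1) = (k', (l.comp i).rowLen k' - 1) := by
        by_contra hc; exact h1 ⟨hc, h2⟩
      rw [Prod.mk.injEq] at this
      rw [this.1]
    · rw [Function.update_of_ne hij] at h1
      exact absurd h2 h1
  · intro m hm
    have hm' : m.comp ≤ l.comp := (Finset.mem_filter.1 hm).2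
    set S := (Finset.univ ×ˢ Finset.range (n + 1)).filter fun a : Fin ℓ × ℕ =>
      (m.comp a.1).rowLen a.2 < (l.comp a.1).rowLen a.2 with hS
    have hmemS : ∀ i k, (m.comp i).rowLen k < (l.comp i).rowLen k → (i, k) ∈ S := by
      intro i k h
      refine Finset.mem_filter.2 ⟨Finset.mem_product.2 ⟨Finset.mem_univ _, Finset.mem_range.2 ?_⟩, h⟩
      exact (row_lt_card (YoungDiagram.mem_iff_lt_rowLen.2 h)).trans_le (l.card_comp_le i)
    have hne : S.Nonempty := by
      by_contra hc
      rw [Finset.not_nonempty_iff_eq_empty] at hc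
      have := size_mono (f := l.comp) (g := m.comp) fun i x hx =>
        YoungDiagram.mem_iff_lt_rowLen.2 ((YoungDiagram.mem_iff_lt_rowLen.1 hx).trans_le
          (not_lt.1 fun h => by simpa [hc] using hmemS i x.1 h))
      have h1 : size m.comp = n := m.card_eq
      have h2 : size l.comp = n + 1 := l.card_eq
      omega
    -- In the last row k in which λ is longer than μ a box can be removed, since row k + 1 of λ is
    -- no longer than that of μ.
    obtain ⟨⟨i, k⟩, hik, hmax⟩ := Finset.exists_max_image S (fun a => a.2) hne
    have hlt : (m.comp i).rowLen k < (l.comp i).rowLen k := (Finset.mem_filter.1 hik).2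
    have hrem : (l.comp i).rowLen (k + 1) < (l.comp i).rowLen k := by
      have h1 : (l.comp i).rowLen (k + 1) ≤ (m.comp i).rowLen (k + 1) := by
        by_contra hc
        have := hmax _ (hmemS i (k + 1) (not_le.1 hc))
        simp at this
      exact (h1.trans ((m.comp i).rowLen_anti k (k + 1) (Nat.le_succ k))).trans_lt hlt
    have ha : (i, k) ∈ l.removable := Finset.mem_filter.2
      ⟨(Finset.mem_filter.1 hik).1, hrem⟩
    refine ⟨(i, k), ha, (MultiPartition.ext (eq_of_le_of_size_le ?_ ?_)).symm⟩
    · refine le_update_iff.2 ⟨fun x hx => ?_, fun j _ => hm' j⟩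
      refine mem_eraseBox.2 ⟨?_, hm' i hx⟩
      rintro rfl
      have := YoungDiagram.mem_iff_lt_rowLen.1 hx
      change (l.comp i).rowLen k - 1 < (m.comp i).rowLen k at this
      omega
    · have h1 := size_update l.comp i (eraseBox (l.comp i) k hrem)
      have h2 := card_eraseBox hrem
      have h3 : size m.comp = n := m.card_eq
      have h4 : size l.comp = n + 1 := l.card_eq
      simp only
      omega

theorem removable_zero (m : MultiPartition ℓ 0) : m.removable = ∅ := by
  simp [removable]

/-- Distinct multipartitions of n have a join with more than n boxes, so a common cover with n + 1
boxes is the join. Hence there is at most one common cover, and dually at most one common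
predecessor. -/
theorem eq_sup_of_covers {m m' : MultiPartition ℓ n} (hne : m ≠ m')
    {l : MultiPartition ℓ (n + 1)} (h : m.Covers l) (h' : m'.Covers l) :
    l.comp = m.comp ⊔ m'.comp := by
  refine (eq_of_le_of_size_le (sup_le h h') ?_).symm
  have h1 : size l.comp = n + 1 := l.card_eq
  have h2 : size m.comp = n := m.card_eq
  have h3 : size m'.comp = n := m'.card_eq
  rw [h1]
  by_contra hc
  have e1 : m.comp = m.comp ⊔ m'.comp := eq_of_le_of_size_le le_sup_left (by omega)
  have e2 : m'.comp = m.comp ⊔ m'.comp := eq_of_le_of_size_le le_sup_right (by omega)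
  exact hne (MultiPartition.ext (e1.trans e2.symm))

theorem eq_inf_of_covers {l l' : MultiPartition ℓ (n + 1)} (hne : l ≠ l')
    {m : MultiPartition ℓ n} (h : m.Covers l) (h' : m.Covers l') :
    m.comp = l.comp ⊓ l'.comp := by
  refine eq_of_le_of_size_le (le_inf h h') ?_
  have h1 : size m.comp = n := m.card_eq
  have h2 : size l.comp = n + 1 := l.card_eq
  have h3 : size l'.comp = n + 1 := l'.card_eq
  rw [h1]
  by_contra hc
  have e1 : l.comp ⊓ l'.comp = l.comp := eq_of_le_of_size_le inf_le_left (by omega)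
  have e2 : l.comp ⊓ l'.comp = l'.comp := eq_of_le_of_size_le inf_le_right (by omega)
  exact hne (MultiPartition.ext (e1.symm.trans e2))

open Classical in
theorem sum_inc_mul_inc_of_ne {m m' : MultiPartition ℓ n} (hne : m ≠ m') :
    ∑ l, m.inc l * m'.inc l = if size (m.comp ⊔ m'.comp) = n + 1 then 1 else 0 := by
  split_ifs with h
  · rw [Finset.sum_eq_single ⟨m.comp ⊔ m'.comp, h⟩]
    · have h1 : m.Covers ⟨m.comp ⊔ m'.comp, h⟩ := le_sup_left (a := m.comp)
      have h2 : m'.Covers ⟨m.comp ⊔ m'.comp, h⟩ := le_sup_right (a := m.comp)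
      simp [inc, h1, h2]
    · intro l _ hl
      unfold inc
      split_ifs with h1 h2
      · exact absurd (MultiPartition.ext (eq_sup_of_covers hne h1 h2)) hl
      all_goals rfl
    · simp
  · refine Finset.sum_eq_zero fun l _ => ?_
    unfold inc
    split_ifs with h1 h2
    · exact absurd (eq_sup_of_covers hne h1 h2 ▸ l.card_eq) h
    all_goals rfl

open Classical in
theorem sum_inc_mul_inc_of_ne' {l l' : MultiPartition ℓ (n + 1)} (hne : l ≠ l') :
    ∑ m : MultiPartition ℓ n, m.inc l * m.inc l' =
      if size (l.comp ⊓ l'.comp) = n then 1 else 0 := by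
  split_ifs with h
  · rw [Finset.sum_eq_single ⟨l.comp ⊓ l'.comp, h⟩]
    · have h1 : Covers ⟨l.comp ⊓ l'.comp, h⟩ l := inf_le_left (a := l.comp)
      have h2 : Covers ⟨l.comp ⊓ l'.comp, h⟩ l' := inf_le_right (a := l.comp)
      simp [inc, h1, h2]
    · intro m _ hm
      unfold inc
      split_ifs with h1 h2
      · exact absurd (MultiPartition.ext (eq_inf_of_covers hne h1 h2)) hm
      all_goals rfl
    · simp
  · refine Finset.sum_eq_zero fun m _ => ?_
    unfold inc
    split_ifs with h1 h2
    · exact absurd (eq_inf_of_covers hne h1 h2 ▸ m.card_eq) h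
    all_goals rfl

theorem inc_mul_self (m : MultiPartition ℓ n) (l : MultiPartition ℓ (n + 1)) :
    m.inc l * m.inc l = m.inc l := by
  unfold inc
  split_ifs <;> rfl

theorem sum_inc_self (m : MultiPartition ℓ n) :
    ∑ l, m.inc l * m.inc l = m.removable.card + ℓ := by
  classical
  simp only [inc_mul_self]
  rw [← card_addable, ← card_covers, Finset.card_filter]
  rfl

theorem sum_inc_self' (l : MultiPartition ℓ (n + 1)) :
    ∑ m : MultiPartition ℓ n, m.inc l * m.inc l = l.removable.card := by
  classical
  simp only [inc_mul_self]
  rw [← card_covered, Finset.card_filter]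
  rfl

open Classical in
/-- The commutation relation between adding and removing boxes. -/
theorem sum_inc_mul_inc (m m' : MultiPartition ℓ (n + 1)) :
    ∑ l, m.inc l * m'.inc l =
      (∑ k : MultiPartition ℓ n, k.inc m * k.inc m') + if m = m' then ℓ else 0 := by
  split_ifs with h
  · subst h
    rw [sum_inc_self, sum_inc_self']
  -- The join and the meet together have 2(n + 1) boxes, so the join has n + 2 of them exactly when
  -- the meet has n.
  · rw [sum_inc_mul_inc_of_ne h, sum_inc_mul_inc_of_ne' h, add_zero]
    have h1 := size_sup_add_size_inf m.comp m'.comp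
    have h2 : size m.comp = n + 1 := m.card_eq
    have h3 : size m'.comp = n + 1 := m'.card_eq
    congr 1
    rw [eq_iff_iff]
    omega

/-- The number of paths from the empty multipartition to `λ`. -/
def pathCount : (n : ℕ) → MultiPartition ℓ n → ℕ
  | 0, _ => 1
  | n + 1, l => ∑ m : MultiPartition ℓ n, m.inc l * pathCount n m

/-- With U adding and D removing a box, DU = UD + ℓ by `sum_inc_mul_inc`. Induction gives D Uⁿ⁺¹ ∅ =
ℓ (n + 1) Uⁿ ∅, as in Young's lattice. -/
theorem sum_inc_mul_pathCount (m : MultiPartition ℓ n) :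
    ∑ l, m.inc l * pathCount (n + 1) l = ℓ * (n + 1) * pathCount n m := by
  classical
  have key : ∀ {n : ℕ} (m : MultiPartition ℓ n), ∑ l, m.inc l * pathCount (n + 1) l =
      ∑ m' : MultiPartition ℓ n, (∑ l, m.inc l * m'.inc l) * pathCount n m' := by
    intro n m
    simp only [pathCount, Finset.mul_sum, Finset.sum_mul]
    rw [Finset.sum_comm]
    simp only [mul_assoc]
  induction n with
  | zero =>
    rw [key, Fintype.sum_eq_single m fun m' h => absurd (Subsingleton.elim m' m) h, sum_inc_self,
      removable_zero]
    simp
  | succ n ih =>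
    rw [key]
    simp only [sum_inc_mul_inc, add_mul, Finset.sum_add_distrib, ite_mul, zero_mul,
      Finset.sum_ite_eq, Finset.mem_univ, if_true]
    have h1 : ∑ m' : MultiPartition ℓ (n + 1), (∑ k : MultiPartition ℓ n, k.inc m * k.inc m') *
        pathCount (n + 1) m' = ℓ * (n + 1) * pathCount (n + 1) m := by
      simp only [Finset.sum_mul]
      rw [Finset.sum_comm]
      simp only [mul_assoc, ← Finset.mul_sum, ih]
      rw [pathCount, Finset.mul_sum, Finset.mul_sum]
      exact Finset.sum_congr rfl fun k _ => by ring
    rw [h1]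
    ring

/-- As D is adjoint to U, the squared norm of Uⁿ⁺¹ ∅ is the inner product of Uⁿ ∅ with D Uⁿ⁺¹ ∅,
that is, ℓ (n + 1) times the squared norm of Uⁿ ∅. -/
theorem sum_pathCount_sq (n : ℕ) :
    ∑ l : MultiPartition ℓ n, pathCount n l * pathCount n l = ℓ ^ n * n.factorial := by
  induction n with
  | zero =>
    have h0 : size (fun _ : Fin ℓ => (⊥ : YoungDiagram)) = 0 :=
      Finset.sum_eq_zero fun _ _ => rfl
    rw [Fintype.sum_eq_single (⟨_, h0⟩ : MultiPartition ℓ 0)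
      fun m' h => absurd (Subsingleton.elim m' _) h]
    simp [pathCount]
  | succ n ih =>
    have h1 : ∑ l : MultiPartition ℓ (n + 1), pathCount (n + 1) l * pathCount (n + 1) l =
        ∑ m : MultiPartition ℓ n, pathCount n m * ∑ l, m.inc l * pathCount (n + 1) l := by
      simp only [Finset.mul_sum]
      rw [Finset.sum_comm]
      refine Finset.sum_congr rfl fun l _ => ?_
      conv_lhs => rw [pathCount, Finset.sum_mul]
      exact Finset.sum_congr rfl fun m _ => by rw [pathCount]; ring
    rw [h1]
    simp only [sum_inc_mul_pathCount]
    rw [Nat.factorial_succ, pow_succ]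
    calc _ = ℓ * (n + 1) * ∑ m : MultiPartition ℓ n, pathCount n m * pathCount n m := by
          rw [Finset.mul_sum]; exact Finset.sum_congr rfl fun m _ => by ring
      _ = _ := by rw [ih]; ring

end MultiPartition

/-! ### From paths to standard tableaux. -/

namespace MultiPartition

variable {ℓ n : ℕ} {m : MultiPartition ℓ n} {l : MultiPartition ℓ (n + 1)}

/-- The boxes of `μ` as boxes of `λ`. -/
def Covers.incl (h : m.Covers l) (b : m.Box) : l.Box := ⟨b.1, h _ b.2⟩

theorem Covers.incl_injective (h : m.Covers l) : Function.Injective h.incl := fun _ _ e =>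
  Subtype.ext (congrArg (fun b : l.Box => b.1) e)

theorem Covers.eq_of_notMem (h : m.Covers l) {b b' : l.Box} (hb : b ∉ Set.range h.incl)
    (hb' : b' ∉ Set.range h.incl) : b = b' := by
  classical
  have h1 := Finset.card_compl (Finset.univ.image h.incl)
  rw [Finset.card_image_of_injective _ h.incl_injective, Finset.card_univ, l.card_box, m.card_box,
    Nat.add_sub_cancel_left] at h1
  exact Finset.card_le_one.1 h1.le b (by simpa using hb) b' (by simpa using hb')

open Classical in
/-- The extension of a tableau by the largest number. -/
def Covers.extendFun (h : m.Covers l) (t : m.Std) (b : l.Box) : Fin (n + 1) :=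
  if hb : b ∈ Set.range h.incl then (t.1 hb.choose).castSucc else Fin.last n

theorem Covers.extendFun_incl (h : m.Covers l) (t : m.Std) (b : m.Box) :
    h.extendFun t (h.incl b) = (t.1 b).castSucc := by
  have hb : h.incl b ∈ Set.range h.incl := ⟨b, rfl⟩
  rw [extendFun, dif_pos hb, h.incl_injective hb.choose_spec]

theorem Covers.extendFun_of_notMem (h : m.Covers l) (t : m.Std) {b : l.Box}
    (hb : b ∉ Set.range h.incl) : h.extendFun t b = Fin.last n := dif_neg hb

theorem Covers.extendFun_injective (h : m.Covers l) (t : m.Std) :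
    Function.Injective (h.extendFun t) := by
  intro b b' e
  by_cases hb : b ∈ Set.range h.incl
  · by_cases hb' : b' ∈ Set.range h.incl
    · obtain ⟨a, rfl⟩ := hb
      obtain ⟨a', rfl⟩ := hb'
      rw [extendFun_incl, extendFun_incl] at e
      rw [t.1.injective (Fin.castSucc_injective _ e)]
    · obtain ⟨a, rfl⟩ := hb
      rw [extendFun_incl, h.extendFun_of_notMem t hb'] at e
      exact absurd e (Fin.castSucc_lt_last _).ne
  · by_cases hb' : b' ∈ Set.range h.incl
    · obtain ⟨a', rfl⟩ := hb'
      rw [extendFun_incl, h.extendFun_of_notMem t hb] at e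
      exact absurd e.symm (Fin.castSucc_lt_last _).ne
    · exact h.eq_of_notMem hb hb'

/-- The standard tableau of shape `λ` with the largest number in the box outside `μ`. -/
def Covers.extend (h : m.Covers l) (t : m.Std) : l.Std :=
  ⟨Equiv.ofBijective (h.extendFun t) ((Fintype.bijective_iff_injective_and_card _).2
    ⟨h.extendFun_injective t, by rw [l.card_box, Fintype.card_fin]⟩), by
    have key : ∀ b b' : l.Box, b ≠ b' → b.comp = b'.comp → b.row ≤ b'.row → b.col ≤ b'.col →
        h.extendFun t b < h.extendFun t b' := by
      intro b b' hne hc hr hk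
      by_cases hb' : b' ∈ Set.range h.incl
      · obtain ⟨a', rfl⟩ := hb'
        have hm : (b.row, b.col) ∈ m.comp b.comp := by
          rw [hc]
          exact (m.comp a'.comp).up_left_mem hr hk a'.mem
        have e : b = h.incl ⟨b.1, hm⟩ := rfl
        rw [e, extendFun_incl, extendFun_incl, Fin.castSucc_lt_castSucc_iff]
        refine t.2.lt hc hr hk fun e' => hne ?_
        rw [e, e']
      · have hb : b ∈ Set.range h.incl := by
          by_contra hb
          exact hne (h.eq_of_notMem hb hb')
        obtain ⟨a, rfl⟩ := hb
        rw [extendFun_incl, h.extendFun_of_notMem t hb']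
        exact Fin.castSucc_lt_last _
    intro b b' hc
    refine ⟨fun hr hk => key b b' ?_ hc hr.le hk.le, fun hk hr => key b b' ?_ hc hr.le hk.le⟩
    · rintro rfl; exact lt_irrefl _ hk
    · rintro rfl; exact lt_irrefl _ hr⟩

/-- The smaller shape is recovered as the set of boxes whose entry is not the largest number. -/
theorem extend_injective : Function.Injective
    fun p : Σ m : {m : MultiPartition ℓ n // m.Covers l}, m.1.Std => p.1.2.extend p.2 := by
  rintro ⟨⟨m, hm⟩, t⟩ ⟨⟨m', hm'⟩, t'⟩ e
  have e1 : ∀ b, hm.extendFun t b = hm'.extendFun t' b := fun b =>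
    congrArg (fun u : l.Std => u.1 b) e
  have hle : m.comp ≤ m'.comp := by
    intro i x hx
    let a : m.Box := m.mkBox i x.1 x.2 hx
    have ha : hm.incl a ∈ Set.range hm'.incl := by
      by_contra hc
      have h1 := e1 (hm.incl a)
      rw [hm.extendFun_incl, hm'.extendFun_of_notMem t' hc] at h1
      exact (Fin.castSucc_lt_last _).ne h1
    obtain ⟨a', ha'⟩ := ha
    have h2 : a'.1 = a.1 := congrArg (fun b : l.Box => b.1) ha'
    have h3 := a'.2
    rw [h2] at h3
    exact h3
  have hmm : m = m' := MultiPartition.ext (eq_of_le_of_size_le hle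
    (m'.card_eq.trans m.card_eq.symm).le)
  subst hmm
  have htt : t = t' := Subtype.ext (Equiv.ext fun b => by
    have := e1 (hm.incl b)
    rw [hm.extendFun_incl, hm'.extendFun_incl] at this
    exact Fin.castSucc_injective _ this)
  rw [htt]

/-- Only this inequality is needed: the independence of the elements m_{s,t} bounds the number of
pairs of tableaux from above by the dimension. -/
theorem pathCount_le_card_std (l : MultiPartition ℓ n) : pathCount n l ≤ Fintype.card l.Std := by
  classical
  induction n with
  | zero =>
    rw [pathCount]
    exact Fintype.card_pos_iff.2 ⟨⟨l.initial, fun b => (l.initial b).elim0⟩⟩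
  | succ n ih =>
    refine le_trans ?_ (Fintype.card_le_of_injective _ (extend_injective (l := l)))
    have h1 : pathCount (n + 1) l =
        ∑ m ∈ Finset.univ.filter (fun m : MultiPartition ℓ n => m.Covers l), pathCount n m := by
      simp only [pathCount, inc, ite_mul, one_mul, zero_mul, Finset.sum_filter]
    rw [Fintype.card_sigma, h1, Finset.sum_subtype (Finset.univ.filter _)
      (fun m => by simp : ∀ m, m ∈ Finset.univ.filter (fun m : MultiPartition ℓ n => m.Covers l) ↔
        m.Covers l)]
    exact Finset.sum_le_sum fun m _ => ih m.1

theorem le_sum_card_std_sq (ℓ n : ℕ) : ℓ ^ n * n.factorial ≤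
    Fintype.card (Σ l : MultiPartition ℓ n, l.Std × l.Std) := by
  rw [Fintype.card_sigma, ← sum_pathCount_sq]
  refine Finset.sum_le_sum fun l _ => ?_
  rw [Fintype.card_prod]
  exact Nat.mul_le_mul (pathCount_le_card_std l) (pathCount_le_card_std l)

end MultiPartition

/-! ### A criterion for cellular bases -/

section Criterion

open Cellular

variable {A : Type*} [Ring A] [Algebra ℂ A] {L : Type*} [PartialOrder L] [Fintype L]
  {M K : L → Type*} [∀ l, Fintype (M l)] {C : (l : L) → M l → M l → A} {D : (l : L) → K l → A}
  {Z : (l : L) → M l → A} {G : (l : L) → M l → K l → ℂ}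

/-- Multiplication by `D_{l,q}` extracts the coefficients of shape `l`, if there are no smaller
shapes. -/
theorem sum_mul_of_shape (h0 : ∀ m l (s t : M m) (q : K l), ¬ m ≤ l → C m s t * D l q = 0)
    (h1 : ∀ l (s t : M l) (q : K l), C l s t * D l q = G l t q • Z l s)
    (c : (Σ l, M l × M l) → ℂ) (l : L) (hc : ∀ p, p.1 < l → c p = 0) (q : K l) :
    (∑ p, c p • C p.1 p.2.1 p.2.2) * D l q = ∑ u, (∑ v, c ⟨l, u, v⟩ * G l v q) • Z l u := by
  classical
  rw [Finset.sum_mul, Fintype.sum_sigma, Finset.sum_eq_single l, Fintype.sum_prod_type]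
  · refine Finset.sum_congr rfl fun u _ => ?_
    rw [Finset.sum_smul]
    refine Finset.sum_congr rfl fun v _ => ?_
    rw [smul_mul_assoc, h1, smul_smul]
  · intro m _ hm
    refine Finset.sum_eq_zero fun p _ => ?_
    by_cases hle : m ≤ l
    · rw [hc _ (lt_of_le_of_ne hle hm), zero_smul, zero_mul]
    · rw [smul_mul_assoc, h0 m l _ _ q hle, smul_zero]
  · exact fun h => absurd (Finset.mem_univ l) h

/-- Induction from smaller to larger shapes. Once the coefficients of the shapes below m vanish,
multiplication by D_{m,q} leaves only shape m; the independence of the Z_u and the nondegeneracy of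
G then remove its coefficients. -/
theorem coeff_eq_zero_of_mul_eq_zero
    (h0 : ∀ m l (s t : M m) (q : K l), ¬ m ≤ l → C m s t * D l q = 0)
    (h1 : ∀ l (s t : M l) (q : K l), C l s t * D l q = G l t q • Z l s)
    (hG : ∀ l (v : M l → ℂ), (∀ q, ∑ t, v t * G l t q = 0) → v = 0)
    (hZ : ∀ l, LinearIndependent ℂ (Z l)) (c : (Σ l, M l × M l) → ℂ) (P : L → Prop)
    (hP : ∀ m m', m' < m → P m → P m')
    (hc : ∀ m, P m → ∀ q, (∑ p, c p • C p.1 p.2.1 p.2.2) * D m q = 0) (m : L) (hm : P m)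
    (u v : M m) : c ⟨m, u, v⟩ = 0 := by
  induction m using WellFoundedLT.induction with
  | ind m ih =>
    have h2 : ∀ q u, ∑ v, c ⟨m, u, v⟩ * G m v q = 0 := fun q =>
      Fintype.linearIndependent_iff.1 (hZ m) _ (by
        rw [← sum_mul_of_shape h0 h1 c m (fun p hp => ih p.1 hp (hP m p.1 hp hm) _ _) q, hc m hm])
    exact congrFun (hG m (fun v => c ⟨m, u, v⟩) fun q => h2 q u) v

/-- Independence follows from the extraction of coefficients, and the dimension bound gives
spanning. For the cell property, a C_{s,t} is expanded in the basis: the shapes not above l drop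
out, and those of shape l are read off from the action of a on the span of the Z_u, which does not
involve t. -/
theorem isCellularBasis_of_pairing [Module.Finite ℂ A] {star : A →ₐ[ℂ] Aᵐᵒᵖ}
    (hs : ∀ a, unop (star (unop (star a))) = a)
    (hC : ∀ l (s t : M l), unop (star (C l s t)) = C l t s)
    (h0 : ∀ m l (s t : M m) (q : K l), ¬ m ≤ l → C m s t * D l q = 0)
    (h1 : ∀ l (s t : M l) (q : K l), C l s t * D l q = G l t q • Z l s)
    (hG : ∀ l (v : M l → ℂ), (∀ q, ∑ t, v t * G l t q = 0) → v = 0)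
    (hZ : ∀ l, LinearIndependent ℂ (Z l))
    (hdim : Module.finrank ℂ A ≤ Fintype.card (Σ l, M l × M l)) : IsCellularBasis star C := by
  classical
  have hli : LinearIndependent ℂ (fun p : Σ l, M l × M l => C p.1 p.2.1 p.2.2) := by
    rw [Fintype.linearIndependent_iff]
    rintro c hc ⟨m, u, v⟩
    exact coeff_eq_zero_of_mul_eq_zero h0 h1 hG hZ c (fun _ => True) (fun _ _ _ _ => trivial)
      (fun m _ q => by rw [hc, zero_mul]) m trivial u v
  have hspan := hli.span_eq_top_of_card_eq_finrank' (le_antisymm hli.fintype_card_le_finrank hdim)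
  refine ⟨hli, hspan, hs, hC, fun l a => ?_⟩
  have hexp : ∀ s t : M l, ∃ c : (Σ l, M l × M l) → ℂ,
      a * C l s t = ∑ p, c p • C p.1 p.2.1 p.2.2 ∧ (∀ p, ¬ l ≤ p.1 → c p = 0) ∧
      ∀ q, G l t q • (a * Z l s) = ∑ u, (∑ v, c ⟨l, u, v⟩ * G l v q) • Z l u := by
    intro s t
    have hmem : a * C l s t ∈ Submodule.span ℂ
        (Set.range fun p : Σ l, M l × M l => C p.1 p.2.1 p.2.2) := by
      rw [hspan]; trivial
    obtain ⟨c, hc⟩ := (Submodule.mem_span_range_iff_exists_fun ℂ).1 hmem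
    have hc0 : ∀ p : Σ l, M l × M l, ¬ l ≤ p.1 → c p = 0 := fun p hp =>
      -- The shapes m with not l ≤ m are closed under going down, and for each of them D_{m,q} kills
      -- C_{s,t}, hence also a C_{s,t}.
      coeff_eq_zero_of_mul_eq_zero h0 h1 hG hZ c (fun m => ¬ l ≤ m)
        (fun m m' hlt hm hle => hm (hle.trans hlt.le))
        (fun m hm q => by rw [hc, mul_assoc, h0 l m s t q hm, mul_zero]) p.1 hp _ _
    refine ⟨c, hc.symm, hc0, fun q => ?_⟩
    rw [← sum_mul_of_shape h0 h1 c l (fun p hp => hc0 p hp.not_ge) q, hc, mul_assoc, h1,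
      mul_smul_comm]
  have hR : ∀ s : M l, ∃ R : M l → ℂ, a * Z l s = ∑ u, R u • Z l u := by
    intro s
    obtain ⟨c, -, -, hc⟩ := hexp s s
    -- No row of G vanishes, so one can divide by an entry: left multiplication by a preserves the
    -- span of the Z_u.
    obtain ⟨q, hq⟩ : ∃ q, G l s q ≠ 0 := by
      by_contra hne
      push Not at hne
      have := congrFun (hG l (Pi.single s 1) fun q => by
        rw [Finset.sum_eq_single s (fun t _ ht => by simp [ht]) (by simp), hne, mul_zero]) s
      simp at this
    refine ⟨fun u => (G l s q)⁻¹ * ∑ v, c ⟨l, u, v⟩ * G l v q, ?_⟩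
    simp only [mul_smul, ← Finset.smul_sum]
    rw [← hc q, smul_smul, inv_mul_cancel₀ hq, one_smul]
  choose R hR using hR
  refine ⟨R, fun s t => ?_⟩
  obtain ⟨c, hc, hc0, hcZ⟩ := hexp s t
  -- Comparing the coefficients of Z_u and using nondegeneracy of G shows that a changes only the
  -- first index.
  have hcl : ∀ u v, c ⟨l, u, v⟩ = if v = t then R s u else 0 := by
    intro u v
    refine sub_eq_zero.1 (congrFun (hG l (fun v => c ⟨l, u, v⟩ - if v = t then R s u else 0)
      fun q => ?_) v)
    have h2 := hcZ q
    rw [hR, Finset.smul_sum, ← sub_eq_zero, ← Finset.sum_sub_distrib] at h2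
    simp only [smul_smul, ← sub_smul] at h2
    have h3 := Fintype.linearIndependent_iff.1 (hZ l) _ h2 u
    simp only [sub_mul, Finset.sum_sub_distrib, ite_mul, zero_mul, Finset.sum_ite_eq',
      Finset.mem_univ, if_true]
    rw [← neg_eq_zero, ← h3]
    ring
  rw [hc, Fintype.sum_sigma, ← Finset.add_sum_erase _ _ (Finset.mem_univ l)]
  have hl : ∑ p : M l × M l, c ⟨l, p⟩ • C l p.1 p.2 = ∑ u, R s u • C l u t := by
    rw [Fintype.sum_prod_type]
    simp [hcl, ite_smul]
  rw [hl, add_sub_cancel_left]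
  refine Submodule.sum_mem _ fun m hm => Submodule.sum_mem _ fun p _ => ?_
  by_cases hle : l ≤ m
  · exact Submodule.smul_mem _ _ (Submodule.subset_span
      ⟨m, lt_of_le_of_ne hle (Finset.ne_of_mem_erase hm).symm, p.1, p.2, rfl⟩)
  · rw [hc0 ⟨m, p⟩ hle, zero_smul]
    exact Submodule.zero_mem _

end Criterion

/-! ### Dual cell modules -/

section Duality

open Cellular

variable {A : Type*} [Ring A] [Algebra ℂ A] {L : Type*} [PartialOrder L]
  {M : L → Type*} [∀ l, Fintype (M l)] {star : A →ₐ[ℂ] Aᵐᵒᵖ} {C N : (l : L) → M l → M l → A}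

/-- A nondegenerate invariant pairing of cell modules gives an isomorphism of one of them with the
contragredient dual of the other one. -/
theorem nonempty_contraDual_equiv (hm : IsCellularBasis star C) (hn : IsCellularBasis star N)
    (l l' : L) (G : M l → M l' → ℂ)
    (hG : ∀ a s q, ∑ u, hm.coeff l (unop (star a)) s u * G u q = ∑ v, hn.coeff l' a q v * G s v)
    (hinj : ∀ v : M l' → ℂ, (∀ t, ∑ q, v q * G t q = 0) → v = 0)
    (hcard : Fintype.card (M l') = Fintype.card (M l)) :
    Nonempty (ContraDual star (CellModule hm l) ≃ₗ[Aᵐᵒᵖ] CellModule hn l') := by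
  classical
  let T : (M l' → ℂ) →ₗ[ℂ] (M l → ℂ) :=
    { toFun := fun h t => ∑ q, h q * G t q
      map_add' := fun h h' => by
        funext t; simp only [Pi.add_apply, add_mul, Finset.sum_add_distrib]
      map_smul' := fun c h => by
        funext t; simp only [Pi.smul_apply, smul_eq_mul, mul_assoc, Finset.mul_sum,
          RingHom.id_apply] }
  have hT : Function.Injective T := by
    rw [← LinearMap.ker_eq_bot, LinearMap.ker_eq_bot']
    exact fun h e => hinj h fun t => congrFun e t
  have hT' : Function.Surjective T :=
    (LinearMap.injective_iff_surjective_of_finrank_eq_finrank (by simpa using hcard)).1 hT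
  let ψ : (M l' → ℂ) → (M l → ℂ) →ₗ[ℂ] ℂ := fun h => Fintype.linearCombination ℂ (T h)
  have hψ : ∀ h (f : M l → ℂ), ψ h f = ∑ t, f t * ∑ q, h q * G t q := fun h f => by
    simp [ψ, T, Fintype.linearCombination_apply]
  have hadd : ∀ h h' : M l' → ℂ, ψ (h + h') = ψ h + ψ h' := fun h h' =>
    LinearMap.ext fun f => by
      rw [LinearMap.add_apply, hψ, hψ, hψ, ← Finset.sum_add_distrib]
      refine Finset.sum_congr rfl fun t _ => ?_
      rw [← mul_add, ← Finset.sum_add_distrib]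
      simp only [Pi.add_apply, add_mul]
  have hact : ∀ (a : A) (h : M l' → ℂ) (f : M l → ℂ),
      ψ (fun q => ∑ v, h v * hn.coeff l' (unop (star a)) v q) f =
        ψ h fun u => ∑ s, f s * hm.coeff l (unop (star (unop (star a)))) s u := by
    intro a h f
    rw [hψ, hψ]
    simp only [Finset.sum_mul]
    rw [Finset.sum_comm (s := Finset.univ (α := M l))]
    simp only [mul_assoc, ← Finset.mul_sum]
    refine Finset.sum_congr rfl fun s _ => congrArg (f s * ·) ?_
    rw [Finset.sum_comm]
    simp only [← Finset.mul_sum, ← hG]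
    simp only [Finset.mul_sum]
    rw [Finset.sum_comm]
    exact Finset.sum_congr rfl fun u _ => Finset.sum_congr rfl fun v _ => by ring
  let Ψ : CellModule hn l' →ₗ[Aᵐᵒᵖ] ContraDual star (CellModule hm l) :=
    { toFun := ψ
      map_add' := hadd
      map_smul' := fun a h => LinearMap.ext fun f => hact (unop a) h f }
  have hΨ : Function.Bijective Ψ := by
    constructor
    · intro h h' e
      refine hT (funext fun t => ?_)
      have := congrArg (fun φ : ContraDual star (CellModule hm l) =>
        φ.toFun (Pi.single t 1 : M l → ℂ)) e
      change ψ h (Pi.single t 1) = ψ h' (Pi.single t 1) at this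
      simpa [ψ, Fintype.linearCombination_apply_single] using this
    · intro φ
      obtain ⟨h, hh⟩ := hT' fun t => φ.toFun (Pi.single t 1 : M l → ℂ)
      refine ⟨h, ?_⟩
      change ψ h = (φ : (M l → ℂ) →ₗ[ℂ] ℂ)
      refine LinearMap.pi_ext' fun t => LinearMap.ext_ring ?_
      simp only [ψ, LinearMap.comp_apply, LinearMap.coe_single,
        Fintype.linearCombination_apply_single, one_smul, hh]
      rfl
  exact ⟨(LinearEquiv.ofBijective Ψ hΨ).symm⟩

end Duality

/-! ### The cellular bases of the degenerate cyclotomic Hecke algebra -/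

section Main

open Cellular

variable {ℓ : ℕ} {ω : Fin ℓ → ℂ} {n : ℕ} {q : Fin ℓ → ℂ} {c : Fin ℓ → Fin 2}

theorem cycPoly_rev (q : Fin ℓ → ℂ) : cycPoly (fun i => q i.rev) = cycPoly q :=
  Equiv.prod_comp Fin.revPerm fun i => Polynomial.X - Polynomial.C (q i)

theorem nonempty_std {l : MultiPartition ℓ n} : Nonempty l.Std :=
  ⟨⟨l.initial, fun _ _ hc => ⟨fun hr hk => (monoEquivOfFin l.Box l.card_box).symm.strictMono
      (Prod.Lex.lt_iff.2 (Or.inr ⟨hc, Prod.Lex.lt_iff.2 (Or.inr ⟨hr, hk⟩)⟩)),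
    fun _ hr => (monoEquivOfFin l.Box l.card_box).symm.strictMono
      (Prod.Lex.lt_iff.2 (Or.inr ⟨hc, Prod.Lex.lt_iff.2 (Or.inl hr)⟩))⟩⟩⟩

theorem spechtElt_ne_zero (hℓ : 0 < ℓ) {l : MultiPartition ℓ (n + 1)} (s : l.Std) :
    spechtElt ω q c l s ≠ 0 :=
  (linearIndependent_spechtElt hℓ).ne_zero s

theorem spechtGen_ne_zero (hℓ : 0 < ℓ) (l : MultiPartition ℓ (n + 1)) :
    spechtGen ω q c l ≠ 0 := by
  obtain ⟨s⟩ := nonempty_std (l := l)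
  intro h
  refine spechtElt_ne_zero (ω := ω) (q := q) (c := c) hℓ s ?_
  rw [spechtElt, h, mul_zero]

theorem isCellularBasis_cellElt (hℓ : 0 < ℓ) (hq : cycPoly q = cycPoly ω) (c : Fin ℓ → Fin 2) :
    IsCellularBasis (heckeStar ω (r := n + 1)) (cellElt ω q c) := by
  have : Module.Finite ℂ (Hecke ω (n + 1)) := hecke_finite ω hℓ
  refine isCellularBasis_of_pairing (D := coElt ω q c) (Z := spechtElt ω q c)
    (G := pairing hq c) (st_st ω) (fun l => st_cellElt) ?_ (fun l => cellElt_mul_coElt hq) ?_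
    (fun l => linearIndependent_spechtElt hℓ)
    ((finrank_hecke_le ω hℓ).trans (MultiPartition.le_sum_card_std_sq ℓ (n + 1)))
  · intro m l s t p h
    have := cellElt_mul_mul_coElt_eq_zero (c := c) hq h s t 1 p
    rwa [mul_one] at this
  · intro l v hv
    exact eq_zero_of_triangular MultiPartition.rowSeq
      (M := fun t u => pairing hq c l t (l.dualStd u))
      (pairing_dualStd_self hq (spechtGen_ne_zero hℓ l))
      (fun t u => pairing_dualStd_of_ne_zero hq (spechtGen_ne_zero hℓ l))
      fun u => hv (l.dualStd u)

/-- This is `cellGen_mul_mul_eq_zero` for the reversed data and λ', turned around by the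
anti-automorphism; reversal and `coSign` are involutions. -/
theorem cellGen_mul_mul_eq_zero' (hq : cycPoly q = cycPoly ω) {r : ℕ} {l m : MultiPartition ℓ r}
    (hm : ¬ m ≤ l.dual) (a : Hecke ω r) :
    cellGen ω q c l * a * cellGen ω (fun i => q i.rev) (coSign c) m = 0 := by
  have h := cellGen_mul_mul_eq_zero (c := coSign c) ((cycPoly_rev q).trans hq) hm (st ω a)
  simp only [Fin.rev_rev, coSign_coSign, MultiPartition.dual_dual] at h
  have h' := congrArg (st ω) h
  rw [st_mul, st_mul, st_st, st_cellGen, st_cellGen, st_zero, ← mul_assoc] at h'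
  exact h'

/-- The element m_{s,s} a d(p)⁻¹ n_λ' is a multiple of d(s)⁻¹ z_λ in two ways. Absorbing a into
m_{s,s}, after applying the anti-automorphism, gives the left-hand side, and absorbing it into
d(p)⁻¹ n_λ' the right-hand side; terms of larger shape vanish by (A). As d(s)⁻¹ z_λ ≠ 0, the scalars
agree. -/
theorem pairing_invariant (hℓ : 0 < ℓ) (hq : cycPoly q = cycPoly ω)
    (hm : IsCellularBasis (heckeStar ω (r := n + 1)) (cellElt ω q c))
    (hn : IsCellularBasis (heckeStar ω (r := n + 1)) (cellElt ω (fun i => q i.rev) (coSign c)))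
    (l : MultiPartition ℓ (n + 1)) (a : Hecke ω (n + 1)) (s : l.Std) (p : l.dual.Std) :
    ∑ u, hm.coeff l (st ω a) s u * pairing hq c l u p =
      ∑ v, hn.coeff l.dual a p v * pairing hq c l s v := by
  have h1 : cellElt ω q c l s s * a * coElt ω q c l p =
      (∑ u, hm.coeff l (st ω a) s u * pairing hq c l u p) • spechtElt ω q c l s := by
    have hker : ∀ y ∈ upper (cellElt ω q c) l, st ω y * coElt ω q c l p = 0 := by
      intro y hy
      unfold upper at hy
      induction hy using Submodule.span_induction with
      | mem y hy =>
        obtain ⟨m, hlt, u, v, rfl⟩ := hy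
        have := cellElt_mul_mul_coElt_eq_zero (c := c) hq hlt.not_ge v u 1 p
        rwa [mul_one, ← st_cellElt] at this
      | zero => rw [st_zero, zero_mul]
      | add y z _ _ hy hz => rw [st_add, add_mul, hy, hz, add_zero]
      | smul b y _ hy => rw [st_smul, smul_mul_assoc, hy, smul_zero]
    have h := hker _ (hm.coeff_spec l (st ω a) s s)
    rw [sub_eq_add_neg, ← neg_one_smul ℂ, st_add, st_smul, st_mul, st_st, st_cellElt, st_sum,
      add_mul, neg_one_smul, neg_mul, ← sub_eq_add_neg, sub_eq_zero] at h
    rw [h, Finset.sum_mul, Finset.sum_smul]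
    refine Finset.sum_congr rfl fun u _ => ?_
    rw [st_smul, st_cellElt, smul_mul_assoc, cellElt_mul_coElt hq, smul_smul]
  have h2 : cellElt ω q c l s s * a * coElt ω q c l p =
      (∑ v, hn.coeff l.dual a p v * pairing hq c l s v) • spechtElt ω q c l s := by
    have hN : ∀ u v : l.dual.Std, cellElt ω (fun i => q i.rev) (coSign c) l.dual u v =
        coElt ω q c l u * pm ω (tabPerm v) := fun u v => rfl
    have hker : ∀ y ∈ upper (cellElt ω (fun i => q i.rev) (coSign c)) l.dual,
        cellElt ω q c l s s * y = 0 := by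
      intro y hy
      unfold upper at hy
      induction hy using Submodule.span_induction with
      | mem y hy =>
        obtain ⟨m, hlt, u, v, rfl⟩ := hy
        have := cellGen_mul_mul_eq_zero' (c := c) hq hlt.not_ge
          (pm ω (tabPerm s) * pm ω (tabPerm u)⁻¹)
        rw [cellElt, cellElt]
        calc _ = pm ω (tabPerm s)⁻¹ * (cellGen ω q c l * (pm ω (tabPerm s) *
              pm ω (tabPerm u)⁻¹) * cellGen ω (fun i => q i.rev) (coSign c) m) *
              pm ω (tabPerm v) := by simp only [mul_assoc]
          _ = 0 := by rw [this, mul_zero, zero_mul]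
      | zero => rw [mul_zero]
      | add y z _ _ hy hz => rw [mul_add, hy, hz, add_zero]
      | smul b y _ hy => rw [mul_smul_comm, hy, smul_zero]
    have h := hker _ (hn.coeff_spec l.dual a p p)
    -- The cell property concerns the basis elements d(p)⁻¹ n_λ' d(p), so the invertible factor d(p)
    -- is appended first and cancelled afterwards.
    have hcancel : ∀ y z : Hecke ω (n + 1), y * pm ω (tabPerm p) = z * pm ω (tabPerm p) →
        y = z := fun y z e => by
      rw [← mul_one y, ← mul_one z, ← pm_mul_inv ω (tabPerm p), ← mul_assoc, e, mul_assoc]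
    rw [mul_sub, sub_eq_zero] at h
    refine hcancel _ _ ?_
    rw [mul_assoc, mul_assoc, ← hN, h, Finset.mul_sum, Finset.sum_smul, Finset.sum_mul]
    refine Finset.sum_congr rfl fun v _ => ?_
    rw [mul_smul_comm, hN, ← mul_assoc, cellElt_mul_coElt hq, mul_smul, smul_mul_assoc,
      smul_mul_assoc, smul_mul_assoc]
  have h3 := h1.symm.trans h2
  rw [← sub_eq_zero, ← sub_smul, smul_eq_zero] at h3
  exact sub_eq_zero.1 (h3.resolve_right (spechtElt_ne_zero hℓ s))

theorem nonempty_contraDual_cellModule_equiv (hℓ : 0 < ℓ) (hq : cycPoly q = cycPoly ω)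
    (hm : IsCellularBasis (heckeStar ω (r := n + 1)) (cellElt ω q c))
    (hn : IsCellularBasis (heckeStar ω (r := n + 1)) (cellElt ω (fun i => q i.rev) (coSign c)))
    (l : MultiPartition ℓ (n + 1)) :
    Nonempty (ContraDual (heckeStar ω (r := n + 1)) (CellModule hm l)
      ≃ₗ[(Hecke ω (n + 1))ᵐᵒᵖ] CellModule hn l.dual) := by
  refine nonempty_contraDual_equiv hm hn l l.dual (pairing hq c l)
    (pairing_invariant hℓ hq hm hn l) (fun v hv => ?_) (Fintype.card_congr l.dualStd).symm
  -- Nondegeneracy on the other side concerns the transposed matrix, which is triangular for the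
  -- opposite order.
  have h := eq_zero_of_triangular (v := fun u => v (l.dualStd u))
    (fun u => OrderDual.toDual (MultiPartition.rowSeq u))
    (M := fun u t => pairing hq c l t (l.dualStd u))
    (pairing_dualStd_self hq (spechtGen_ne_zero hℓ l))
    (fun u t h => (pairing_dualStd_of_ne_zero hq (spechtGen_ne_zero hℓ l) h).imp Eq.symm id)
    fun t => (Equiv.sum_comp l.dualStd fun p => v p * pairing hq c l t p).trans (hv t)
  funext p
  have := congrFun h (l.dualStd.symm p)
  simpa using this

end Main

end DegHecke

end

theorem mainTheorem10 (ℓ r : ℕ) (hℓ : 0 < ℓ) (hr : 0 < r) (ω : Fin ℓ → ℂ) (c : Fin ℓ → Fin 2) :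
    ∃ (hm : Cellular.IsCellularBasis (DegHecke.heckeStar ω (r := r)) (DegHecke.mBasis ω c))
      (hn : Cellular.IsCellularBasis (DegHecke.heckeStar ω (r := r)) (DegHecke.nBasis ω c)),
      ∀ l : DegHecke.MultiPartition ℓ r,
        Nonempty
          (Cellular.ContraDual (DegHecke.heckeStar ω (r := r)) (Cellular.CellModule hm l)
            ≃ₗ[(DegHecke.Hecke ω r)ᵐᵒᵖ] Cellular.CellModule hn l.dual) := by
  obtain ⟨n, rfl⟩ : ∃ n, r = n + 1 := ⟨r - 1, by omega⟩
  rw [DegHecke.mBasis_eq, DegHecke.nBasis_eq]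
  exact ⟨DegHecke.isCellularBasis_cellElt hℓ rfl c,
    DegHecke.isCellularBasis_cellElt hℓ (DegHecke.cycPoly_rev ω) (DegHecke.coSign c),
    DegHecke.nonempty_contraDual_cellModule_equiv hℓ rfl _ _⟩
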